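/- Let $\Bbbk$ be a field of characteristic $0$; dg vector spaces have differentials of degree $+1$ and all signs follow the Koszul rule. **Properads.** A properad $\mathcal P$ consists of dg vector spaces $\mathcal P(C,D)$ for all finite sets $C$ (outputs) and $D$ (inputs), functorial in pairs of bijections $(\rho,\sigma):(C,D)\to(C',D')$, and of degree $0$ chain maps $${}_B\overset{\eta}{\circ}_A:\mathcal P(C_1,D_1\sqcup B)\otimes\mathcal P(C_2\sqcup A,D_2)\to\mathcal P(C_1\sqcup C_2,D_1\sqcup D_2)$$ for all bijections $\eta:B\to A$ of finite nonempty sets, which are equivariant and satisfy the associativity axioms of a properad: (a) $(x\circ y)\circ z=x\circ(y\circ z)$ whenever $x$ is glued to $y$, $y$ to $z$, and possibly also $x$ to $z$; (b) $x\circ(y\circ z)=(-1)^{|x||y|}\,y\circ(x\circ z)$ when $x$ and $y$ are both glued to outputs of $z$ and not to each other; (c) $(x\circ z)\circ y=(-1)^{|y||z|}(x\circ y)\circ z$ when $y$ and $z$ are both glued to inputs of $x$ and not to each other (all up to the evident relabellings). Let $\mathcal P$ be such that each $\mathcal P(C,D)=\bigoplus_{G\ge 0}\mathcal P(C,D,G)$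 has an additional grading by $G\in\mathbb N_0$, preserved by the differential and by the action of bijections, such that every $\mathcal P(C,D,G)$ is finite dimensional and vanishes unless $\chi:=2G+|C|+|D|-2>0$, and such that for given $C_1,C_2,D_1,D_2,G$ the component $\mathcal P(C_1,D_1\sqcup B,G_1)\otimes\mathcal P(C_2\sqcup A,D_2,G_2)\to\mathcal P(C_1\sqcup C_2,D_1\sqcup D_2,G)$ of the operations is nonzero for only finitely many $(|A|,G_1,G_2)$. We write $\mathcal P(C,D,\chi)$ for $\mathcal P(C,D,G)$. **Cobar complex.** $C\mathcal P$ is the free properad generated by the suspended duals $\uparrow\!\mathcal P(C,D,\chi)^{\#}$ (with $\uparrow$ of degree $+1$, so that $\uparrow\!\xi$ has degree $1-i$ if $\xi$ is a functional on the part of degree $i$), with the differential that on generators is $$\partial=d_{\mathcal P^{\#}}+\sum_{C_1\sqcup C_2=C,\ D_1\sqcup D_2=D}\ \sum_{|A|\ge 1}\ \sum_{\chi_1,\chi_2>0}\frac1{|A|!}\Big({}_B\overset{\eta}{\circ}_A\Big)^{\#}_{\mathcal P},$$ and that is extended by the Leibniz rule. Here $d_{\mathcal P^\#}\xi=(-1)^{|\xi|}\xi\circ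 d$; for each value of $|A|$ just one pair of sets $A,B$ and one bijection $\eta:B\to A$ is taken; and the dual of the operation, restricted to the parts of degrees $i$ and $j$ of $\mathcal P(C_1,D_1\sqcup B,\chi_1)$ and $\mathcal P(C_2\sqcup A,D_2,\chi_2)$, takes $\xi$ to $(-1)^{i(1+j)}\sum_{a,b}\xi(p_a\circ q_b)\,\uparrow\!p_a^{\#}\circ\uparrow\!q_b^{\#}$ for bases $p_a$, $q_b$ of these parts. **Endomorphism properad and algebras.** For a dg vector space $V$ let $\bigodot_C V$ be the unordered tensor product of copies of $V$ indexed by the finite set $C$ (reordering the factors produces Koszul signs), and let $\mathcal E_V(C,D,\chi)=\mathcal E_V(C,D)=\operatorname{Hom}_\Bbbk(\bigodot_DV,\bigodot_CV)$ with $d(f)=d\circ f-(-1)^{|f|}f\circ d$, with bijections acting by conjugation, and with $g\,{}_B\overset{\eta}{\circ}_A f$ the composite $$\textstyle\bigodot_{D_1\sqcup D_2}V\cong\bigodot_{D_1}V\otimes\bigodot_{D_2}V\xrightarrow{\mathrm{id}\otimes f}\bigodot_{D_1}V\otimes\bigodot_{C_2\sqcup A}V\overset{\eta^{-1}}{\cong}\bigodot_{D_1\sqcup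 B}V\otimes\bigodot_{C_2}V\xrightarrow{g\otimes\mathrm{id}}\bigodot_{C_1}V\otimes\bigodot_{C_2}V\cong\bigodot_{C_1\sqcup C_2}V.$$ An algebra over $C\mathcal P$ on $V$ is a morphism $\alpha:C\mathcal P\to\mathcal E_V$, that is, a collection of degree $0$ chain maps compatible with the actions of bijections and with the operations. **The space $P$.** Let $P=\prod_{m,n\ge0,\ \chi>0}P(m,n,\chi)$, where $P(m,n,\chi)={}^{\Sigma_m}\big(\mathcal P([m],[n],\chi)\otimes\mathcal E_V([m],[n],\chi)\big)^{\Sigma_n}$ is the space of invariants of the diagonal $\Sigma_m\times\Sigma_n$-action. Let $d=d_{\mathcal P}\otimes\mathrm{id}-\mathrm{id}\otimes d_{\mathcal E_V}$ on $P$, and let the $(m,n,\chi)$-component of $g\circ h$ for $g,h\in P$ be the component in $\mathcal P([m],[n],\chi)\otimes\mathcal E_V([m],[n],\chi)$ of $$\sum_{C_1\sqcup C_2=[m],\ D_1\sqcup D_2=[n]}\ \sum_{|A|\ge1}\ \sum_{\chi_1,\chi_2>0}\frac1{|A|!}\Big(({}_B\overset{\eta}{\circ}_A)_{\mathcal P}\otimes({}_B\overset{\eta}{\circ}_A)_{\mathcal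 E_V}\Big)\,\sigma_{23}\,\big(g_{C_1,D_1\sqcup B,\chi_1}\otimes h_{C_2\sqcup A,D_2,\chi_2}\big),$$ where again one $\eta:B\to A$ is taken for each value of $|A|$, where $\sigma_{23}$ exchanges the two middle factors (with the Koszul sign), and where $g_{C,D,\chi}$ is obtained from the component $g_{|C|,|D|,\chi}$ by relabelling along arbitrary bijections $[|C|]\to C$ and $[|D|]\to D$. **Theorem.** For every dg vector space $V$, the algebras over the cobar complex $C\mathcal P$ on $V$ are in bijection with the elements $L\in P$ of degree $1$ that satisfy the master equation $$d(L)+L\circ L=0 .$$ The bijection sends $\alpha$ to the element $L$ with components $L_{m,n,\chi}=\sum_i p_i\otimes\alpha(\uparrow\!p_i^{\#})$, where $\{p_i\}$ is a homogeneous basis of $\mathcal P([m],[n],\chi)$ and $\{p_i^{\#}\}$ is its dual basis. -/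

import Mathlib

open scoped TensorProduct

universe w u u' v

noncomputable section

namespace CobarMaster

/-! ### Signs and gradings -/

/-- The sign `(-1)^n` as an element of the ground field. -/
def sgn (k : Type w) [Field k] (n : ℤ) : k := ((n.negOnePow : ℤ) : k)

section Grading

variable {k : Type w} [Field k] {ι : Type} [DecidableEq ι] {M : Type u} [AddCommGroup M] [Module k M]
  {𝒜 : ι → Submodule k M}

/-- The decomposition of a module into the pieces of an internal grading. -/
def decomp (h : DirectSum.IsInternal 𝒜) : M ≃ₗ[k] DirectSum ι (fun i => 𝒜 i) :=
  (LinearEquiv.ofBijective (DirectSum.coeLinearMap 𝒜) h).symm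

/-- The component of degree `i`. -/
def component (h : DirectSum.IsInternal 𝒜) (i : ι) : M →ₗ[k] 𝒜 i :=
  DirectSum.component k ι (fun i => 𝒜 i) i ∘ₗ (decomp h).toLinearMap

open Classical in
/-- The projection onto the sum of the pieces whose index satisfies `s`. -/
def proj (h : DirectSum.IsInternal 𝒜) (s : ι → Prop) : M →ₗ[k] M :=
  DirectSum.toModule k ι M (fun i => if s i then (𝒜 i).subtype else 0) ∘ₗ (decomp h).toLinearMap

end Grading

/-- The parity involution `x ↦ (-1)^|x| x` of a graded vector space. -/
def parity {k : Type w} [Field k] {M : Type u} [AddCommGroup M] [Module k M]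
    {𝒜 : ℤ → Submodule k M} (h : DirectSum.IsInternal 𝒜) : M →ₗ[k] M :=
  proj h Even - proj h Odd

/-! ### Relabelling bijections -/

/-- `(α ⊔ β) ⊔ γ ≃ (α ⊔ γ) ⊔ β`. -/
def swapR (α β γ : Type) : (α ⊕ β) ⊕ γ ≃ (α ⊕ γ) ⊕ β :=
  ((Equiv.sumAssoc α β γ).trans (Equiv.sumCongr (Equiv.refl α) (Equiv.sumComm β γ))).trans
    (Equiv.sumAssoc α γ β).symm

/-- `α ⊔ (β ⊔ γ) ≃ β ⊔ (α ⊔ γ)`. -/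
def swapL (α β γ : Type) : α ⊕ (β ⊕ γ) ≃ β ⊕ (α ⊕ γ) :=
  ((Equiv.sumAssoc α β γ).symm.trans (Equiv.sumCongr (Equiv.sumComm α β) (Equiv.refl γ))).trans
    (Equiv.sumAssoc β α γ)

/-- `(α ⊔ β) ⊔ γ ≃ α ⊔ (γ ⊔ β)`. -/
def assocSwap (α β γ : Type) : (α ⊕ β) ⊕ γ ≃ α ⊕ (γ ⊕ β) :=
  (Equiv.sumAssoc α β γ).trans (Equiv.sumCongr (Equiv.refl α) (Equiv.sumComm β γ))

/-! ### Properads -/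

/-- The data underlying a (dg) properad: for all finite sets `C` (outputs) and `D` (inputs) a vector
space with a family of homogeneous parts and an endomorphism `d` (the differential), the action of
bijections, and for every bijection `η : B ≃ A` of nonempty finite sets the operation gluing the
inputs `B` of the first argument to the outputs `A` of the second one.
Disjoint unions of finite sets are written as sum types. -/
structure ProperadData (k : Type w) [Field k] where
  obj : ∀ (C D : Type) [Finite C] [Finite D], Type u
  [addCommGroup : ∀ (C D : Type) [Finite C] [Finite D], AddCommGroup (obj C D)]
  [module : ∀ (C D : Type) [Finite C] [Finite D], Module k (obj C D)]
  deg : ∀ (C D : Type) [Finite C] [Finite D], ℤ → Submodule k (obj C D)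
  d : ∀ (C D : Type) [Finite C] [Finite D], obj C D →ₗ[k] obj C D
  act : ∀ {C D C' D' : Type} [Finite C] [Finite D] [Finite C'] [Finite D'],
    (C ≃ C') → (D ≃ D') → obj C D →ₗ[k] obj C' D'
  comp : ∀ {C₁ D₁ C₂ D₂ A B : Type} [Finite C₁] [Finite D₁] [Finite C₂] [Finite D₂] [Finite A]
    [Finite B] [Nonempty B], (B ≃ A) →
    obj C₁ (D₁ ⊕ B) →ₗ[k] obj (C₂ ⊕ A) D₂ →ₗ[k] obj (C₁ ⊕ C₂) (D₁ ⊕ D₂)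

attribute [instance] ProperadData.addCommGroup ProperadData.module

/-- A properad in dg vector spaces (differential of degree `+1`). -/
structure Properad (k : Type w) [Field k] extends ProperadData.{w, u} k where
  /-- Every `P(C, D)` is a dg vector space. -/
  internal : ∀ (C D : Type) [Finite C] [Finite D], DirectSum.IsInternal (deg C D)
  d_deg : ∀ {C D : Type} [Finite C] [Finite D] {i : ℤ} {x : obj C D},
    x ∈ deg C D i → d C D x ∈ deg C D (i + 1)
  d_d : ∀ {C D : Type} [Finite C] [Finite D] (x : obj C D), d C D (d C D x) = 0
  /-- The structure maps are morphisms of dg vector spaces. -/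
  act_deg : ∀ {C D C' D' : Type} [Finite C] [Finite D] [Finite C'] [Finite D']
    (ρ : C ≃ C') (σ : D ≃ D') {i : ℤ} {x : obj C D}, x ∈ deg C D i → act ρ σ x ∈ deg C' D' i
  d_act : ∀ {C D C' D' : Type} [Finite C] [Finite D] [Finite C'] [Finite D']
    (ρ : C ≃ C') (σ : D ≃ D') (x : obj C D), d C' D' (act ρ σ x) = act ρ σ (d C D x)
  comp_deg : ∀ {C₁ D₁ C₂ D₂ A B : Type} [Finite C₁] [Finite D₁] [Finite C₂] [Finite D₂]
    [Finite A] [Finite B] [Nonempty B] (η : B ≃ A) {i j : ℤ} {x : obj C₁ (D₁ ⊕ B)}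
    {y : obj (C₂ ⊕ A) D₂}, x ∈ deg _ _ i → y ∈ deg _ _ j → comp η x y ∈ deg _ _ (i + j)
  d_comp : ∀ {C₁ D₁ C₂ D₂ A B : Type} [Finite C₁] [Finite D₁] [Finite C₂] [Finite D₂]
    [Finite A] [Finite B] [Nonempty B] (η : B ≃ A) {i : ℤ} {x : obj C₁ (D₁ ⊕ B)}
    (y : obj (C₂ ⊕ A) D₂), x ∈ deg _ _ i →
    d _ _ (comp η x y) = comp η (d _ _ x) y + sgn k i • comp η x (d _ _ y)
  /-- Functoriality in bijections. -/
  act_refl : ∀ {C D : Type} [Finite C] [Finite D] (x : obj C D),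
    act (Equiv.refl C) (Equiv.refl D) x = x
  act_act : ∀ {C D C' D' C'' D'' : Type} [Finite C] [Finite D] [Finite C'] [Finite D']
    [Finite C''] [Finite D''] (ρ : C ≃ C') (σ : D ≃ D') (ρ' : C' ≃ C'') (σ' : D' ≃ D'')
    (x : obj C D), act ρ' σ' (act ρ σ x) = act (ρ.trans ρ') (σ.trans σ') x
  /-- Equivariance of the operations. -/
  act_comp : ∀ {C₁ D₁ C₂ D₂ A B C₁' D₁' C₂' D₂' A' B' : Type} [Finite C₁] [Finite D₁]
    [Finite C₂] [Finite D₂] [Finite A] [Finite B] [Nonempty B] [Finite C₁'] [Finite D₁']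
    [Finite C₂'] [Finite D₂'] [Finite A'] [Finite B'] [Nonempty B'] (η : B ≃ A)
    (ρ₁ : C₁ ≃ C₁') (σ₁ : D₁ ≃ D₁') (β : B ≃ B') (ρ₂ : C₂ ≃ C₂') (σ₂ : D₂ ≃ D₂') (α : A ≃ A')
    (x : obj C₁ (D₁ ⊕ B)) (y : obj (C₂ ⊕ A) D₂),
    act (Equiv.sumCongr ρ₁ ρ₂) (Equiv.sumCongr σ₁ σ₂) (comp η x y) =
      comp ((β.symm.trans η).trans α) (act ρ₁ (Equiv.sumCongr σ₁ β) x)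
        (act (Equiv.sumCongr ρ₂ α) σ₂ y)
  /-- Associativity when `x` is glued to `y` (along `η₁`), `y` to `z` (along `η₂`), and `x` to `z`
  (along `η₃`, possibly empty). -/
  assoc : ∀ {C₁ D₁ C₂ D₂ C₃ D₃ A₁ B₁ A₂ B₂ A₃ B₃ : Type} [Finite C₁] [Finite D₁] [Finite C₂]
    [Finite D₂] [Finite C₃] [Finite D₃] [Finite A₁] [Finite B₁] [Finite A₂] [Finite B₂]
    [Finite A₃] [Finite B₃] [Nonempty B₁] [Nonempty B₂] (η₁ : B₁ ≃ A₁) (η₂ : B₂ ≃ A₂)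
    (η₃ : B₃ ≃ A₃) (x : obj C₁ ((D₁ ⊕ B₃) ⊕ B₁)) (y : obj (C₂ ⊕ A₁) (D₂ ⊕ B₂))
    (z : obj (C₃ ⊕ (A₃ ⊕ A₂)) D₃),
    act (Equiv.sumAssoc C₁ C₂ C₃) (Equiv.sumAssoc D₁ D₂ D₃)
      (comp (Equiv.sumCongr η₃ η₂)
        (act (Equiv.refl _) (Equiv.sumSumSumComm D₁ B₃ D₂ B₂) (comp η₁ x y)) z) =
      comp (Equiv.sumCongr η₁ η₃) (act (Equiv.refl _) (assocSwap D₁ B₃ B₁) x)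
        (act (Equiv.sumSumSumComm C₂ A₁ C₃ A₃) (Equiv.refl _)
          (comp η₂ y (act (Equiv.sumAssoc C₃ A₃ A₂).symm (Equiv.refl _) z)))
  /-- `x` and `y` both glued to the outputs of `z`: the order does not matter, up to the Koszul
  sign. -/
  par_out : ∀ {C₁ D₁ C₂ D₂ C₃ D₃ A B A' B' : Type} [Finite C₁] [Finite D₁] [Finite C₂]
    [Finite D₂] [Finite C₃] [Finite D₃] [Finite A] [Finite B] [Finite A'] [Finite B']
    [Nonempty B] [Nonempty B'] (η : B ≃ A) (η' : B' ≃ A') {i j : ℤ} {x : obj C₁ (D₁ ⊕ B)}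
    {y : obj C₂ (D₂ ⊕ B')} (z : obj ((C₃ ⊕ A) ⊕ A') D₃), x ∈ deg _ _ i → y ∈ deg _ _ j →
    comp η x (act (Equiv.sumAssoc C₂ C₃ A).symm (Equiv.refl _) (comp η' y z)) =
      sgn k (i * j) • act (swapL C₂ C₁ C₃) (swapL D₂ D₁ D₃)
        (comp η' y (act (Equiv.sumAssoc C₁ C₃ A').symm (Equiv.refl _)
          (comp η x (act (swapR C₃ A A') (Equiv.refl _) z))))
  /-- `y` and `z` both glued to the inputs of `x`: the order does not matter, up to the Koszul
  sign. -/
  par_in : ∀ {C₁ D₁ C₂ D₂ C₃ D₃ A B A' B' : Type} [Finite C₁] [Finite D₁] [Finite C₂]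
    [Finite D₂] [Finite C₃] [Finite D₃] [Finite A] [Finite B] [Finite A'] [Finite B']
    [Nonempty B] [Nonempty B'] (η : B ≃ A) (η' : B' ≃ A') {i j : ℤ}
    (x : obj C₁ ((D₁ ⊕ B) ⊕ B')) {y : obj (C₂ ⊕ A) D₂} {z : obj (C₃ ⊕ A') D₃},
    y ∈ deg _ _ i → z ∈ deg _ _ j →
    comp η (act (Equiv.refl _) (swapR D₁ B D₃) (comp η' x z)) y =
      sgn k (i * j) • act (swapR C₁ C₂ C₃) (swapR D₁ D₂ D₃)
        (comp η' (act (Equiv.refl _) (swapR D₁ B' D₂)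
          (comp η (act (Equiv.refl _) (swapR D₁ B B') x) y)) z)

/-- A morphism of properads: degree `0` maps of dg vector spaces compatible with the actions of
bijections and with the operations. -/
structure ProperadData.Hom {k : Type w} [Field k] (P : ProperadData.{w, u} k)
    (Q : ProperadData.{w, u'} k) where
  toFun : ∀ (C D : Type) [Finite C] [Finite D], P.obj C D →ₗ[k] Q.obj C D
  map_deg : ∀ {C D : Type} [Finite C] [Finite D] {i : ℤ} {x : P.obj C D},
    x ∈ P.deg C D i → toFun C D x ∈ Q.deg C D i
  map_d : ∀ {C D : Type} [Finite C] [Finite D] (x : P.obj C D),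
    toFun C D (P.d C D x) = Q.d C D (toFun C D x)
  map_act : ∀ {C D C' D' : Type} [Finite C] [Finite D] [Finite C'] [Finite D']
    (ρ : C ≃ C') (σ : D ≃ D') (x : P.obj C D),
    toFun C' D' (P.act ρ σ x) = Q.act ρ σ (toFun C D x)
  map_comp : ∀ {C₁ D₁ C₂ D₂ A B : Type} [Finite C₁] [Finite D₁] [Finite C₂] [Finite D₂]
    [Finite A] [Finite B] [Nonempty B] (η : B ≃ A) (x : P.obj C₁ (D₁ ⊕ B))
    (y : P.obj (C₂ ⊕ A) D₂),
    toFun _ _ (P.comp η x y) = Q.comp η (toFun _ _ x) (toFun _ _ y)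

/-- The additional grading of a properad by `G ∈ ℕ`. Here `bi C D G i` is the part of degree `i` of
the dg vector space `P(C, D, G)`, which is assumed to be finite dimensional, and to vanish unless
`χ = 2 G + |C| + |D| - 2 > 0`. The component of `P(C₁, D₁ ⊔ B, G₁) ∘ P(C₂ ⊔ A, D₂, G₂)` in
`P(C₁ ⊔ C₂, D₁ ⊔ D₂, G)` may be nonzero only for finitely many `|A| = |B|`, `G₁` and `G₂`. -/
structure Properad.StableGrading {k : Type w} [Field k] (P : Properad.{w, u} k) where
  bi : ∀ (C D : Type) [Finite C] [Finite D], ℕ → ℤ → Submodule k (P.obj C D)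
  internal : ∀ (C D : Type) [Finite C] [Finite D],
    DirectSum.IsInternal (fun p : ℕ × ℤ => bi C D p.1 p.2)
  bi_le : ∀ (C D : Type) [Finite C] [Finite D] (G : ℕ) (i : ℤ), bi C D G i ≤ P.deg C D i
  d_mem : ∀ {C D : Type} [Finite C] [Finite D] {G : ℕ} {i : ℤ} {x : P.obj C D},
    x ∈ bi C D G i → P.d C D x ∈ bi C D G (i + 1)
  act_mem : ∀ {C D C' D' : Type} [Finite C] [Finite D] [Finite C'] [Finite D'] (ρ : C ≃ C')
    (σ : D ≃ D') {G : ℕ} {i : ℤ} {x : P.obj C D}, x ∈ bi C D G i → P.act ρ σ x ∈ bi C' D' G i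
  finite : ∀ (C D : Type) [Finite C] [Finite D] (G : ℕ),
    FiniteDimensional k (⨆ i, bi C D G i : Submodule k (P.obj C D))
  stable : ∀ (C D : Type) [Finite C] [Finite D] (G : ℕ) (i : ℤ),
    2 * G + Nat.card C + Nat.card D ≤ 2 → bi C D G i = ⊥
  finitary : ∀ (C₁ D₁ C₂ D₂ : Type) [Finite C₁] [Finite D₁] [Finite C₂] [Finite D₂] (G : ℕ),
    {t : ℕ × ℕ × ℕ | ∃ x ∈ (⨆ i, bi C₁ (D₁ ⊕ Fin (t.1 + 1)) t.2.1 i : Submodule k _),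
      ∃ y ∈ (⨆ i, bi (C₂ ⊕ Fin (t.1 + 1)) D₂ t.2.2 i : Submodule k _),
      proj (internal (C₁ ⊕ C₂) (D₁ ⊕ D₂)) (fun p => p.1 = G)
        (P.comp (Equiv.refl (Fin (t.1 + 1))) x y) ≠ 0}.Finite

/-! ### The cobar complex -/

section Cobar

variable {k : Type w} [Field k] {P : Properad.{w, u} k}

namespace Properad.StableGrading

variable (𝒢 : P.StableGrading)

/-- The projection of `P(C, D)` onto its component of bidegree `(G, i)`. -/
def pr (C D : Type) [Finite C] [Finite D] (G : ℕ) (i : ℤ) : P.obj C D →ₗ[k] 𝒢.bi C D G i :=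
  component (𝒢.internal C D) (G, i)

/-- The projection of `P(C, D)` onto `P(C, D, G)`. -/
def prG (C D : Type) [Finite C] [Finite D] (G : ℕ) : P.obj C D →ₗ[k] P.obj C D :=
  proj (𝒢.internal C D) (fun p => p.1 = G)

/-- The functionals on the part of degree `i` of `P(C, D, G)`, that is, the part of degree `-i` of
the linear dual of `P(C, D, G)`. -/
abbrev DualPart (C D : Type) [Finite C] [Finite D] (G : ℕ) (i : ℤ) : Type (max u w) :=
  Module.Dual k (𝒢.bi C D G i)

/-- The action of bijections on the dual: the transpose of `P(ρ⁻¹, σ⁻¹)`. -/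
def dualAct {C D C' D' : Type} [Finite C] [Finite D] [Finite C'] [Finite D'] (ρ : C ≃ C')
    (σ : D ≃ D') (G : ℕ) (i : ℤ) : 𝒢.DualPart C D G i →ₗ[k] 𝒢.DualPart C' D' G i :=
  (𝒢.pr C D G i ∘ₗ P.act ρ.symm σ.symm ∘ₗ (𝒢.bi C' D' G i).subtype).lcomp k k

/-- The differential of the dual, `ξ ↦ (-1)^|ξ| ξ ∘ d`. -/
def dualD (C D : Type) [Finite C] [Finite D] (G : ℕ) (i : ℤ) :
    𝒢.DualPart C D G i →ₗ[k] 𝒢.DualPart C D G (i - 1) :=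
  sgn k i • (𝒢.pr C D G i ∘ₗ P.d C D ∘ₗ (𝒢.bi C D G (i - 1)).subtype).lcomp k k

/-- Formal composites of the generators `↑ξ`, where `ξ` runs over the homogeneous functionals on the
`P(C, D, G)`. -/
inductive Mon : Type → Type → Type (max 1 u w)
  | gen {C D : Type} [Finite C] [Finite D] (G : ℕ) (i : ℤ) (ξ : 𝒢.DualPart C D G i) : Mon C D
  | act {C D C' D' : Type} [Finite C] [Finite D] [Finite C'] [Finite D'] (ρ : C ≃ C')
      (σ : D ≃ D') (a : Mon C D) : Mon C' D'
  | comp {C₁ D₁ C₂ D₂ A B : Type} [Finite C₁] [Finite D₁] [Finite C₂] [Finite D₂] [Finite A]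
      [Finite B] [Nonempty B] (η : B ≃ A) (a : Mon C₁ (D₁ ⊕ B)) (b : Mon (C₂ ⊕ A) D₂) :
      Mon (C₁ ⊕ C₂) (D₁ ⊕ D₂)

variable {𝒢}

/-- The degree of a formal composite; the suspension has degree `+1`. -/
def Mon.deg : {C D : Type} → 𝒢.Mon C D → ℤ
  | _, _, @Mon.gen _ _ _ _ _ _ _ _ _ i _ => 1 - i
  | _, _, @Mon.act _ _ _ _ _ _ _ _ _ _ _ _ _ _ a => a.deg
  | _, _, @Mon.comp _ _ _ _ _ _ _ _ _ _ _ _ _ _ _ _ _ _ a b => a.deg + b.deg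

variable (𝒢)

/-- Linear combinations of formal composites. -/
abbrev Lin (C D : Type) : Type (max 1 u w) := 𝒢.Mon C D →₀ k

variable {𝒢}

/-- A formal composite as a linear combination. -/
def Mon.lin {C D : Type} (a : 𝒢.Mon C D) : 𝒢.Lin C D := Finsupp.single a 1

/-- The formal action of bijections. -/
def linAct {C D C' D' : Type} [Finite C] [Finite D] [Finite C'] [Finite D'] (ρ : C ≃ C')
    (σ : D ≃ D') : 𝒢.Lin C D →ₗ[k] 𝒢.Lin C' D' :=
  Finsupp.linearCombination k (fun a => (Mon.act ρ σ a).lin)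

/-- The formal operations. -/
def linComp {C₁ D₁ C₂ D₂ A B : Type} [Finite C₁] [Finite D₁] [Finite C₂] [Finite D₂]
    [Finite A] [Finite B] [Nonempty B] (η : B ≃ A) :
    𝒢.Lin C₁ (D₁ ⊕ B) →ₗ[k] 𝒢.Lin (C₂ ⊕ A) D₂ →ₗ[k] 𝒢.Lin (C₁ ⊕ C₂) (D₁ ⊕ D₂) :=
  Finsupp.linearCombination k
    (fun a => Finsupp.linearCombination k (fun b => (Mon.comp η a b).lin))

/-- The linear combinations of formal composites that vanish in the free properad generated by the
suspended dual of `P`: the smallest family of subspaces, closed under the formal action and the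
formal operations, that makes the generators linear and equivariant and enforces the axioms of a
properad. -/
inductive Rel : {C D : Type} → 𝒢.Lin C D → Prop
  | zero {C D : Type} : Rel (0 : 𝒢.Lin C D)
  | add {C D : Type} {x y : 𝒢.Lin C D} : Rel x → Rel y → Rel (x + y)
  | smul {C D : Type} (c : k) {x : 𝒢.Lin C D} : Rel x → Rel (c • x)
  | act {C D C' D' : Type} [Finite C] [Finite D] [Finite C'] [Finite D'] (ρ : C ≃ C')
      (σ : D ≃ D') {x : 𝒢.Lin C D} : Rel x → Rel (linAct ρ σ x)
  | comp_left {C₁ D₁ C₂ D₂ A B : Type} [Finite C₁] [Finite D₁] [Finite C₂] [Finite D₂]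
      [Finite A] [Finite B] [Nonempty B] (η : B ≃ A) {x : 𝒢.Lin C₁ (D₁ ⊕ B)}
      (y : 𝒢.Lin (C₂ ⊕ A) D₂) : Rel x → Rel (linComp η x y)
  | comp_right {C₁ D₁ C₂ D₂ A B : Type} [Finite C₁] [Finite D₁] [Finite C₂] [Finite D₂]
      [Finite A] [Finite B] [Nonempty B] (η : B ≃ A) (x : 𝒢.Lin C₁ (D₁ ⊕ B))
      {y : 𝒢.Lin (C₂ ⊕ A) D₂} : Rel y → Rel (linComp η x y)
  | gen_add {C D : Type} [Finite C] [Finite D] (G : ℕ) (i : ℤ) (ξ ζ : 𝒢.DualPart C D G i) :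
      Rel ((Mon.gen G i (ξ + ζ)).lin - ((Mon.gen G i ξ).lin + (Mon.gen G i ζ).lin))
  | gen_smul {C D : Type} [Finite C] [Finite D] (G : ℕ) (i : ℤ) (c : k)
      (ξ : 𝒢.DualPart C D G i) : Rel ((Mon.gen G i (c • ξ)).lin - c • (Mon.gen G i ξ).lin)
  | gen_act {C D C' D' : Type} [Finite C] [Finite D] [Finite C'] [Finite D'] (ρ : C ≃ C')
      (σ : D ≃ D') (G : ℕ) (i : ℤ) (ξ : 𝒢.DualPart C D G i) :
      Rel ((Mon.act ρ σ (Mon.gen G i ξ)).lin - (Mon.gen G i (𝒢.dualAct ρ σ G i ξ)).lin)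
  | act_refl {C D : Type} [Finite C] [Finite D] (a : 𝒢.Mon C D) :
      Rel ((Mon.act (Equiv.refl C) (Equiv.refl D) a).lin - a.lin)
  | act_act {C D C' D' C'' D'' : Type} [Finite C] [Finite D] [Finite C'] [Finite D']
      [Finite C''] [Finite D''] (ρ : C ≃ C') (σ : D ≃ D') (ρ' : C' ≃ C'') (σ' : D' ≃ D'')
      (a : 𝒢.Mon C D) :
      Rel ((Mon.act ρ' σ' (Mon.act ρ σ a)).lin - (Mon.act (ρ.trans ρ') (σ.trans σ') a).lin)
  | act_comp {C₁ D₁ C₂ D₂ A B C₁' D₁' C₂' D₂' A' B' : Type} [Finite C₁] [Finite D₁]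
      [Finite C₂] [Finite D₂] [Finite A] [Finite B] [Nonempty B] [Finite C₁'] [Finite D₁']
      [Finite C₂'] [Finite D₂'] [Finite A'] [Finite B'] [Nonempty B'] (η : B ≃ A)
      (ρ₁ : C₁ ≃ C₁') (σ₁ : D₁ ≃ D₁') (β : B ≃ B') (ρ₂ : C₂ ≃ C₂') (σ₂ : D₂ ≃ D₂') (α : A ≃ A')
      (a : 𝒢.Mon C₁ (D₁ ⊕ B)) (b : 𝒢.Mon (C₂ ⊕ A) D₂) :
      Rel ((Mon.act (Equiv.sumCongr ρ₁ ρ₂) (Equiv.sumCongr σ₁ σ₂) (Mon.comp η a b)).lin -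
        (Mon.comp ((β.symm.trans η).trans α) (Mon.act ρ₁ (Equiv.sumCongr σ₁ β) a)
          (Mon.act (Equiv.sumCongr ρ₂ α) σ₂ b)).lin)
  | assoc {C₁ D₁ C₂ D₂ C₃ D₃ A₁ B₁ A₂ B₂ A₃ B₃ : Type} [Finite C₁] [Finite D₁] [Finite C₂]
      [Finite D₂] [Finite C₃] [Finite D₃] [Finite A₁] [Finite B₁] [Finite A₂] [Finite B₂]
      [Finite A₃] [Finite B₃] [Nonempty B₁] [Nonempty B₂] (η₁ : B₁ ≃ A₁) (η₂ : B₂ ≃ A₂)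
      (η₃ : B₃ ≃ A₃) (a : 𝒢.Mon C₁ ((D₁ ⊕ B₃) ⊕ B₁)) (b : 𝒢.Mon (C₂ ⊕ A₁) (D₂ ⊕ B₂))
      (c : 𝒢.Mon (C₃ ⊕ (A₃ ⊕ A₂)) D₃) :
      Rel ((Mon.act (Equiv.sumAssoc C₁ C₂ C₃) (Equiv.sumAssoc D₁ D₂ D₃)
          (Mon.comp (Equiv.sumCongr η₃ η₂)
            (Mon.act (Equiv.refl _) (Equiv.sumSumSumComm D₁ B₃ D₂ B₂) (Mon.comp η₁ a b)) c)).lin -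
        (Mon.comp (Equiv.sumCongr η₁ η₃) (Mon.act (Equiv.refl _) (assocSwap D₁ B₃ B₁) a)
          (Mon.act (Equiv.sumSumSumComm C₂ A₁ C₃ A₃) (Equiv.refl _)
            (Mon.comp η₂ b
              (Mon.act (Equiv.sumAssoc C₃ A₃ A₂).symm (Equiv.refl _) c)))).lin)
  | par_out {C₁ D₁ C₂ D₂ C₃ D₃ A B A' B' : Type} [Finite C₁] [Finite D₁] [Finite C₂]
      [Finite D₂] [Finite C₃] [Finite D₃] [Finite A] [Finite B] [Finite A'] [Finite B']
      [Nonempty B] [Nonempty B'] (η : B ≃ A) (η' : B' ≃ A') (a : 𝒢.Mon C₁ (D₁ ⊕ B))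
      (b : 𝒢.Mon C₂ (D₂ ⊕ B')) (c : 𝒢.Mon ((C₃ ⊕ A) ⊕ A') D₃) :
      Rel ((Mon.comp η a (Mon.act (Equiv.sumAssoc C₂ C₃ A).symm (Equiv.refl _)
          (Mon.comp η' b c))).lin -
        sgn k (a.deg * b.deg) • (Mon.act (swapL C₂ C₁ C₃) (swapL D₂ D₁ D₃)
          (Mon.comp η' b (Mon.act (Equiv.sumAssoc C₁ C₃ A').symm (Equiv.refl _)
            (Mon.comp η a (Mon.act (swapR C₃ A A') (Equiv.refl _) c))))).lin)
  | par_in {C₁ D₁ C₂ D₂ C₃ D₃ A B A' B' : Type} [Finite C₁] [Finite D₁] [Finite C₂]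
      [Finite D₂] [Finite C₃] [Finite D₃] [Finite A] [Finite B] [Finite A'] [Finite B']
      [Nonempty B] [Nonempty B'] (η : B ≃ A) (η' : B' ≃ A') (a : 𝒢.Mon C₁ ((D₁ ⊕ B) ⊕ B'))
      (b : 𝒢.Mon (C₂ ⊕ A) D₂) (c : 𝒢.Mon (C₃ ⊕ A') D₃) :
      Rel ((Mon.comp η (Mon.act (Equiv.refl _) (swapR D₁ B D₃) (Mon.comp η' a c)) b).lin -
        sgn k (b.deg * c.deg) • (Mon.act (swapR C₁ C₂ C₃) (swapR D₁ D₂ D₃)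
          (Mon.comp η' (Mon.act (Equiv.refl _) (swapR D₁ B' D₂)
            (Mon.comp η (Mon.act (Equiv.refl _) (swapR D₁ B B') a) b)) c)).lin)

variable (𝒢)

/-- The subspace of relations. -/
def relSub (C D : Type) : Submodule k (𝒢.Lin C D) where
  carrier := {x | Rel x}
  zero_mem' := Rel.zero
  add_mem' := Rel.add
  smul_mem' := fun c _ => Rel.smul c

/-- The free properad generated by the suspended dual of `P`. -/
abbrev Free (C D : Type) : Type (max 1 u w) := 𝒢.Lin C D ⧸ 𝒢.relSub C D

/-- The class of a linear combination of formal composites. -/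
abbrev cls (C D : Type) : 𝒢.Lin C D →ₗ[k] 𝒢.Free C D := (𝒢.relSub C D).mkQ

variable {𝒢}

/-- The action of bijections on the free properad. -/
def freeAct {C D C' D' : Type} [Finite C] [Finite D] [Finite C'] [Finite D'] (ρ : C ≃ C')
    (σ : D ≃ D') : 𝒢.Free C D →ₗ[k] 𝒢.Free C' D' :=
  (𝒢.relSub C D).mapQ (𝒢.relSub C' D') (linAct ρ σ) (fun _ hx => Rel.act ρ σ hx)

/-- The operations of the free properad. -/
def freeComp {C₁ D₁ C₂ D₂ A B : Type} [Finite C₁] [Finite D₁] [Finite C₂] [Finite D₂]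
    [Finite A] [Finite B] [Nonempty B] (η : B ≃ A) :
    𝒢.Free C₁ (D₁ ⊕ B) →ₗ[k] 𝒢.Free (C₂ ⊕ A) D₂ →ₗ[k] 𝒢.Free (C₁ ⊕ C₂) (D₁ ⊕ D₂) :=
  Submodule.liftQ _
    { toFun := fun x => (𝒢.relSub (C₂ ⊕ A) D₂).mapQ (𝒢.relSub (C₁ ⊕ C₂) (D₁ ⊕ D₂)) (linComp η x)
        (fun _ hy => Rel.comp_right η x hy)
      map_add' := fun x y => LinearMap.ext fun z => by
        obtain ⟨z, rfl⟩ := Submodule.Quotient.mk_surjective _ z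
        simp only [LinearMap.add_apply, Submodule.mapQ_apply, map_add, Submodule.Quotient.mk_add]
        rfl
      map_smul' := fun c x => LinearMap.ext fun z => by
        obtain ⟨z, rfl⟩ := Submodule.Quotient.mk_surjective _ z
        simp only [LinearMap.smul_apply, Submodule.mapQ_apply, map_smul, RingHom.id_apply,
          Submodule.Quotient.mk_smul]
        rfl }
    (fun x hx => by
      rw [LinearMap.mem_ker]
      refine LinearMap.ext fun y => ?_
      obtain ⟨y, rfl⟩ := Submodule.Quotient.mk_surjective _ y
      exact (Submodule.Quotient.mk_eq_zero _).2 (Rel.comp_left η y hx))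

/-- The homogeneous parts of the free properad. -/
def freeDeg (C D : Type) (i : ℤ) : Submodule k (𝒢.Free C D) :=
  (Finsupp.supported k k {a : 𝒢.Mon C D | a.deg = i}).map (𝒢.cls C D)

variable (𝒢)

/-- The generators `ξ ↦ ↑ξ` of the free properad. -/
def incl (C D : Type) [Finite C] [Finite D] (G : ℕ) (i : ℤ) :
    𝒢.DualPart C D G i →ₗ[k] 𝒢.Free C D where
  toFun ξ := 𝒢.cls C D (Mon.gen G i ξ).lin
  map_add' ξ ζ := by
    rw [← map_add]
    exact (Submodule.Quotient.eq _).2 (Rel.gen_add G i ξ ζ)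
  map_smul' c ξ := by
    rw [RingHom.id_apply, ← map_smul]
    exact (Submodule.Quotient.eq _).2 (Rel.gen_smul G i c ξ)

theorem bi_finite (C D : Type) [Finite C] [Finite D] (G : ℕ) (i : ℤ) :
    Module.Finite k (𝒢.bi C D G i) :=
  haveI := 𝒢.finite C D G
  Submodule.finiteDimensional_of_le (le_iSup (fun i => 𝒢.bi C D G i) i)

end Properad.StableGrading

/-- For finite dimensional `X` and `Y`, the map `(X ⊗ Y)^# ≅ X^# ⊗ Y^# → W` induced by a bilinear
map `X^# × Y^# → W`; no sign is inserted in this isomorphism. -/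
def dualContract {X : Type u} {Y : Type u'} {W : Type v} [AddCommGroup X] [Module k X]
    [AddCommGroup Y] [Module k Y] [AddCommGroup W] [Module k W] [Module.Finite k X]
    [Module.Finite k Y] (Γ : Module.Dual k X →ₗ[k] Module.Dual k Y →ₗ[k] W) :
    Module.Dual k (X ⊗[k] Y) →ₗ[k] W :=
  TensorProduct.lift Γ ∘ₗ (TensorProduct.dualDistribEquiv k X Y).symm.toLinearMap

namespace Properad.StableGrading

variable (𝒢 : P.StableGrading)

/-- The part of the differential of a generator coming from the dual of the operation
`P(C₁, D₁ ⊔ B)_{G₁, i} ⊗ P(C₂ ⊔ A, D₂)_{G₂, j} → P(C, D)_{G, l}`, for given decompositions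
`C₁ ⊔ C₂ ≃ C` and `D₁ ⊔ D₂ ≃ D` and for `A = B` the standard set with `n + 1` elements. The sign
`(-1)^(i (1 + j)) = (-1)^(i j) (-1)^i` is the Koszul sign of the pairing of `X^# ⊗ Y^#` with
`X ⊗ Y` times the one of moving the second suspension past the first functional. -/
def quadPart {C₁ C₂ D₁ D₂ C D : Type} [Finite C₁] [Finite C₂] [Finite D₁] [Finite D₂] [Finite C]
    [Finite D] (e : C₁ ⊕ C₂ ≃ C) (f : D₁ ⊕ D₂ ≃ D) (n : ℕ) (p q : ℕ × ℤ) (G : ℕ) (l : ℤ) :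
    𝒢.DualPart C D G l →ₗ[k] 𝒢.Free C D :=
  haveI := 𝒢.bi_finite C₁ (D₁ ⊕ Fin (n + 1)) p.1 p.2
  haveI := 𝒢.bi_finite (C₂ ⊕ Fin (n + 1)) D₂ q.1 q.2
  (sgn k (p.2 * (1 + q.2)) * ((n + 1).factorial : k)⁻¹) •
    (dualContract
      (((freeComp (Equiv.refl (Fin (n + 1)))).compl₁₂
        (𝒢.incl C₁ (D₁ ⊕ Fin (n + 1)) p.1 p.2)
        (𝒢.incl (C₂ ⊕ Fin (n + 1)) D₂ q.1 q.2)).compr₂ (freeAct e f)) ∘ₗ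
    (𝒢.pr C D G l ∘ₗ P.act e f ∘ₗ TensorProduct.lift
      ((P.comp (Equiv.refl (Fin (n + 1)))).compl₁₂
        (𝒢.bi C₁ (D₁ ⊕ Fin (n + 1)) p.1 p.2).subtype
        (𝒢.bi (C₂ ⊕ Fin (n + 1)) D₂ q.1 q.2).subtype)).lcomp k k)

open Classical in
/-- The part of the differential of a generator given by the duals of the operations: the sum over
all `C₁ ⊔ C₂ = C` and `D₁ ⊔ D₂ = D`, over the number of glued pairs, and over all bidegrees of the
two factors. -/
def quad (C D : Type) [Finite C] [Finite D] (G : ℕ) (l : ℤ) :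
    𝒢.DualPart C D G l →ₗ[k] 𝒢.Free C D :=
  ∑ᶠ t : (Set C × Set D) × ℕ × (ℕ × ℤ) × (ℕ × ℤ),
    𝒢.quadPart (Equiv.Set.sumCompl t.1.1) (Equiv.Set.sumCompl t.1.2) t.2.1 t.2.2.1 t.2.2.2 G l

/-- The differential on formal composites: on generators it is the sum of the differential of the
dual and of the duals of the operations, and it is extended by the Leibniz rule. -/
def dMon : {C D : Type} → 𝒢.Mon C D → 𝒢.Free C D
  | _, _, @Mon.gen _ _ _ _ C D _ _ G i ξ =>
      𝒢.incl C D G (i - 1) (𝒢.dualD C D G i ξ) + 𝒢.quad C D G i ξ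
  | _, _, @Mon.act _ _ _ _ _ _ _ _ _ _ _ _ ρ σ a => freeAct ρ σ (dMon a)
  | _, _, @Mon.comp _ _ _ _ _ _ _ _ _ _ _ _ _ _ _ _ _ η a b =>
      freeComp η (dMon a) (𝒢.cls _ _ b.lin) + sgn k a.deg • freeComp η (𝒢.cls _ _ a.lin) (dMon b)

/-- The linear extension of the differential. -/
def dLin (C D : Type) : 𝒢.Lin C D →ₗ[k] 𝒢.Free C D := Finsupp.linearCombination k 𝒢.dMon

/-! The rest of this part checks that the differential is well defined on the free properad. -/

variable {𝒢}

theorem freeAct_cls {C D C' D' : Type} [Finite C] [Finite D] [Finite C'] [Finite D'] (ρ : C ≃ C')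
    (σ : D ≃ D') (a : 𝒢.Mon C D) :
    freeAct ρ σ (𝒢.cls C D a.lin) = 𝒢.cls C' D' (Mon.act ρ σ a).lin := by
  simp [freeAct, linAct, Mon.lin]

theorem freeComp_cls {C₁ D₁ C₂ D₂ A B : Type} [Finite C₁] [Finite D₁] [Finite C₂] [Finite D₂]
    [Finite A] [Finite B] [Nonempty B] (η : B ≃ A) (a : 𝒢.Mon C₁ (D₁ ⊕ B))
    (b : 𝒢.Mon (C₂ ⊕ A) D₂) :
    freeComp η (𝒢.cls _ _ a.lin) (𝒢.cls _ _ b.lin) = 𝒢.cls _ _ (Mon.comp η a b).lin := by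
  change 𝒢.cls _ _ (linComp η a.lin b.lin) = _
  simp [linComp, Mon.lin]

theorem free_ind {C D : Type} {p : 𝒢.Free C D → Prop} (h : ∀ a : 𝒢.Mon C D, p (𝒢.cls C D a.lin))
    (h0 : p 0) (hadd : ∀ x y, p x → p y → p (x + y)) (hsmul : ∀ (c : k) x, p x → p (c • x))
    (x : 𝒢.Free C D) : p x := by
  obtain ⟨x, rfl⟩ := Submodule.Quotient.mk_surjective _ x
  induction x using Finsupp.induction_linear with
  | zero => exact h0
  | add x y hx hy => exact hadd _ _ hx hy
  | single a c =>
    have := hsmul c _ (h a)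
    rw [← map_smul] at this
    simpa [Mon.lin] using this

theorem cls_eq {C D : Type} {x y : 𝒢.Lin C D} (h : Rel (x - y)) : 𝒢.cls C D x = 𝒢.cls C D y :=
  (Submodule.Quotient.eq _).2 h

theorem cls_mem_freeDeg {C D : Type} (a : 𝒢.Mon C D) {i : ℤ} (h : a.deg = i) :
    𝒢.cls C D a.lin ∈ freeDeg C D i :=
  Submodule.mem_map_of_mem (Finsupp.single_mem_supported k 1 h)

theorem freeDeg_ind {C D : Type} {i : ℤ} {p : (x : 𝒢.Free C D) → x ∈ freeDeg C D i → Prop}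
    (h : ∀ (a : 𝒢.Mon C D) (ha : a.deg = i), p (𝒢.cls C D a.lin) (cls_mem_freeDeg a ha))
    (h0 : p 0 (zero_mem _))
    (hadd : ∀ x y hx hy, p x hx → p y hy → p (x + y) (add_mem hx hy))
    (hsmul : ∀ (c : k) x hx, p x hx → p (c • x) (Submodule.smul_mem _ c hx))
    (x : 𝒢.Free C D) (hx : x ∈ freeDeg C D i) : p x hx := by
  have key : ∀ y : 𝒢.Lin C D, y ∈ Submodule.span k ((fun a => Finsupp.single a (1 : k)) ''
      {a : 𝒢.Mon C D | a.deg = i}) → ∃ hy, p (𝒢.cls C D y) hy := by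
    intro y hy
    induction hy using Submodule.span_induction with
    | mem x hx =>
      obtain ⟨a, ha, rfl⟩ := hx
      exact ⟨_, h a ha⟩
    | zero => exact ⟨by rw [map_zero]; exact zero_mem _, by simpa only [map_zero] using h0⟩
    | add x y _ _ hx hy =>
      obtain ⟨hx, hx'⟩ := hx
      obtain ⟨hy, hy'⟩ := hy
      exact ⟨by rw [map_add]; exact add_mem hx hy,
        by simpa only [map_add] using hadd _ _ hx hy hx' hy'⟩
    | smul c x _ hx =>
      obtain ⟨hx, hx'⟩ := hx
      exact ⟨by rw [map_smul]; exact Submodule.smul_mem _ c hx,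
        by simpa only [map_smul] using hsmul c _ hx hx'⟩
  obtain ⟨y, hy, rfl⟩ := id hx
  rw [SetLike.mem_coe, Finsupp.supported_eq_span_single] at hy
  exact (key y hy).2

theorem freeAct_mem {C D C' D' : Type} [Finite C] [Finite D] [Finite C'] [Finite D'] (ρ : C ≃ C')
    (σ : D ≃ D') {i : ℤ} {x : 𝒢.Free C D} (hx : x ∈ freeDeg C D i) :
    freeAct ρ σ x ∈ freeDeg (𝒢 := 𝒢) C' D' i := by
  refine freeDeg_ind (p := fun x _ => freeAct ρ σ x ∈ freeDeg (𝒢 := 𝒢) C' D' i) ?_ ?_ ?_ ?_ x hx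
  · rintro a rfl
    rw [freeAct_cls]
    exact cls_mem_freeDeg (Mon.act ρ σ a) rfl
  · simp
  · intro x y _ _ hx hy
    rw [map_add]; exact add_mem hx hy
  · intro c x _ hx
    rw [map_smul]; exact Submodule.smul_mem _ _ hx

theorem freeComp_mem {C₁ D₁ C₂ D₂ A B : Type} [Finite C₁] [Finite D₁] [Finite C₂] [Finite D₂]
    [Finite A] [Finite B] [Nonempty B] (η : B ≃ A) {i j : ℤ} {x : 𝒢.Free C₁ (D₁ ⊕ B)}
    {y : 𝒢.Free (C₂ ⊕ A) D₂} (hx : x ∈ freeDeg _ _ i) (hy : y ∈ freeDeg _ _ j) :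
    freeComp η x y ∈ freeDeg _ _ (i + j) := by
  refine freeDeg_ind (p := fun x _ => freeComp η x y ∈ freeDeg _ _ (i + j)) ?_ ?_ ?_ ?_ x hx
  · rintro a rfl
    refine freeDeg_ind (p := fun y _ => freeComp η _ y ∈ freeDeg _ _ (a.deg + j)) ?_ ?_ ?_ ?_ y hy
    · rintro b rfl
      rw [freeComp_cls]
      exact cls_mem_freeDeg (Mon.comp η a b) rfl
    · simp
    · intro x y _ _ hx hy
      rw [map_add]; exact add_mem hx hy
    · intro c x _ hx
      rw [map_smul]; exact Submodule.smul_mem _ _ hx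
  · simp
  · intro x y _ _ hx hy
    rw [map_add, LinearMap.add_apply]; exact add_mem hx hy
  · intro c x _ hx
    rw [map_smul, LinearMap.smul_apply]; exact Submodule.smul_mem _ _ hx

theorem free_act_refl {C D : Type} [Finite C] [Finite D] (x : 𝒢.Free C D) :
    freeAct (Equiv.refl C) (Equiv.refl D) x = x := by
  induction x using free_ind with
  | h a => rw [freeAct_cls]; exact cls_eq (Rel.act_refl a)
  | h0 => simp
  | hadd x y hx hy => rw [map_add, hx, hy]
  | hsmul c x hx => rw [map_smul, hx]

theorem free_act_act {C D C' D' C'' D'' : Type} [Finite C] [Finite D] [Finite C'] [Finite D']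
    [Finite C''] [Finite D''] (ρ : C ≃ C') (σ : D ≃ D') (ρ' : C' ≃ C'') (σ' : D' ≃ D'')
    (x : 𝒢.Free C D) :
    freeAct ρ' σ' (freeAct ρ σ x) = freeAct (ρ.trans ρ') (σ.trans σ') x := by
  induction x using free_ind with
  | h a => simp only [freeAct_cls]; exact cls_eq (Rel.act_act ρ σ ρ' σ' a)
  | h0 => simp
  | hadd x y hx hy => simp only [map_add, hx, hy]
  | hsmul c x hx => simp only [map_smul, hx]

theorem free_act_comp {C₁ D₁ C₂ D₂ A B C₁' D₁' C₂' D₂' A' B' : Type} [Finite C₁] [Finite D₁]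
    [Finite C₂] [Finite D₂] [Finite A] [Finite B] [Nonempty B] [Finite C₁'] [Finite D₁']
    [Finite C₂'] [Finite D₂'] [Finite A'] [Finite B'] [Nonempty B'] (η : B ≃ A)
    (ρ₁ : C₁ ≃ C₁') (σ₁ : D₁ ≃ D₁') (β : B ≃ B') (ρ₂ : C₂ ≃ C₂') (σ₂ : D₂ ≃ D₂') (α : A ≃ A')
    (x : 𝒢.Free C₁ (D₁ ⊕ B)) (y : 𝒢.Free (C₂ ⊕ A) D₂) :
    freeAct (Equiv.sumCongr ρ₁ ρ₂) (Equiv.sumCongr σ₁ σ₂) (freeComp η x y) =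
      freeComp ((β.symm.trans η).trans α) (freeAct ρ₁ (Equiv.sumCongr σ₁ β) x)
        (freeAct (Equiv.sumCongr ρ₂ α) σ₂ y) := by
  induction x using free_ind with
  | h a =>
    induction y using free_ind with
    | h b =>
      simp only [freeAct_cls, freeComp_cls]
      exact cls_eq (Rel.act_comp η ρ₁ σ₁ β ρ₂ σ₂ α a b)
    | h0 => simp only [map_zero]
    | hadd x y hx hy => simp only [map_add, hx, hy]
    | hsmul c x hx => simp only [map_smul, hx]
  | h0 => simp only [map_zero, LinearMap.zero_apply]
  | hadd x y hx hy => simp only [map_add, LinearMap.add_apply, hx, hy]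
  | hsmul c x hx => simp only [map_smul, LinearMap.smul_apply, hx]

theorem free_assoc {C₁ D₁ C₂ D₂ C₃ D₃ A₁ B₁ A₂ B₂ A₃ B₃ : Type} [Finite C₁] [Finite D₁]
    [Finite C₂] [Finite D₂] [Finite C₃] [Finite D₃] [Finite A₁] [Finite B₁] [Finite A₂]
    [Finite B₂] [Finite A₃] [Finite B₃] [Nonempty B₁] [Nonempty B₂] (η₁ : B₁ ≃ A₁) (η₂ : B₂ ≃ A₂)
    (η₃ : B₃ ≃ A₃) (x : 𝒢.Free C₁ ((D₁ ⊕ B₃) ⊕ B₁)) (y : 𝒢.Free (C₂ ⊕ A₁) (D₂ ⊕ B₂))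
    (z : 𝒢.Free (C₃ ⊕ (A₃ ⊕ A₂)) D₃) :
    freeAct (Equiv.sumAssoc C₁ C₂ C₃) (Equiv.sumAssoc D₁ D₂ D₃)
      (freeComp (Equiv.sumCongr η₃ η₂)
        (freeAct (Equiv.refl _) (Equiv.sumSumSumComm D₁ B₃ D₂ B₂) (freeComp η₁ x y)) z) =
      freeComp (Equiv.sumCongr η₁ η₃) (freeAct (Equiv.refl _) (assocSwap D₁ B₃ B₁) x)
        (freeAct (Equiv.sumSumSumComm C₂ A₁ C₃ A₃) (Equiv.refl _)
          (freeComp η₂ y (freeAct (Equiv.sumAssoc C₃ A₃ A₂).symm (Equiv.refl _) z))) := by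
  induction x using free_ind with
  | h a =>
    induction y using free_ind with
    | h b =>
      induction z using free_ind with
      | h c =>
        simp only [freeAct_cls, freeComp_cls]
        exact cls_eq (Rel.assoc η₁ η₂ η₃ a b c)
      | h0 => simp only [map_zero]
      | hadd x y hx hy => simp only [map_add, hx, hy]
      | hsmul c x hx => simp only [map_smul, hx]
    | h0 => simp only [map_zero, LinearMap.zero_apply]
    | hadd x y hx hy => simp only [map_add, LinearMap.add_apply, hx, hy]
    | hsmul c x hx => simp only [map_smul, LinearMap.smul_apply, hx]
  | h0 => simp only [map_zero, LinearMap.zero_apply]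
  | hadd x y hx hy => simp only [map_add, LinearMap.add_apply, hx, hy]
  | hsmul c x hx => simp only [map_smul, LinearMap.smul_apply, hx]

theorem free_par_out {C₁ D₁ C₂ D₂ C₃ D₃ A B A' B' : Type} [Finite C₁] [Finite D₁] [Finite C₂]
    [Finite D₂] [Finite C₃] [Finite D₃] [Finite A] [Finite B] [Finite A'] [Finite B']
    [Nonempty B] [Nonempty B'] (η : B ≃ A) (η' : B' ≃ A') {i j : ℤ} {x : 𝒢.Free C₁ (D₁ ⊕ B)}
    {y : 𝒢.Free C₂ (D₂ ⊕ B')} (z : 𝒢.Free ((C₃ ⊕ A) ⊕ A') D₃) (hx : x ∈ freeDeg _ _ i)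
    (hy : y ∈ freeDeg _ _ j) :
    freeComp η x (freeAct (Equiv.sumAssoc C₂ C₃ A).symm (Equiv.refl _) (freeComp η' y z)) =
      sgn k (i * j) • freeAct (swapL C₂ C₁ C₃) (swapL D₂ D₁ D₃)
        (freeComp η' y (freeAct (Equiv.sumAssoc C₁ C₃ A').symm (Equiv.refl _)
          (freeComp η x (freeAct (swapR C₃ A A') (Equiv.refl _) z)))) := by
  induction x, hx using freeDeg_ind with
  | h a ha =>
    induction y, hy using freeDeg_ind with
    | h b hb =>
      induction z using free_ind with
      | h c =>
        subst ha hb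
        simp only [freeAct_cls, freeComp_cls, ← map_smul]
        exact cls_eq (Rel.par_out η η' a b c)
      | h0 => simp only [map_zero, smul_zero]
      | hadd x y hx hy => simp only [map_add, hx, hy, smul_add]
      | hsmul c x hx => simp only [map_smul, hx]; rw [smul_comm]
    | h0 => simp only [map_zero, LinearMap.zero_apply, smul_zero]
    | hadd x y _ _ hx hy => simp only [map_add, LinearMap.add_apply, hx, hy, smul_add]
    | hsmul c x _ hx => simp only [map_smul, LinearMap.smul_apply, hx]; rw [smul_comm]
  | h0 => simp only [map_zero, LinearMap.zero_apply, smul_zero]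
  | hadd x y _ _ hx hy => simp only [map_add, LinearMap.add_apply, hx, hy, smul_add]
  | hsmul c x _ hx => simp only [map_smul, LinearMap.smul_apply, hx]; rw [smul_comm]

theorem free_par_in {C₁ D₁ C₂ D₂ C₃ D₃ A B A' B' : Type} [Finite C₁] [Finite D₁] [Finite C₂]
    [Finite D₂] [Finite C₃] [Finite D₃] [Finite A] [Finite B] [Finite A'] [Finite B']
    [Nonempty B] [Nonempty B'] (η : B ≃ A) (η' : B' ≃ A') {i j : ℤ}
    (x : 𝒢.Free C₁ ((D₁ ⊕ B) ⊕ B')) {y : 𝒢.Free (C₂ ⊕ A) D₂} {z : 𝒢.Free (C₃ ⊕ A') D₃}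
    (hy : y ∈ freeDeg _ _ i) (hz : z ∈ freeDeg _ _ j) :
    freeComp η (freeAct (Equiv.refl _) (swapR D₁ B D₃) (freeComp η' x z)) y =
      sgn k (i * j) • freeAct (swapR C₁ C₂ C₃) (swapR D₁ D₂ D₃)
        (freeComp η' (freeAct (Equiv.refl _) (swapR D₁ B' D₂)
          (freeComp η (freeAct (Equiv.refl _) (swapR D₁ B B') x) y)) z) := by
  induction y, hy using freeDeg_ind with
  | h b hb =>
    induction z, hz using freeDeg_ind with
    | h c hc =>
      induction x using free_ind with
      | h a =>
        subst hb hc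
        simp only [freeAct_cls, freeComp_cls, ← map_smul]
        exact cls_eq (Rel.par_in η η' a b c)
      | h0 => simp only [map_zero, LinearMap.zero_apply, smul_zero]
      | hadd x y hx hy => simp only [map_add, LinearMap.add_apply, hx, hy, smul_add]
      | hsmul c x hx => simp only [map_smul, LinearMap.smul_apply, hx]; rw [smul_comm]
    | h0 => simp only [map_zero, LinearMap.zero_apply, smul_zero]
    | hadd x y _ _ hx hy => simp only [map_add, LinearMap.add_apply, hx, hy, smul_add]
    | hsmul c x _ hx => simp only [map_smul, LinearMap.smul_apply, hx]; rw [smul_comm]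
  | h0 => simp only [map_zero, LinearMap.zero_apply, smul_zero]
  | hadd x y _ _ hx hy => simp only [map_add, LinearMap.add_apply, hx, hy, smul_add]
  | hsmul c x _ hx => simp only [map_smul, LinearMap.smul_apply, hx]; rw [smul_comm]

theorem sgn_add (m n : ℤ) : sgn k (m + n) = sgn k m * sgn k n := by
  simp [sgn, Int.negOnePow_add]

theorem sgn_mul_self (m : ℤ) : sgn k m * sgn k m = 1 := by
  rw [← sgn_add, sgn, Int.negOnePow_even _ (Even.add_self m)]; simp

/-- The parity involution on linear combinations of formal composites. -/
def linParity (C D : Type) : 𝒢.Lin C D →ₗ[k] 𝒢.Lin C D :=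
  Finsupp.linearCombination k (fun a => sgn k a.deg • a.lin)

theorem linParity_lin {C D : Type} (a : 𝒢.Mon C D) : linParity C D a.lin = sgn k a.deg • a.lin := by
  simp [linParity, Mon.lin]

theorem linAct_lin {C D C' D' : Type} [Finite C] [Finite D] [Finite C'] [Finite D'] (ρ : C ≃ C')
    (σ : D ≃ D') (a : 𝒢.Mon C D) : linAct ρ σ a.lin = (Mon.act ρ σ a).lin := by
  simp [linAct, Mon.lin]

theorem linComp_lin {C₁ D₁ C₂ D₂ A B : Type} [Finite C₁] [Finite D₁] [Finite C₂] [Finite D₂]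
    [Finite A] [Finite B] [Nonempty B] (η : B ≃ A) (a : 𝒢.Mon C₁ (D₁ ⊕ B))
    (b : 𝒢.Mon (C₂ ⊕ A) D₂) : linComp η a.lin b.lin = (Mon.comp η a b).lin := by
  simp [linComp, Mon.lin]

theorem lin_ind {C D : Type} {p : 𝒢.Lin C D → Prop} (h : ∀ a : 𝒢.Mon C D, p a.lin)
    (h0 : p 0) (hadd : ∀ x y, p x → p y → p (x + y)) (hsmul : ∀ (c : k) x, p x → p (c • x))
    (x : 𝒢.Lin C D) : p x := by
  induction x using Finsupp.induction_linear with
  | zero => exact h0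
  | add x y hx hy => exact hadd _ _ hx hy
  | single a c => simpa [Mon.lin] using hsmul c _ (h a)

theorem linParity_linAct {C D C' D' : Type} [Finite C] [Finite D] [Finite C'] [Finite D']
    (ρ : C ≃ C') (σ : D ≃ D') (x : 𝒢.Lin C D) :
    linParity C' D' (linAct ρ σ x) = linAct ρ σ (linParity C D x) := by
  induction x using lin_ind with
  | h a => simp only [linAct_lin, linParity_lin, map_smul]; rfl
  | h0 => simp only [map_zero]
  | hadd x y hx hy => simp only [map_add, hx, hy]
  | hsmul c x hx => simp only [map_smul, hx]

theorem linParity_linComp {C₁ D₁ C₂ D₂ A B : Type} [Finite C₁] [Finite D₁] [Finite C₂]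
    [Finite D₂] [Finite A] [Finite B] [Nonempty B] (η : B ≃ A) (x : 𝒢.Lin C₁ (D₁ ⊕ B))
    (y : 𝒢.Lin (C₂ ⊕ A) D₂) :
    linParity _ _ (linComp η x y) = linComp η (linParity _ _ x) (linParity _ _ y) := by
  induction x using lin_ind with
  | h a =>
    induction y using lin_ind with
    | h b =>
      simp only [linComp_lin, linParity_lin, map_smul, LinearMap.smul_apply, smul_smul]
      rw [Mon.deg, sgn_add, mul_comm]
    | h0 => simp only [map_zero]
    | hadd x y hx hy => simp only [map_add, hx, hy]
    | hsmul c x hx => simp only [map_smul, hx]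
  | h0 => simp only [map_zero, LinearMap.zero_apply]
  | hadd x y hx hy => simp only [map_add, LinearMap.add_apply, hx, hy]
  | hsmul c x hx => simp only [map_smul, LinearMap.smul_apply, hx]

theorem rel_parity_of {C D : Type} {a b : 𝒢.Mon C D} {c : k} (h : a.deg = b.deg)
    (hr : Rel (a.lin - c • b.lin)) : Rel (linParity C D (a.lin - c • b.lin)) := by
  rw [map_sub, map_smul, linParity_lin, linParity_lin, h, smul_comm, ← smul_sub]
  exact Rel.smul _ hr

theorem rel_parity_of' {C D : Type} {a b : 𝒢.Mon C D} (h : a.deg = b.deg)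
    (hr : Rel (a.lin - b.lin)) : Rel (linParity C D (a.lin - b.lin)) := by
  have := rel_parity_of (c := 1) h (by rwa [one_smul])
  rwa [one_smul] at this

theorem rel_parity {C D : Type} {x : 𝒢.Lin C D} (hx : Rel x) : Rel (linParity C D x) := by
  induction hx with
  | zero => rw [map_zero]; exact Rel.zero
  | add _ _ hx hy => rw [map_add]; exact Rel.add hx hy
  | smul c _ hx => rw [map_smul]; exact Rel.smul c hx
  | act ρ σ _ hx => rw [linParity_linAct]; exact Rel.act ρ σ hx
  | comp_left η y _ hx => rw [linParity_linComp]; exact Rel.comp_left η _ hx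
  | comp_right η x _ hy => rw [linParity_linComp]; exact Rel.comp_right η _ hy
  | gen_add G i ξ ζ =>
    have := Rel.smul (sgn k (1 - i)) (Rel.gen_add G i ξ ζ)
    simpa only [map_sub, map_add, linParity_lin, Mon.deg, smul_sub, smul_add] using this
  | gen_smul G i c ξ => exact rel_parity_of rfl (Rel.gen_smul G i c ξ)
  | gen_act ρ σ G i ξ => exact rel_parity_of' rfl (Rel.gen_act ρ σ G i ξ)
  | act_refl a => exact rel_parity_of' rfl (Rel.act_refl a)
  | act_act ρ σ ρ' σ' a => exact rel_parity_of' rfl (Rel.act_act ρ σ ρ' σ' a)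
  | act_comp η ρ₁ σ₁ β ρ₂ σ₂ α a b =>
    exact rel_parity_of' rfl (Rel.act_comp η ρ₁ σ₁ β ρ₂ σ₂ α a b)
  | assoc η₁ η₂ η₃ a b c =>
    exact rel_parity_of' (by simp only [Mon.deg]; ring) (Rel.assoc η₁ η₂ η₃ a b c)
  | par_out η η' a b c =>
    exact rel_parity_of (by simp only [Mon.deg]; ring) (Rel.par_out η η' a b c)
  | par_in η η' a b c =>
    exact rel_parity_of (by simp only [Mon.deg]; ring) (Rel.par_in η η' a b c)

theorem dLin_lin {C D : Type} (a : 𝒢.Mon C D) : 𝒢.dLin C D a.lin = 𝒢.dMon a := by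
  simp [dLin, Mon.lin]

theorem dLin_linAct {C D C' D' : Type} [Finite C] [Finite D] [Finite C'] [Finite D']
    (ρ : C ≃ C') (σ : D ≃ D') (x : 𝒢.Lin C D) :
    𝒢.dLin C' D' (linAct ρ σ x) = freeAct ρ σ (𝒢.dLin C D x) := by
  induction x using lin_ind with
  | h a => rw [linAct_lin, dLin_lin, dLin_lin, dMon]
  | h0 => simp only [map_zero]
  | hadd x y hx hy => simp only [map_add, hx, hy]
  | hsmul c x hx => simp only [map_smul, hx]

theorem dLin_linComp {C₁ D₁ C₂ D₂ A B : Type} [Finite C₁] [Finite D₁] [Finite C₂]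
    [Finite D₂] [Finite A] [Finite B] [Nonempty B] (η : B ≃ A) (x : 𝒢.Lin C₁ (D₁ ⊕ B))
    (y : 𝒢.Lin (C₂ ⊕ A) D₂) :
    𝒢.dLin _ _ (linComp η x y) = freeComp η (𝒢.dLin _ _ x) (𝒢.cls _ _ y) +
      freeComp η (𝒢.cls _ _ (linParity _ _ x)) (𝒢.dLin _ _ y) := by
  induction x using lin_ind with
  | h a =>
    induction y using lin_ind with
    | h b =>
      rw [linComp_lin, dLin_lin, dLin_lin, dLin_lin, dMon, linParity_lin]
      simp only [map_smul, LinearMap.smul_apply]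
    | h0 => simp only [map_zero, add_zero]
    | hadd x y hx hy => simp only [map_add, hx, hy]; abel
    | hsmul c x hx => simp only [map_smul, hx, smul_add]
  | h0 => simp only [map_zero, LinearMap.zero_apply, add_zero]
  | hadd x y hx hy => simp only [map_add, LinearMap.add_apply, hx, hy]; abel
  | hsmul c x hx => simp only [map_smul, LinearMap.smul_apply, hx, smul_add]

theorem dualContract_mem {X : Type u} {Y : Type u'} {W : Type v} [AddCommGroup X] [Module k X]
    [AddCommGroup Y] [Module k Y] [AddCommGroup W] [Module k W] [Module.Finite k X]
    [Module.Finite k Y] (Γ : Module.Dual k X →ₗ[k] Module.Dual k Y →ₗ[k] W) (S : Submodule k W)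
    (h : ∀ ζ θ, Γ ζ θ ∈ S) (b : Module.Dual k (X ⊗[k] Y)) : dualContract Γ b ∈ S := by
  rw [dualContract, LinearMap.comp_apply]
  generalize (TensorProduct.dualDistribEquiv k X Y).symm.toLinearMap b = t
  induction t using TensorProduct.induction_on with
  | zero => simp
  | tmul ζ θ => simpa using h ζ θ
  | add x y hx hy => rw [map_add]; exact add_mem hx hy

theorem incl_mem {C D : Type} [Finite C] [Finite D] (G : ℕ) (i : ℤ) (ξ : 𝒢.DualPart C D G i) :
    𝒢.incl C D G i ξ ∈ freeDeg C D (1 - i) :=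
  cls_mem_freeDeg _ rfl

theorem component_coe {ι : Type} [DecidableEq ι] {M : Type u} [AddCommGroup M] [Module k M]
    {𝒜 : ι → Submodule k M} (h : DirectSum.IsInternal 𝒜) {i : ι} (x : 𝒜 i) :
    component h i (x : M) = x :=
  h.ofBijective_coeLinearMap_same x

theorem component_ne {ι : Type} [DecidableEq ι] {M : Type u} [AddCommGroup M] [Module k M]
    {𝒜 : ι → Submodule k M} (h : DirectSum.IsInternal 𝒜) {i j : ι} (hij : i ≠ j) (x : 𝒜 i) :
    component h j (x : M) = 0 :=
  h.ofBijective_coeLinearMap_of_ne hij x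

theorem pr_of_mem {C D : Type} [Finite C] [Finite D] {G : ℕ} {i : ℤ} {x : P.obj C D}
    (hx : x ∈ 𝒢.bi C D G i) : 𝒢.pr C D G i x = ⟨x, hx⟩ :=
  component_coe (𝒜 := fun p : ℕ × ℤ => 𝒢.bi C D p.1 p.2) (𝒢.internal C D) (i := (G, i)) ⟨x, hx⟩

theorem pr_of_mem_ne {C D : Type} [Finite C] [Finite D] {G G' : ℕ} {i i' : ℤ} {x : P.obj C D}
    (hx : x ∈ 𝒢.bi C D G i) (h : (G, i) ≠ (G', i')) : 𝒢.pr C D G' i' x = 0 :=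
  component_ne (𝒜 := fun p : ℕ × ℤ => 𝒢.bi C D p.1 p.2) (𝒢.internal C D) h ⟨x, hx⟩

theorem bi_ind {C D : Type} [Finite C] [Finite D] {p : P.obj C D → Prop}
    (h : ∀ G i, ∀ x ∈ 𝒢.bi C D G i, p x) (hadd : ∀ x y, p x → p y → p (x + y))
    (x : P.obj C D) : p x := by
  have hx : x ∈ ⨆ q : ℕ × ℤ, 𝒢.bi C D q.1 q.2 := by
    rw [(𝒢.internal C D).submodule_iSup_eq_top]; trivial
  induction hx using Submodule.iSup_induction' with
  | mem q x hx => exact h _ _ x hx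
  | zero => exact h 0 0 0 (zero_mem _)
  | add x y _ _ hx hy => exact hadd x y hx hy

theorem pr_act {C D C' D' : Type} [Finite C] [Finite D] [Finite C'] [Finite D']
    (ρ : C ≃ C') (σ : D ≃ D') (G : ℕ) (i : ℤ) (x : P.obj C D) :
    (𝒢.pr C' D' G i (P.act ρ σ x) : P.obj C' D') = P.act ρ σ (𝒢.pr C D G i x) := by
  induction x using 𝒢.bi_ind with
  | h G' i' x hx =>
    by_cases h : (G', i') = (G, i)
    · obtain ⟨rfl, rfl⟩ := Prod.mk.inj h
      rw [pr_of_mem hx, pr_of_mem (𝒢.act_mem ρ σ hx)]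
    · rw [pr_of_mem_ne hx h, pr_of_mem_ne (𝒢.act_mem ρ σ hx) h]; simp
  | hadd x y hx hy => simp only [map_add, Submodule.coe_add, hx, hy]

theorem pr_deg_zero {C D : Type} [Finite C] [Finite D] {G : ℕ} {i j : ℤ} {x : P.obj C D}
    (hx : x ∈ P.deg C D j) (h : i ≠ j) : 𝒢.pr C D G i x = 0 := by
  have key : ∀ x : P.obj C D,
      𝒢.pr C D G i x = 𝒢.pr C D G i (component (P.internal C D) i x : P.obj C D) := by
    intro x
    induction x using 𝒢.bi_ind with
    | h G' i' x hx =>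
      by_cases h : i' = i
      · subst h
        rw [component_coe (P.internal C D) (i := i') ⟨x, 𝒢.bi_le _ _ _ _ hx⟩]
      · rw [component_ne (P.internal C D) h ⟨x, 𝒢.bi_le _ _ _ _ hx⟩,
          pr_of_mem_ne hx (fun h' => h (Prod.mk.inj h').2)]
        simp
    | hadd x y hx hy => simp only [map_add, Submodule.coe_add, hx, hy]
  rw [key, component_ne (P.internal C D) (Ne.symm h) ⟨x, hx⟩]
  simp

theorem mem_of_eq_zero {X : Type u} {W : Type v} [AddCommGroup X] [Module k X] [AddCommGroup W]
    [Module k W] (F : X →ₗ[k] W) (S : Submodule k W) {b : X} (hb : b = 0) : F b ∈ S := by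
  rw [hb, map_zero]; exact zero_mem _

theorem quadPart_mem {C₁ C₂ D₁ D₂ C D : Type} [Finite C₁] [Finite C₂] [Finite D₁] [Finite D₂]
    [Finite C] [Finite D] (e : C₁ ⊕ C₂ ≃ C) (f : D₁ ⊕ D₂ ≃ D) (n : ℕ) (p q : ℕ × ℤ) (G : ℕ)
    (l : ℤ) (ξ : 𝒢.DualPart C D G l) : 𝒢.quadPart e f n p q G l ξ ∈ freeDeg C D (1 - l + 1) := by
  have := 𝒢.bi_finite C₁ (D₁ ⊕ Fin (n + 1)) p.1 p.2
  have := 𝒢.bi_finite (C₂ ⊕ Fin (n + 1)) D₂ q.1 q.2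
  rw [quadPart, LinearMap.smul_apply, LinearMap.comp_apply]
  refine Submodule.smul_mem _ _ ?_
  by_cases h : l = p.2 + q.2
  · refine dualContract_mem _ _ (fun ζ θ => ?_) _
    simp only [LinearMap.compr₂_apply, LinearMap.compl₁₂_apply]
    have := freeAct_mem (𝒢 := 𝒢) e f (freeComp_mem (Equiv.refl (Fin (n + 1)))
      (incl_mem p.1 p.2 ζ) (incl_mem q.1 q.2 θ))
    convert this using 1
    rw [h]; ring_nf
  · refine mem_of_eq_zero _ _ ?_
    refine TensorProduct.ext' fun x y => ?_
    simp only [LinearMap.lcomp_apply, LinearMap.comp_apply, TensorProduct.lift.tmul,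
      LinearMap.compl₁₂_apply, Submodule.subtype_apply, LinearMap.zero_apply]
    rw [pr_deg_zero (P.act_deg e f (P.comp_deg _ (𝒢.bi_le _ _ _ _ x.2) (𝒢.bi_le _ _ _ _ y.2))) h,
      map_zero]

theorem quad_mem {C D : Type} [Finite C] [Finite D] (G : ℕ)
    (l : ℤ) (ξ : 𝒢.DualPart C D G l) : 𝒢.quad C D G l ξ ∈ freeDeg C D (1 - l + 1) := by
  refine finsum_induction (fun F : 𝒢.DualPart C D G l →ₗ[k] 𝒢.Free C D =>
    F ξ ∈ freeDeg C D (1 - l + 1)) ?_ ?_ ?_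
  · simp
  · intro F F' h h'
    rw [LinearMap.add_apply]; exact add_mem h h'
  · intro t
    exact quadPart_mem _ _ _ _ _ _ _ _

theorem dMon_mem {C D : Type} (a : 𝒢.Mon C D) : 𝒢.dMon a ∈ freeDeg C D (a.deg + 1) := by
  induction a with
  | gen G i ξ =>
    refine add_mem ?_ (quad_mem G i ξ)
    convert incl_mem (𝒢 := 𝒢) G (i - 1) (𝒢.dualD _ _ G i ξ) using 1
    simp only [Mon.deg]; ring_nf
  | act ρ σ a ha => exact freeAct_mem ρ σ ha
  | comp η a b ha hb =>
    refine add_mem ?_ (Submodule.smul_mem _ _ ?_)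
    · convert freeComp_mem η ha (cls_mem_freeDeg b rfl) using 1
      simp only [Mon.deg]; ring_nf
    · convert freeComp_mem η (cls_mem_freeDeg a rfl) hb using 1
      simp only [Mon.deg]; ring_nf

theorem freeAct_incl {C D C' D' : Type} [Finite C] [Finite D] [Finite C'] [Finite D'] (ρ : C ≃ C')
    (σ : D ≃ D') (G : ℕ) (i : ℤ) (ξ : 𝒢.DualPart C D G i) :
    freeAct ρ σ (𝒢.incl C D G i ξ) = 𝒢.incl C' D' G i (𝒢.dualAct ρ σ G i ξ) := by
  change freeAct ρ σ (𝒢.cls C D (Mon.gen G i ξ).lin) = _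
  rw [freeAct_cls]
  exact cls_eq (Rel.gen_act ρ σ G i ξ)

theorem pr_coe_pr {C D : Type} [Finite C] [Finite D] (G : ℕ) (i : ℤ) (x : P.obj C D) :
    𝒢.pr C D G i (𝒢.pr C D G i x : P.obj C D) = 𝒢.pr C D G i x :=
  pr_of_mem (𝒢.pr C D G i x).2

theorem pr_act_pr {C D C' D' : Type} [Finite C] [Finite D] [Finite C'] [Finite D']
    (ρ : C ≃ C') (σ : D ≃ D') (G : ℕ) (i : ℤ) (x : P.obj C D) :
    𝒢.pr C' D' G i (P.act ρ σ (𝒢.pr C D G i x)) = 𝒢.pr C' D' G i (P.act ρ σ x) := by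
  rw [← pr_act, pr_coe_pr]

theorem dualAct_apply {C D C' D' : Type} [Finite C] [Finite D] [Finite C'] [Finite D'] (ρ : C ≃ C')
    (σ : D ≃ D') (G : ℕ) (i : ℤ) (ξ : 𝒢.DualPart C D G i) (x : P.obj C' D') :
    𝒢.dualAct ρ σ G i ξ (𝒢.pr C' D' G i x) = ξ (𝒢.pr C D G i (P.act ρ.symm σ.symm x)) := by
  change ξ (𝒢.pr C D G i (P.act ρ.symm σ.symm (𝒢.pr C' D' G i x : P.obj C' D'))) = _
  rw [pr_act_pr]

theorem dualD_dualAct {C D C' D' : Type} [Finite C] [Finite D] [Finite C'] [Finite D']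
    (ρ : C ≃ C') (σ : D ≃ D') (G : ℕ) (i : ℤ) (ξ : 𝒢.DualPart C D G i) :
    𝒢.dualD C' D' G i (𝒢.dualAct ρ σ G i ξ) = 𝒢.dualAct ρ σ G (i - 1) (𝒢.dualD C D G i ξ) := by
  refine LinearMap.ext fun x => ?_
  change sgn k i • 𝒢.dualAct ρ σ G i ξ (𝒢.pr C' D' G i (P.d C' D' x)) =
    sgn k i • ξ (𝒢.pr C D G i (P.d C D (𝒢.pr C D G (i - 1) (P.act ρ.symm σ.symm x) : P.obj C D)))
  rw [dualAct_apply, ← P.d_act, pr_of_mem (𝒢.act_mem ρ.symm σ.symm x.2)]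

theorem dualContract_map {X X' : Type u} {Y Y' : Type u'} {W : Type v} [AddCommGroup X]
    [Module k X] [AddCommGroup Y] [Module k Y] [AddCommGroup X'] [Module k X'] [AddCommGroup Y']
    [Module k Y'] [AddCommGroup W] [Module k W] [Module.Finite k X] [Module.Finite k Y]
    [Module.Finite k X'] [Module.Finite k Y']
    (Γ : Module.Dual k X →ₗ[k] Module.Dual k Y →ₗ[k] W)
    (Γ' : Module.Dual k X' →ₗ[k] Module.Dual k Y' →ₗ[k] W) (φ : X →ₗ[k] X') (ψ : Y →ₗ[k] Y')
    (h : ∀ ζ θ, Γ (φ.dualMap ζ) (ψ.dualMap θ) = Γ' ζ θ) (b : Module.Dual k (X' ⊗[k] Y')) :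
    dualContract Γ (b ∘ₗ TensorProduct.map φ ψ) = dualContract Γ' b := by
  obtain ⟨t, rfl⟩ := (TensorProduct.dualDistribEquiv k X' Y').surjective b
  have key : (TensorProduct.dualDistribEquiv k X' Y' t) ∘ₗ TensorProduct.map φ ψ =
      TensorProduct.dualDistribEquiv k X Y (TensorProduct.map φ.dualMap ψ.dualMap t) := by
    refine TensorProduct.ext' fun x y => ?_
    induction t using TensorProduct.induction_on with
    | zero => simp
    | tmul ζ θ => rfl
    | add s t hs ht =>
      simp only [map_add, LinearMap.comp_apply, LinearMap.add_apply] at hs ht ⊢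
      rw [hs, ht]
  rw [key]
  simp only [dualContract, LinearMap.comp_apply, LinearEquiv.coe_coe,
    LinearEquiv.symm_apply_apply]
  clear key
  induction t using TensorProduct.induction_on with
  | zero => simp
  | tmul ζ θ => simpa using h ζ θ
  | add s t hs ht => simp only [map_add, hs, ht]

theorem dualContract_post {X : Type u} {Y : Type u'} {W W' : Type v} [AddCommGroup X] [Module k X]
    [AddCommGroup Y] [Module k Y] [AddCommGroup W] [Module k W] [AddCommGroup W'] [Module k W']
    [Module.Finite k X] [Module.Finite k Y] (Γ : Module.Dual k X →ₗ[k] Module.Dual k Y →ₗ[k] W)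
    (Γ' : Module.Dual k X →ₗ[k] Module.Dual k Y →ₗ[k] W')
    (F : W →ₗ[k] W') (h : ∀ ζ θ, F (Γ ζ θ) = Γ' ζ θ) (b : Module.Dual k (X ⊗[k] Y)) :
    F (dualContract Γ b) = dualContract Γ' b := by
  simp only [dualContract, LinearMap.comp_apply]
  generalize (TensorProduct.dualDistribEquiv k X Y).symm.toLinearMap b = t
  induction t using TensorProduct.induction_on with
  | zero => simp
  | tmul ζ θ => simpa using h ζ θ
  | add s t hs ht => simp only [map_add, hs, ht]

theorem quadPart_act {C₁ C₂ D₁ D₂ C D C' D' : Type} [Finite C₁] [Finite C₂] [Finite D₁]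
    [Finite D₂] [Finite C] [Finite D] [Finite C'] [Finite D'] (e : C₁ ⊕ C₂ ≃ C) (f : D₁ ⊕ D₂ ≃ D)
    (ρ : C ≃ C') (σ : D ≃ D') (n : ℕ) (p q : ℕ × ℤ) (G : ℕ) (l : ℤ) (ξ : 𝒢.DualPart C D G l) :
    freeAct ρ σ (𝒢.quadPart e f n p q G l ξ) =
      𝒢.quadPart (e.trans ρ) (f.trans σ) n p q G l (𝒢.dualAct ρ σ G l ξ) := by
  have := 𝒢.bi_finite C₁ (D₁ ⊕ Fin (n + 1)) p.1 p.2
  have := 𝒢.bi_finite (C₂ ⊕ Fin (n + 1)) D₂ q.1 q.2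
  simp only [quadPart, LinearMap.smul_apply, LinearMap.comp_apply, map_smul]
  congr 1
  refine (dualContract_post _
    (((freeComp (Equiv.refl (Fin (n + 1)))).compl₁₂ (𝒢.incl C₁ (D₁ ⊕ Fin (n + 1)) p.1 p.2)
      (𝒢.incl (C₂ ⊕ Fin (n + 1)) D₂ q.1 q.2)).compr₂ (freeAct (e.trans ρ) (f.trans σ)))
    (freeAct ρ σ) (fun ζ θ => ?_) _).trans ?_
  · rw [LinearMap.compr₂_apply, LinearMap.compr₂_apply, free_act_act]
  · refine congrArg _ (TensorProduct.ext' (R := k) fun x y => ?_)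
    simp only [LinearMap.lcomp_apply, LinearMap.comp_apply, dualAct_apply, P.act_act,
      Equiv.trans_assoc, Equiv.self_trans_symm, Equiv.trans_refl]

theorem quadPart_congr {C₁ C₂ D₁ D₂ C₁' C₂' D₁' D₂' C D : Type} [Finite C₁] [Finite C₂]
    [Finite D₁] [Finite D₂] [Finite C₁'] [Finite C₂'] [Finite D₁'] [Finite D₂'] [Finite C]
    [Finite D] (e : C₁ ⊕ C₂ ≃ C) (f : D₁ ⊕ D₂ ≃ D) (e' : C₁' ⊕ C₂' ≃ C) (f' : D₁' ⊕ D₂' ≃ D)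
    (a : C₁ ≃ C₁') (b : C₂ ≃ C₂') (c : D₁ ≃ D₁') (g : D₂ ≃ D₂')
    (he : (Equiv.sumCongr a b).trans e' = e) (hf : (Equiv.sumCongr c g).trans f' = f)
    (n : ℕ) (p q : ℕ × ℤ) (G : ℕ) (l : ℤ) :
    𝒢.quadPart e f n p q G l = 𝒢.quadPart e' f' n p q G l := by
  have := 𝒢.bi_finite C₁ (D₁ ⊕ Fin (n + 1)) p.1 p.2
  have := 𝒢.bi_finite (C₂ ⊕ Fin (n + 1)) D₂ q.1 q.2
  have := 𝒢.bi_finite C₁' (D₁' ⊕ Fin (n + 1)) p.1 p.2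
  have := 𝒢.bi_finite (C₂' ⊕ Fin (n + 1)) D₂' q.1 q.2
  refine LinearMap.ext fun ξ => ?_
  simp only [quadPart, LinearMap.smul_apply, LinearMap.comp_apply]
  congr 1
  refine Eq.trans ?_ (dualContract_map
    (((freeComp (Equiv.refl (Fin (n + 1)))).compl₁₂ (𝒢.incl C₁ (D₁ ⊕ Fin (n + 1)) p.1 p.2)
      (𝒢.incl (C₂ ⊕ Fin (n + 1)) D₂ q.1 q.2)).compr₂ (freeAct e f)) _
    (𝒢.pr C₁' (D₁' ⊕ Fin (n + 1)) p.1 p.2 ∘ₗ P.act a (Equiv.sumCongr c (Equiv.refl _)) ∘ₗ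
      (𝒢.bi C₁ (D₁ ⊕ Fin (n + 1)) p.1 p.2).subtype)
    (𝒢.pr (C₂' ⊕ Fin (n + 1)) D₂' q.1 q.2 ∘ₗ P.act (Equiv.sumCongr b (Equiv.refl _)) g ∘ₗ
      (𝒢.bi (C₂ ⊕ Fin (n + 1)) D₂ q.1 q.2).subtype) (fun ζ θ => ?_) _)
  · congr 1
    refine TensorProduct.ext' fun x y => ?_
    simp only [LinearMap.lcomp_apply, LinearMap.comp_apply, TensorProduct.lift.tmul,
      LinearMap.compl₁₂_apply, Submodule.subtype_apply, TensorProduct.map_tmul]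
    rw [pr_of_mem (𝒢.act_mem _ _ x.2), pr_of_mem (𝒢.act_mem _ _ y.2)]
    have h := P.act_comp (Equiv.refl (Fin (n + 1))) a c (Equiv.refl _) b g (Equiv.refl _)
      (x : P.obj C₁ (D₁ ⊕ Fin (n + 1))) (y : P.obj (C₂ ⊕ Fin (n + 1)) D₂)
    simp only [Equiv.refl_symm, Equiv.trans_refl] at h
    rw [← h, P.act_act, he, hf]
  · have h1 : 𝒢.incl C₁ (D₁ ⊕ Fin (n + 1)) p.1 p.2 (LinearMap.dualMap
        (𝒢.pr C₁' (D₁' ⊕ Fin (n + 1)) p.1 p.2 ∘ₗ P.act a (Equiv.sumCongr c (Equiv.refl _)) ∘ₗ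
        (𝒢.bi C₁ (D₁ ⊕ Fin (n + 1)) p.1 p.2).subtype) ζ) =
        freeAct a.symm (Equiv.sumCongr c (Equiv.refl _)).symm (𝒢.incl _ _ p.1 p.2 ζ) := by
      rw [freeAct_incl]; rfl
    have h2 : 𝒢.incl (C₂ ⊕ Fin (n + 1)) D₂ q.1 q.2 (LinearMap.dualMap
        (𝒢.pr (C₂' ⊕ Fin (n + 1)) D₂' q.1 q.2 ∘ₗ P.act (Equiv.sumCongr b (Equiv.refl _)) g ∘ₗ
        (𝒢.bi (C₂ ⊕ Fin (n + 1)) D₂ q.1 q.2).subtype) θ) =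
        freeAct (Equiv.sumCongr b (Equiv.refl _)).symm g.symm (𝒢.incl _ _ q.1 q.2 θ) := by
      rw [freeAct_incl]; rfl
    simp only [LinearMap.compr₂_apply, LinearMap.compl₁₂_apply]
    rw [h1, h2]
    have h := free_act_comp (Equiv.refl (Fin (n + 1))) a.symm c.symm (Equiv.refl _) b.symm g.symm
      (Equiv.refl _) (𝒢.incl C₁' (D₁' ⊕ Fin (n + 1)) p.1 p.2 ζ)
      (𝒢.incl (C₂' ⊕ Fin (n + 1)) D₂' q.1 q.2 θ)
    simp only [Equiv.refl_symm, Equiv.trans_refl] at h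
    simp only [Equiv.sumCongr_symm, Equiv.refl_symm]
    rw [← h, free_act_act, ← he, ← hf, ← Equiv.trans_assoc, ← Equiv.trans_assoc,
      ← Equiv.sumCongr_symm, ← Equiv.sumCongr_symm]
    simp only [Equiv.symm_trans_self, Equiv.refl_trans]

theorem quad_act {C D C' D' : Type} [Finite C] [Finite D] [Finite C'] [Finite D']
    (ρ : C ≃ C') (σ : D ≃ D') (G : ℕ) (l : ℤ) (ξ : 𝒢.DualPart C D G l) :
    freeAct ρ σ (𝒢.quad C D G l ξ) = 𝒢.quad C' D' G l (𝒢.dualAct ρ σ G l ξ) := by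
  classical
  have hA : ∀ z : 𝒢.Free C D, freeAct ρ.symm σ.symm (freeAct ρ σ z) = z := fun z => by
    rw [free_act_act, Equiv.self_trans_symm, Equiv.self_trans_symm, free_act_refl]
  have hA' : ∀ z : 𝒢.Free C' D', freeAct ρ σ (freeAct ρ.symm σ.symm z) = z := fun z => by
    rw [free_act_act, Equiv.symm_trans_self, Equiv.symm_trans_self, free_act_refl]
  have hB : ∀ z : 𝒢.DualPart C D G l, 𝒢.dualAct ρ.symm σ.symm G l (𝒢.dualAct ρ σ G l z) = z :=
    fun z => LinearMap.ext fun x => by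
      obtain ⟨y, rfl⟩ : ∃ y, 𝒢.pr _ _ G l y = x := ⟨x, pr_of_mem x.2⟩
      rw [dualAct_apply, dualAct_apply, P.act_act, Equiv.symm_symm,
        Equiv.symm_symm, Equiv.self_trans_symm, Equiv.self_trans_symm, P.act_refl]
  have hB' : ∀ z : 𝒢.DualPart C' D' G l, 𝒢.dualAct ρ σ G l (𝒢.dualAct ρ.symm σ.symm G l z) = z :=
    fun z => LinearMap.ext fun x => by
      obtain ⟨y, rfl⟩ : ∃ y, 𝒢.pr _ _ G l y = x := ⟨x, pr_of_mem x.2⟩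
      rw [dualAct_apply, dualAct_apply, P.act_act, Equiv.symm_symm,
        Equiv.symm_symm, Equiv.symm_trans_self, Equiv.symm_trans_self, P.act_refl]
  let A : 𝒢.Free C D ≃ₗ[k] 𝒢.Free C' D' :=
    LinearEquiv.ofLinearMap (freeAct ρ σ) (freeAct ρ.symm σ.symm)
      (LinearMap.ext hA') (LinearMap.ext hA)
  let B : 𝒢.DualPart C D G l ≃ₗ[k] 𝒢.DualPart C' D' G l :=
    LinearEquiv.ofLinearMap (𝒢.dualAct ρ σ G l) (𝒢.dualAct ρ.symm σ.symm G l)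
      (LinearMap.ext hB') (LinearMap.ext hB)
  suffices h : LinearEquiv.arrowCongr B A (𝒢.quad C D G l) = 𝒢.quad C' D' G l by
    rw [← h]
    change _ = freeAct ρ σ (𝒢.quad C D G l (𝒢.dualAct ρ.symm σ.symm G l _))
    rw [hB]
  let E : (Set C × Set D) × ℕ × (ℕ × ℤ) × (ℕ × ℤ) ≃ (Set C' × Set D') × ℕ × (ℕ × ℤ) × (ℕ × ℤ) :=
    Equiv.prodCongr (Equiv.prodCongr (Equiv.Set.congr ρ) (Equiv.Set.congr σ)) (Equiv.refl _)
  rw [quad, quad]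
  refine ((LinearEquiv.arrowCongr B A).toAddEquiv.map_finsum _).trans ?_
  rw [← finsum_comp_equiv E]
  refine finsum_congr fun t => ?_
  obtain ⟨⟨S, T⟩, n, p, q⟩ := t
  refine LinearMap.ext fun ξ => ?_
  change freeAct ρ σ (𝒢.quadPart _ _ n p q G l (𝒢.dualAct ρ.symm σ.symm G l ξ)) =
    𝒢.quadPart (Equiv.Set.sumCompl (ρ '' S)) (Equiv.Set.sumCompl (σ '' T)) n p q G l ξ
  rw [quadPart_act, hB']
  have hc : ∀ {α β : Type} (τ : α ≃ β) (U : Set α), ∀ x : α, x ∈ Uᶜ ↔ τ x ∈ (τ '' U)ᶜ := by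
    intro α β τ U x; simp
  refine congrFun (congrArg DFunLike.coe (quadPart_congr _ _ _ _ (ρ.image S)
    (ρ.subtypeEquiv (hc ρ S)) (σ.image T) (σ.subtypeEquiv (hc σ T)) ?_ ?_ n p q G l)) ξ
  · ext x; rcases x with x | x <;> rfl
  · ext x; rcases x with x | x <;> rfl

theorem dLin_rel {C D : Type} {x : 𝒢.Lin C D} (hx : Rel x) : 𝒢.dLin C D x = 0 := by
  induction hx with
  | zero => rw [map_zero]
  | add _ _ hx hy => rw [map_add, hx, hy, add_zero]
  | smul c _ hx => rw [map_smul, hx, smul_zero]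
  | act ρ σ _ hx => rw [dLin_linAct, hx, map_zero]
  | comp_left η y hr hx =>
    have h2 : 𝒢.cls _ _ (linParity _ _ _) = 0 :=
      (Submodule.Quotient.mk_eq_zero _).2 (rel_parity hr)
    rw [dLin_linComp, hx, h2]
    simp only [map_zero, LinearMap.zero_apply, add_zero]
  | comp_right η x hr hy =>
    have h2 : 𝒢.cls _ _ _ = 0 := (Submodule.Quotient.mk_eq_zero _).2 hr
    rw [dLin_linComp, hy, h2]
    simp only [map_zero, add_zero]
  | gen_add G i ξ ζ =>
    rw [map_sub, map_add, dLin_lin, dLin_lin, dLin_lin, sub_eq_zero]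
    simp only [dMon, map_add]
    abel
  | gen_smul G i c ξ =>
    rw [map_sub, map_smul, dLin_lin, dLin_lin, sub_eq_zero]
    simp only [dMon, map_smul, smul_add]
  | gen_act ρ σ G i ξ =>
    rw [map_sub, dLin_lin, dLin_lin, sub_eq_zero]
    simp only [dMon]
    rw [map_add, freeAct_incl, quad_act, dualD_dualAct]
  | act_refl a =>
    rw [map_sub, dLin_lin, dLin_lin, sub_eq_zero, dMon, free_act_refl]
  | act_act ρ σ ρ' σ' a =>
    rw [map_sub, dLin_lin, dLin_lin, sub_eq_zero, dMon, dMon, dMon, free_act_act]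
  | act_comp η ρ₁ σ₁ β ρ₂ σ₂ α a b =>
    rw [map_sub, dLin_lin, dLin_lin, sub_eq_zero]
    simp only [dMon, map_add, map_smul, ← freeAct_cls]
    rw [free_act_comp η ρ₁ σ₁ β ρ₂ σ₂ α, free_act_comp η ρ₁ σ₁ β ρ₂ σ₂ α]
    rfl
  | assoc η₁ η₂ η₃ a b c =>
    rw [map_sub, dLin_lin, dLin_lin, sub_eq_zero]
    simp only [dMon, map_add, map_smul, ← freeAct_cls, ← freeComp_cls, LinearMap.add_apply,
      LinearMap.smul_apply, free_assoc, Mon.deg, smul_add, smul_smul, sgn_add, add_assoc]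
  | par_out η η' a b c =>
    rw [map_sub, map_smul, dLin_lin, dLin_lin, sub_eq_zero]
    simp only [dMon, map_add, map_smul, ← freeAct_cls, ← freeComp_cls,
      smul_add, smul_smul]
    rw [free_par_out η η' _ (dMon_mem a) (cls_mem_freeDeg b rfl),
      free_par_out η η' _ (cls_mem_freeDeg a rfl) (dMon_mem b),
      free_par_out η η' _ (cls_mem_freeDeg a rfl) (cls_mem_freeDeg b rfl)]
    simp only [smul_smul, add_mul, mul_add, sgn_add, one_mul, mul_one]
    have h : ∀ u v : ℤ, sgn k u * (sgn k v * sgn k u) = sgn k v := fun u v => by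
      rw [mul_left_comm, sgn_mul_self, mul_one]
    rw [h, mul_comm (sgn k a.deg * sgn k b.deg), mul_comm (sgn k b.deg) (sgn k a.deg)]
    abel
  | par_in η η' a b c =>
    rw [map_sub, map_smul, dLin_lin, dLin_lin, sub_eq_zero]
    simp only [dMon, map_add, map_smul, ← freeAct_cls, ← freeComp_cls, LinearMap.add_apply,
      LinearMap.smul_apply, Mon.deg, smul_add, smul_smul]
    rw [free_par_in η η' _ (cls_mem_freeDeg b rfl) (cls_mem_freeDeg c rfl),
      free_par_in η η' _ (cls_mem_freeDeg b rfl) (dMon_mem c),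
      free_par_in η η' _ (dMon_mem b) (cls_mem_freeDeg c rfl)]
    simp only [smul_smul, add_mul, mul_add, sgn_add, one_mul, mul_one]
    have h : ∀ u v : ℤ, sgn k u * (sgn k v * sgn k u) = sgn k v := fun u v => by
      rw [mul_left_comm, sgn_mul_self, mul_one]
    rw [mul_assoc (sgn k a.deg), h, mul_comm (sgn k (b.deg * c.deg)) (sgn k a.deg),
      mul_left_comm (sgn k (b.deg * c.deg))]
    abel

variable (𝒢)

/-- The differential of the cobar complex. -/
def freeD (C D : Type) : 𝒢.Free C D →ₗ[k] 𝒢.Free C D :=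
  (𝒢.relSub C D).liftQ (𝒢.dLin C D) (fun _ hx => LinearMap.mem_ker.2 (dLin_rel hx))

/-- The cobar complex of a properad: the free properad generated by the suspended dual, with the
differential induced by the dual of the operations and the differential of the dual. -/
def cobar : ProperadData.{w, max 1 u w} k where
  obj C D := 𝒢.Free C D
  deg C D := freeDeg C D
  d C D := 𝒢.freeD C D
  act := freeAct
  comp := freeComp

end Properad.StableGrading

end Cobar

/-! ### The endomorphism properad -/

/-- A dg vector space. -/
structure DGVect (k : Type w) [Field k] where
  carrier : Type v
  [addCommGroup : AddCommGroup carrier]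
  [module : Module k carrier]
  deg : ℤ → Submodule k carrier
  internal : DirectSum.IsInternal deg
  d : carrier →ₗ[k] carrier
  d_deg : ∀ {i : ℤ} {x : carrier}, x ∈ deg i → d x ∈ deg (i + 1)
  d_d : ∀ x : carrier, d (d x) = 0

attribute [instance] DGVect.addCommGroup DGVect.module

/-- The (strict) total orders on `C`. -/
abbrev Ordering (C : Type) : Type := {r : C → C → Prop // IsStrictTotalOrder C r}

theorem ordering_nonempty (C : Type) : Nonempty (Ordering C) :=
  ⟨⟨WellOrderingRel, inferInstance⟩⟩

namespace Ordering

/-- Transport of a total order along a bijection. -/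
def map {C D : Type} (σ : C ≃ D) (r : Ordering C) : Ordering D :=
  ⟨fun a b => r.1 (σ.symm a) (σ.symm b),
    haveI := r.2
    { irrefl := fun a => irrefl_of r.1 (σ.symm a)
      trans := fun _ _ _ h h' => trans_of r.1 h h'
      trichotomous := fun a b h h' => σ.symm.injective
        ((trichotomous_of r.1 (σ.symm a) (σ.symm b)).resolve_left h |>.resolve_right h') }⟩

/-- The total order on `C ⊔ D` that puts `C` before `D`. -/
def sum {C D : Type} (r : Ordering C) (r' : Ordering D) : Ordering (C ⊕ D) :=
  ⟨Sum.Lex r.1 r'.1, haveI := r.2; haveI := r'.2; {}⟩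

end Ordering

section Endo

variable {k : Type w} [Field k]

namespace DGVect

/-- The tensor product of copies of `V` indexed by `C`. -/
abbrev T (V : DGVect.{w, v} k) (C : Type) : Type (max w v) := ⨂[k] _ : C, V.carrier

variable (V : DGVect.{w, v} k)

open Classical in
/-- The projection of the tensor product onto the part whose factors with index in `O` are odd and
whose other factors are even. -/
def part {C : Type} (O : Finset C) : V.T C →ₗ[k] V.T C :=
  PiTensorProduct.map (O.piecewise (fun _ => proj V.internal Odd) (fun _ => proj V.internal Even))

/-- The Koszul sign of passing from the order `r` to the order `r'`, when exactly the factors with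
index in `O` are odd. -/
def koszulSign (k : Type w) [Field k] {C : Type} (O : Finset C) (r r' : Ordering C) : k :=
  sgn k ({p : C × C | p.1 ∈ O ∧ p.2 ∈ O ∧ r.1 p.1 p.2 ∧ r'.1 p.2 p.1}.ncard : ℤ)

/-- The isomorphism from the tensor product of the factors in the order `r` to the tensor product of
the factors in the order `r'`, permuting the factors with the Koszul sign. -/
def koszul {C : Type} (r r' : Ordering C) : V.T C →ₗ[k] V.T C :=
  ∑ᶠ O : Finset C, koszulSign k O r r' • V.part O

/-- The unordered tensor product of copies of `V` indexed by `C`: an element is represented by an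
element of the tensor product for each total order on `C`, and these correspond to each other
under permutations of the factors with Koszul signs. -/
def odot (C : Type) : Submodule k (Ordering C → V.T C) where
  carrier := {x | ∀ r r' : Ordering C, x r' = V.koszul r r' (x r)}
  zero_mem' := fun r r' => by simp only [Pi.zero_apply, map_zero]
  add_mem' := fun hx hy r r' => by simp only [Pi.add_apply, map_add, ← hx r r', ← hy r r']
  smul_mem' := fun c _ hx r r' => by simp only [Pi.smul_apply, map_smul, ← hx r r']

open Classical in
theorem proj_of_mem (s : ℤ → Prop) {i : ℤ} {x : V.carrier} (hx : x ∈ V.deg i) :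
    proj V.internal s x = if s i then x else 0 := by
  have h : decomp V.internal x = DirectSum.of (fun i => V.deg i) i ⟨x, hx⟩ := by
    rw [decomp, LinearEquiv.symm_apply_eq]
    exact (DirectSum.coeLinearMap_of V.deg i ⟨x, hx⟩).symm
  rw [proj, LinearMap.comp_apply, LinearEquiv.coe_coe, h]
  refine (DirectSum.toModule_lof k i _).trans ?_
  split_ifs <;> rfl

theorem carrier_ind {p : V.carrier → Prop} (h : ∀ i, ∀ x ∈ V.deg i, p x)
    (hadd : ∀ x y, p x → p y → p (x + y)) (x : V.carrier) : p x := by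
  have hx : x ∈ ⨆ i, V.deg i := by
    rw [V.internal.submodule_iSup_eq_top]; trivial
  induction hx using Submodule.iSup_induction' with
  | mem i x hx => exact h i x hx
  | zero => exact h 0 0 (zero_mem _)
  | add x y _ _ hx hy => exact hadd x y hx hy

theorem proj_idem (s : ℤ → Prop) : proj V.internal s ∘ₗ proj V.internal s = proj V.internal s := by
  refine LinearMap.ext fun x => ?_
  induction x using V.carrier_ind with
  | h i x hx =>
    rw [LinearMap.comp_apply, V.proj_of_mem s hx]
    split_ifs with h
    · rw [V.proj_of_mem s hx, if_pos h]
    · rw [map_zero]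
  | hadd x y hx hy => rw [map_add, hx, hy, map_add]

theorem proj_orth (s t : ℤ → Prop) (h : ∀ i, s i → ¬ t i) :
    proj V.internal s ∘ₗ proj V.internal t = 0 := by
  refine LinearMap.ext fun x => ?_
  induction x using V.carrier_ind with
  | h i x hx =>
    rw [LinearMap.comp_apply, V.proj_of_mem t hx]
    split_ifs with h'
    · rw [V.proj_of_mem s hx, if_neg fun hs => h i hs h', LinearMap.zero_apply]
    · rw [map_zero, LinearMap.zero_apply]
  | hadd x y hx hy => rw [map_add, hx, hy, map_add]

theorem proj_odd_add_even : proj V.internal Odd + proj V.internal Even = LinearMap.id := by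
  refine LinearMap.ext fun x => ?_
  induction x using V.carrier_ind with
  | h i x hx =>
    rw [LinearMap.add_apply, V.proj_of_mem _ hx, V.proj_of_mem _ hx, LinearMap.id_apply]
    rcases Int.even_or_odd i with h | h
    · rw [if_neg (Int.not_odd_iff_even.2 h), if_pos h, zero_add]
    · rw [if_pos h, if_neg (Int.not_even_iff_odd.2 h), add_zero]
  | hadd x y hx hy => rw [map_add, hx, hy, map_add]

open Classical in
theorem part_part {C : Type} (O O' : Finset C) :
    V.part O ∘ₗ V.part O' = if O = O' then V.part O else 0 := by
  rw [part, part, ← PiTensorProduct.map_comp]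
  split_ifs with h
  · subst h
    congr 1
    funext c
    by_cases hc : c ∈ O
    · simp only [Finset.piecewise, hc, if_true, proj_idem]
    · simp only [Finset.piecewise, hc, if_false, proj_idem]
  · obtain ⟨c, hc⟩ : ∃ c, ¬ (c ∈ O ↔ c ∈ O') := by
      by_contra hcon
      push Not at hcon
      exact h (Finset.ext hcon)
    refine (PiTensorProduct.mapMultilinear k (fun _ : C => V.carrier)
      (fun _ => V.carrier)).map_coord_zero c ?_
    by_cases h1 : c ∈ O
    · have h2 : c ∉ O' := fun h2 => hc ⟨fun _ => h2, fun _ => h1⟩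
      simp only [Finset.piecewise, h1, h2, if_true, if_false]
      exact V.proj_orth _ _ fun i hi => Int.not_even_iff_odd.2 hi
    · have h2 : c ∈ O' := by
        by_contra h2
        exact hc ⟨fun h => absurd h h1, fun h => absurd h h2⟩
      simp only [Finset.piecewise, h1, h2, if_true, if_false]
      exact V.proj_orth _ _ fun i hi => Int.not_odd_iff_even.2 hi

theorem sum_part {C : Type} [Finite C] : ∑ᶠ O : Finset C, V.part O = LinearMap.id := by
  classical
  have := Fintype.ofFinite C
  rw [finsum_eq_sum_of_fintype]
  have h := (PiTensorProduct.mapMultilinear k (fun _ : C => V.carrier)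
    (fun _ => V.carrier)).map_add_univ (fun _ => proj V.internal Odd)
      (fun _ => proj V.internal Even)
  refine Eq.trans (Finset.sum_congr rfl fun O _ => ?_) (h.symm.trans ?_)
  · rw [part, PiTensorProduct.mapMultilinear_apply]
  · rw [PiTensorProduct.mapMultilinear_apply]
    refine Eq.trans (congrArg PiTensorProduct.map (funext fun c => ?_)) PiTensorProduct.map_id
    exact V.proj_odd_add_even

open Classical in
theorem koszulSign_eq {C : Type} [Fintype C] (O : Finset C) (r r' : Ordering C) :
    koszulSign k O r r' = ∏ p : C × C,
      if p.1 ∈ O ∧ p.2 ∈ O ∧ r.1 p.1 p.2 ∧ r'.1 p.2 p.1 then (-1 : k) else 1 := by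
  rw [koszulSign, sgn, Set.ncard_eq_toFinset_card', Finset.prod_ite, Finset.prod_const,
    Finset.prod_const_one, mul_one, Int.negOnePow_def, zpow_natCast, Units.val_pow_eq_pow_val,
    Units.val_neg, Units.val_one, Int.cast_pow, Int.cast_neg, Int.cast_one]
  congr 2
  ext p
  simp

theorem koszulSign_self {C : Type} (O : Finset C) (r : Ordering C) : koszulSign k O r r = 1 := by
  have := r.2
  rw [koszulSign, Set.eq_empty_of_forall_notMem (s := {p : C × C | _})
    fun p hp => asymm_of r.1 hp.2.2.1 hp.2.2.2]
  simp [sgn]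

open Classical in
theorem prod_pairs {C : Type} [Fintype C] (r : Ordering C) (f : C × C → k)
    (hf : ∀ a, f (a, a) = 1) :
    ∏ p, f p = ∏ p : C × C, if r.1 p.1 p.2 then f p * f p.swap else 1 := by
  have := r.2
  have h1 : ∀ p : C × C, f p = (if r.1 p.1 p.2 then f p else 1) *
      (if r.1 p.2 p.1 then f p else 1) := by
    rintro ⟨a, b⟩
    rcases trichotomous_of r.1 a b with h | h | h
    · simp only [h, asymm_of r.1 h, if_true, if_false, mul_one]
    · subst h
      simp only [hf, ite_self, mul_one]
    · simp only [h, asymm_of r.1 h, if_true, if_false, one_mul]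
  rw [Finset.prod_congr rfl fun p _ => h1 p, Finset.prod_mul_distrib,
    ← (Equiv.prodComm C C).prod_comp (fun p : C × C => if r.1 p.2 p.1 then f p else 1),
    ← Finset.prod_mul_distrib]
  refine Finset.prod_congr rfl fun p _ => ?_
  by_cases h : r.1 p.1 p.2
  · simp only [Equiv.prodComm_apply, Prod.fst_swap, Prod.snd_swap, h, if_true]
  · simp only [Equiv.prodComm_apply, Prod.fst_swap, Prod.snd_swap, h, if_false, mul_one]

theorem koszulSign_mul {C : Type} [Finite C] (O : Finset C) (r r' r'' : Ordering C) :
    koszulSign k O r r' * koszulSign k O r' r'' = koszulSign k O r r'' := by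
  classical
  have := Fintype.ofFinite C
  have i1 := r.2
  have i2 := r'.2
  have i3 := r''.2
  have hi : ∀ (s s' : Ordering C) (a : C), (if a ∈ O ∧ a ∈ O ∧ s.1 a a ∧ s'.1 a a then (-1 : k)
      else 1) = 1 := fun s s' a => if_neg fun h => by
    have := s.2
    exact irrefl_of s.1 a h.2.2.1
  have he : ∀ s s' : Ordering C, koszulSign k O s s' = _ := fun s s' =>
    (koszulSign_eq O s s').trans (prod_pairs r _ (hi s s'))
  rw [he, he, he, ← Finset.prod_mul_distrib]
  refine Finset.prod_congr rfl fun p _ => ?_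
  obtain ⟨a, b⟩ := p
  by_cases h : r.1 a b
  swap
  · simp only [h, if_false, mul_one]
  have hne : a ≠ b := fun hab => irrefl_of r.1 a (by rw [← hab] at h; exact h)
  by_cases hO : a ∈ O ∧ b ∈ O
  swap
  · simp only [Prod.fst_swap, Prod.snd_swap]
    have h1 : ∀ q : Prop, ¬ (a ∈ O ∧ b ∈ O ∧ q) := fun q hq => hO ⟨hq.1, hq.2.1⟩
    have h2 : ∀ q : Prop, ¬ (b ∈ O ∧ a ∈ O ∧ q) := fun q hq => hO ⟨hq.2.1, hq.1⟩
    simp only [h1, h2, if_false, mul_one, ite_self]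
  have hr := asymm_of r.1 h
  rcases (trichotomous_of r'.1 a b).imp_right (Or.resolve_left · hne) with h' | h' <;>
  rcases (trichotomous_of r''.1 a b).imp_right (Or.resolve_left · hne) with h'' | h'' <;>
  simp [h, hr, h', asymm_of r'.1 h', h'', asymm_of r''.1 h'', hO]

theorem koszul_self {C : Type} [Finite C] (r : Ordering C) (x : V.T C) : V.koszul r r x = x := by
  have h : V.koszul r r = ∑ᶠ O : Finset C, V.part O :=
    finsum_congr fun O => by rw [koszulSign_self, one_smul]
  rw [h, V.sum_part, LinearMap.id_apply]

theorem koszul_koszul {C : Type} [Finite C] (r r' r'' : Ordering C) (x : V.T C) :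
    V.koszul r' r'' (V.koszul r r' x) = V.koszul r r'' x := by
  classical
  have := Fintype.ofFinite C
  have hp : ∀ (O O' : Finset C) (y : V.T C), V.part O (V.part O' y) =
      if O = O' then V.part O y else 0 := fun O O' y => by
    rw [← LinearMap.comp_apply, V.part_part]
    split_ifs <;> rfl
  rw [koszul, koszul, koszul, finsum_eq_sum_of_fintype, finsum_eq_sum_of_fintype,
    finsum_eq_sum_of_fintype]
  simp only [LinearMap.sum_apply, LinearMap.smul_apply, map_sum, map_smul, hp, smul_ite, smul_zero,
    Finset.sum_ite_eq', Finset.mem_univ, if_true, smul_smul]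
  refine Finset.sum_congr rfl fun O _ => ?_
  rw [koszulSign_mul]

/-- The representation of the elements of the unordered tensor product by means of an order. -/
def ev {C : Type} [Finite C] (r : Ordering C) : V.odot C ≃ₗ[k] V.T C where
  toFun x := x.1 r
  map_add' _ _ := rfl
  map_smul' _ _ := rfl
  invFun t := ⟨fun r' => V.koszul r r' t, fun r' r'' => (V.koszul_koszul r r' r'' t).symm⟩
  left_inv x := Subtype.ext (funext fun r' => (x.2 r r').symm)
  right_inv t := V.koszul_self r t

/-- Some total order; the constructions below do not depend on it. -/
def anyOrder (C : Type) : Ordering C := (ordering_nonempty C).some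

/-- The map of unordered tensor products induced by an endomorphism of the tensor product of the
factors in the chosen order. -/
def onT {C : Type} [Finite C] (f : Ordering C → (V.T C →ₗ[k] V.T C)) : V.odot C →ₗ[k] V.odot C :=
  (V.ev (anyOrder C)).symm.toLinearMap ∘ₗ f (anyOrder C) ∘ₗ (V.ev (anyOrder C)).toLinearMap

/-- The relabelling isomorphism of unordered tensor products. -/
def relabel {C D : Type} [Finite C] [Finite D] (σ : C ≃ D) : V.odot C ≃ₗ[k] V.odot D :=
  (V.ev (anyOrder C)).trans
    ((PiTensorProduct.reindex k (fun _ => V.carrier) σ).trans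
      (V.ev ((anyOrder C).map σ)).symm)

/-- The isomorphism from the unordered tensor product over `C ⊔ D` to the tensor product of the
unordered tensor products over `C` and `D`. -/
def split (C D : Type) [Finite C] [Finite D] :
    V.odot (C ⊕ D) ≃ₗ[k] V.odot C ⊗[k] V.odot D :=
  ((V.ev ((anyOrder C).sum (anyOrder D))).trans
    (PiTensorProduct.tmulEquiv k V.carrier).symm).trans
      (TensorProduct.congr (V.ev (anyOrder C)).symm (V.ev (anyOrder D)).symm)

/-- The homogeneous parts of the unordered tensor product. -/
def odotDeg (C : Type) [Finite C] (e : ℤ) : Submodule k (V.odot C) :=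
  (Submodule.span k {t : V.T C | ∃ (a : C → ℤ) (x : C → V.carrier), (∀ c, x c ∈ V.deg (a c)) ∧
    ∑ᶠ c, a c = e ∧ t = PiTensorProduct.tprod k x}).comap (V.ev (anyOrder C)).toLinearMap

/-- The projection of the unordered tensor product onto its even part. -/
def odotEven (C : Type) [Finite C] : V.odot C →ₗ[k] V.odot C :=
  V.onT fun _ => ∑ᶠ O : {O : Finset C // Even O.card}, V.part O.1

/-- The projection of the unordered tensor product onto its odd part. -/
def odotOdd (C : Type) [Finite C] : V.odot C →ₗ[k] V.odot C :=
  V.onT fun _ => ∑ᶠ O : {O : Finset C // Odd O.card}, V.part O.1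

/-- The parity involution of the unordered tensor product. -/
def odotParity (C : Type) [Finite C] : V.odot C →ₗ[k] V.odot C := V.odotEven C - V.odotOdd C

open Classical in
/-- The differential of the unordered tensor product: the sum over all factors of the application of
`d` to this factor, with the sign of moving `d` past the preceding factors. -/
def odotD (C : Type) [Finite C] : V.odot C →ₗ[k] V.odot C :=
  V.onT fun r => ∑ᶠ c : C, PiTensorProduct.map
    (fun c' => if r.1 c' c then parity V.internal else if c' = c then V.d else LinearMap.id)

/-- The linear maps between unordered tensor products. -/
abbrev E (C D : Type) [Finite C] [Finite D] : Type (max w v) := V.odot D →ₗ[k] V.odot C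

/-- The parity involution `f ↦ (-1)^|f| f` on linear maps. -/
def homParity (C D : Type) [Finite C] [Finite D] : V.E C D →ₗ[k] V.E C D where
  toFun f := V.odotParity C ∘ₗ f ∘ₗ V.odotParity D
  map_add' f g := by rw [LinearMap.add_comp, LinearMap.comp_add]
  map_smul' c f := by rw [LinearMap.smul_comp, LinearMap.comp_smul, RingHom.id_apply]

/-- The linear maps homogeneous of degree `i`. -/
def homDeg (C D : Type) [Finite C] [Finite D] (i : ℤ) : Submodule k (V.E C D) where
  carrier := {f | ∀ (e : ℤ) (x : V.odot D), x ∈ V.odotDeg D e → f x ∈ V.odotDeg C (e + i)}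
  zero_mem' := fun e x _ => by simp only [LinearMap.zero_apply, zero_mem]
  add_mem' := fun hf hg e x hx => add_mem (hf e x hx) (hg e x hx)
  smul_mem' := fun c _ hf e x hx => Submodule.smul_mem _ c (hf e x hx)

/-- The differential `f ↦ d f - (-1)^|f| f d` of the linear maps. -/
def homD (C D : Type) [Finite C] [Finite D] : V.E C D →ₗ[k] V.E C D where
  toFun f := V.odotD C ∘ₗ f - V.homParity C D f ∘ₗ V.odotD D
  map_add' f g := by
    rw [map_add, LinearMap.add_comp, LinearMap.comp_add]
    abel
  map_smul' c f := by
    refine LinearMap.ext fun x => ?_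
    simp only [map_smul, LinearMap.sub_apply, LinearMap.comp_apply, LinearMap.smul_apply,
      RingHom.id_apply, smul_sub]

/-- The action of bijections on linear maps, by conjugation. -/
def homAct {C D C' D' : Type} [Finite C] [Finite D] [Finite C'] [Finite D'] (ρ : C ≃ C')
    (σ : D ≃ D') : V.E C D →ₗ[k] V.E C' D' :=
  (LinearEquiv.arrowCongr (V.relabel σ) (V.relabel ρ)).toLinearMap

/-- The map `id ⊗ f`, with `(id ⊗ f)(x ⊗ y) = (-1)^(|f| |x|) x ⊗ f y`. -/
def idTensor (C D D' : Type) [Finite C] [Finite D] [Finite D'] (f : V.E D' D) :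
    V.odot C ⊗[k] V.odot D →ₗ[k] V.odot C ⊗[k] V.odot D' :=
  TensorProduct.map (V.odotEven C) f + TensorProduct.map (V.odotOdd C) (V.homParity D' D f)

/-- The canonical isomorphism used for composing along `η`. -/
def middle (D₁ C₂ : Type) {A B : Type} [Finite D₁] [Finite C₂] [Finite A] [Finite B] (η : B ≃ A) :
    V.odot D₁ ⊗[k] V.odot (C₂ ⊕ A) ≃ₗ[k] V.odot (D₁ ⊕ B) ⊗[k] V.odot C₂ :=
  (TensorProduct.congr (LinearEquiv.refl k _)
    (((V.relabel (Equiv.sumComm C₂ A)).trans (V.split A C₂)).trans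
      (TensorProduct.congr (V.relabel η.symm) (LinearEquiv.refl k _)))).trans
    ((TensorProduct.assoc k _ _ _).symm.trans
      (TensorProduct.congr (V.split D₁ B).symm (LinearEquiv.refl k _)))

/-- The composite
`⊙(D₁ ⊔ D₂) ≅ ⊙D₁ ⊗ ⊙D₂ → ⊙D₁ ⊗ ⊙(C₂ ⊔ A) ≅ ⊙(D₁ ⊔ B) ⊗ ⊙C₂ → ⊙C₁ ⊗ ⊙C₂ ≅ ⊙(C₁ ⊔ C₂)` of
`id ⊗ f` and `g ⊗ id`. -/
def homComp {C₁ D₁ C₂ D₂ A B : Type} [Finite C₁] [Finite D₁] [Finite C₂] [Finite D₂] [Finite A]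
    [Finite B] (η : B ≃ A) :
    V.E C₁ (D₁ ⊕ B) →ₗ[k] V.E (C₂ ⊕ A) D₂ →ₗ[k] V.E (C₁ ⊕ C₂) (D₁ ⊕ D₂) :=
  LinearMap.mk₂ k
    (fun g f => (V.split C₁ C₂).symm.toLinearMap ∘ₗ LinearMap.rTensor (V.odot C₂) g ∘ₗ
      (V.middle D₁ C₂ η).toLinearMap ∘ₗ V.idTensor D₁ D₂ (C₂ ⊕ A) f ∘ₗ
      (V.split D₁ D₂).toLinearMap)
    (fun g g' f => by
      simp only [LinearMap.rTensor_add, LinearMap.add_comp, LinearMap.comp_add])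
    (fun c g f => by
      simp only [LinearMap.rTensor_smul, LinearMap.smul_comp, LinearMap.comp_smul])
    (fun g f f' => by
      have h : V.idTensor D₁ D₂ (C₂ ⊕ A) (f + f') = V.idTensor D₁ D₂ (C₂ ⊕ A) f +
          V.idTensor D₁ D₂ (C₂ ⊕ A) f' := by
        simp only [idTensor, map_add, TensorProduct.map_add_right]
        abel
      simp only [h, LinearMap.add_comp, LinearMap.comp_add])
    (fun c g f => by
      have h : V.idTensor D₁ D₂ (C₂ ⊕ A) (c • f) = c • V.idTensor D₁ D₂ (C₂ ⊕ A) f := by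
        simp only [idTensor, map_smul, TensorProduct.map_smul_right, smul_add]
      simp only [h, LinearMap.smul_comp, LinearMap.comp_smul])

end DGVect

/-- The endomorphism properad of a dg vector space. -/
def endo (V : DGVect.{w, v} k) : ProperadData.{w, max w v} k where
  obj C D := V.E C D
  deg C D := V.homDeg C D
  d C D := V.homD C D
  act := V.homAct
  comp := V.homComp

end Endo

/-! ### The master equation -/

section Master

variable {k : Type w} [Field k] {P : Properad.{w, u} k}

namespace Properad.StableGrading

variable (𝒢 : P.StableGrading) (V : DGVect.{w, v} k)

/-- The tensor product `P(C, D) ⊗ Hom(⊙_D V, ⊙_C V)`. -/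
abbrev PE (_ : P.StableGrading) (V : DGVect.{w, v} k) (C D : Type) [Finite C] [Finite D] :
    Type (max u w v) :=
  P.obj C D ⊗[k] V.E C D

/-- The diagonal action of bijections. -/
def peAct {C D C' D' : Type} [Finite C] [Finite D] [Finite C'] [Finite D'] (ρ : C ≃ C')
    (σ : D ≃ D') : 𝒢.PE V C D →ₗ[k] 𝒢.PE V C' D' :=
  TensorProduct.map (P.act ρ σ) (V.homAct ρ σ)

/-- The flip `p ⊗ f ⊗ q ⊗ g ↦ (-1)^(|f| |q|) p ⊗ q ⊗ f ⊗ g` of the two middle factors. -/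
def middleFlip (C₁ D₁ C₂ D₂ : Type) [Finite C₁] [Finite D₁] [Finite C₂] [Finite D₂] :
    𝒢.PE V C₁ D₁ ⊗[k] 𝒢.PE V C₂ D₂ →ₗ[k]
      (P.obj C₁ D₁ ⊗[k] P.obj C₂ D₂) ⊗[k] (V.E C₁ D₁ ⊗[k] V.E C₂ D₂) :=
  (TensorProduct.tensorTensorTensorComm k _ _ _ _).toLinearMap ∘ₗ
    (TensorProduct.map LinearMap.id
        (TensorProduct.map (proj (P.internal C₂ D₂) Even) LinearMap.id) +
      TensorProduct.map (TensorProduct.map LinearMap.id (V.homParity C₁ D₁))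
        (TensorProduct.map (proj (P.internal C₂ D₂) Odd) LinearMap.id))

/-- The families `L` of elements `L(m, n, G) ∈ P([m], [n]) ⊗ Hom(⊙_[n] V, ⊙_[m] V)`, an ambient
space of the product over all `m`, `n`, `G` of the invariants `P(m, n, G)`. -/
abbrev Family (V : DGVect.{w, v} k) : Type (max u w v) :=
  ∀ m n : ℕ, ℕ → 𝒢.PE V (Fin m) (Fin n)

/-- The product of the spaces of invariants of `P([m], [n], G) ⊗ Hom(⊙_[n] V, ⊙_[m] V)` under
`Σ_m × Σ_n`. The factors with `2 G + m + n - 2 ≤ 0` vanish. -/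
def inv : Submodule k (𝒢.Family V) where
  carrier := {L | ∀ m n G,
    L m n G ∈ LinearMap.range (TensorProduct.map
      (⨆ i, 𝒢.bi (Fin m) (Fin n) G i : Submodule k (P.obj (Fin m) (Fin n))).subtype
      (LinearMap.id : V.E (Fin m) (Fin n) →ₗ[k] _)) ∧
    ∀ (ρ : Fin m ≃ Fin m) (σ : Fin n ≃ Fin n), 𝒢.peAct V ρ σ (L m n G) = L m n G}
  zero_mem' := fun _ _ _ => ⟨zero_mem _, fun _ _ => map_zero _⟩
  add_mem' := fun hL hL' m n G => ⟨add_mem (hL m n G).1 (hL' m n G).1, fun ρ σ => by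
    rw [Pi.add_apply, Pi.add_apply, Pi.add_apply, map_add, (hL m n G).2, (hL' m n G).2]⟩
  smul_mem' := fun c _ hL m n G => ⟨Submodule.smul_mem _ c (hL m n G).1, fun ρ σ => by
    rw [Pi.smul_apply, Pi.smul_apply, Pi.smul_apply, map_smul, (hL m n G).2]⟩

/-- The family `L` is homogeneous of degree `i`. -/
def IsHomogeneous (L : 𝒢.Family V) (i : ℤ) : Prop :=
  ∀ m n G, L m n G ∈ Submodule.span k {t : 𝒢.PE V (Fin m) (Fin n) | ∃ (j : ℤ)
    (p : P.obj (Fin m) (Fin n)) (f : V.E (Fin m) (Fin n)),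
      p ∈ 𝒢.bi (Fin m) (Fin n) G j ∧ f ∈ V.homDeg (Fin m) (Fin n) (i - j) ∧ t = p ⊗ₜ[k] f}

/-- The differential `d ⊗ id - id ⊗ d`, with `(id ⊗ d)(p ⊗ f) = (-1)^|p| p ⊗ d f`. -/
def masterD (L : 𝒢.Family V) : 𝒢.Family V := fun m n G =>
  TensorProduct.map (P.d (Fin m) (Fin n)) LinearMap.id (L m n G) -
    TensorProduct.map (parity (P.internal (Fin m) (Fin n))) (V.homD (Fin m) (Fin n)) (L m n G)

/-- The component of `L` for arbitrary finite sets, obtained from `L(|C|, |D|, G)` by relabelling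
along bijections `[|C|] ≃ C` and `[|D|] ≃ D`. -/
def transport (L : 𝒢.Family V) (C D : Type) [Finite C] [Finite D] (G : ℕ) : 𝒢.PE V C D :=
  𝒢.peAct V (Finite.equivFin C).symm (Finite.equivFin D).symm (L (Nat.card C) (Nat.card D) G)

/-- The tensor product of the operations of `P` and of the endomorphism properad, followed by the
projection to `P(C₁ ⊔ C₂, D₁ ⊔ D₂, G)`. -/
def glue {C₁ D₁ C₂ D₂ A B : Type} [Finite C₁] [Finite D₁] [Finite C₂] [Finite D₂] [Finite A]
    [Finite B] [Nonempty B] (η : B ≃ A) (G : ℕ) :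
    𝒢.PE V C₁ (D₁ ⊕ B) ⊗[k] 𝒢.PE V (C₂ ⊕ A) D₂ →ₗ[k] 𝒢.PE V (C₁ ⊕ C₂) (D₁ ⊕ D₂) :=
  TensorProduct.map (𝒢.prG (C₁ ⊕ C₂) (D₁ ⊕ D₂) G ∘ₗ TensorProduct.lift (P.comp η))
    (TensorProduct.lift (V.homComp η)) ∘ₗ 𝒢.middleFlip V C₁ (D₁ ⊕ B) (C₂ ⊕ A) D₂

open Classical in
/-- The composition `L ∘ L'`: its component `(m, n, G)` is the sum over all `C₁ ⊔ C₂ = [m]` and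
`D₁ ⊔ D₂ = [n]`, over the number `r + 1 > 0` of glued pairs (with weight `1 / (r + 1)!`), and over
the indices `G₁` and `G₂` of the two factors. -/
def masterComp (L L' : 𝒢.Family V) : 𝒢.Family V := fun m n G =>
  ∑ᶠ t : (Set (Fin m) × Set (Fin n)) × ℕ × ℕ × ℕ,
    ((t.2.1 + 1).factorial : k)⁻¹ •
      𝒢.peAct V (Equiv.Set.sumCompl t.1.1) (Equiv.Set.sumCompl t.1.2)
        (𝒢.glue V (Equiv.refl (Fin (t.2.1 + 1))) G
          (𝒢.transport V L t.1.1 (t.1.2 ⊕ Fin (t.2.1 + 1)) t.2.2.1 ⊗ₜ[k]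
            𝒢.transport V L' (↥(t.1.1)ᶜ ⊕ Fin (t.2.1 + 1)) ↥(t.1.2)ᶜ t.2.2.2))

/-- The solutions of degree `1` of the master equation `d L + L ∘ L = 0`. -/
def Solution : Type (max u w v) :=
  {L : 𝒢.Family V // L ∈ 𝒢.inv V ∧ 𝒢.IsHomogeneous V L 1 ∧
    𝒢.masterD V L + 𝒢.masterComp V L L = 0}

/-- The contraction of the first tensor factor with a functional on `P(C, D, G)` of degree `i`. -/
def contract (C D : Type) [Finite C] [Finite D] (G : ℕ) (i : ℤ) (ξ : 𝒢.DualPart C D G i) :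
    𝒢.PE V C D →ₗ[k] V.E C D :=
  (TensorProduct.lid k (V.E C D)).toLinearMap ∘ₗ
    TensorProduct.map (ξ ∘ₗ 𝒢.pr C D G i) LinearMap.id

end Properad.StableGrading

end Master

end CobarMaster

end

/-!
A morphism out of the cobar complex is determined by its values on the generators `↑ξ`, and since
the cobar complex is free as a properad, these values may be prescribed by any equivariant family of
degree `0` maps `γ` from the suspended dual of `P` to the endomorphism properad (`GenMap`). What has
to be checked for this is that the endomorphism properad satisfies the relations of the free
properad, that is, the axioms of a properad (`evalLin_rel`). These are derived from a normal form: a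
composite of linear maps along bijections is an honest composite of maps of the form `f ⊗ id`, up to
relabelling the factors (`homComp_eq`, `locate`), so that equivariance and associativity are
comparisons of bijections, and the two remaining axioms are the interchange law
`(f ⊗ id)(id ⊗ g) = ± (id ⊗ g)(f ⊗ id)` (`locate_interchange`). By the Leibniz rule on both sides,
`γ` extends to a morphism of dg properads if and only if the extension commutes with the
differentials on the generators (`evalFree_freeD`).

Since `P(C, D, G)` is finite dimensional, an element of degree `1` of
`P(C, D, G) ⊗ Hom(⊙_D V, ⊙_C V)` is the same as a degree `0` map from the suspended dual of
`P(C, D, G)` to `Hom(⊙_D V, ⊙_C V)`: in one direction one contracts with functionals, in the other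
one forms `∑ pₐ ⊗ γ(↑pₐ^#)` (`contract_expand`, `expand_contract`). Invariant families `L`
correspond in this way to equivariant families `γ` (`genMap_family`, `family_genMap`).

It remains to contract `d L + L ∘ L` with a functional `ξ` of degree `l`. The first summand gives
`(-1)^l (γ(d ξ) - d γ(ξ))` (`contract_masterD`). The second one gives `(-1)^l` times the value of
the extension of `γ` on the quadratic part of `∂ ↑ξ` (`contract_masterComp`), because the dual of an
operation of `P` is paired with the two factors of `L ∘ L`; the sign `(-1)^((1 - i) j)` of the flip
and the sign `(-1)^(i (1 + j))` in `∂` differ by `(-1)^(i + j) = (-1)^l`. All the sums involved are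
finite by the finiteness condition on the operations. So the master equation says that
the extension of `γ` commutes with the differentials on the generators (`master_iff`).
-/

noncomputable section

namespace CobarMaster

/-! ### Signs -/

section Signs

open Properad.StableGrading (sgn_add sgn_mul_self)

variable {k : Type w} [Field k]

theorem sgn_zero : sgn k 0 = 1 := by simp [sgn]

theorem sgn_of_even {n : ℤ} (h : Even n) : sgn k n = 1 := by simp [sgn, Int.negOnePow_even _ h]

theorem sgn_of_odd {n : ℤ} (h : Odd n) : sgn k n = -1 := by simp [sgn, Int.negOnePow_odd _ h]

theorem sgn_eq_of_even_sub {m n : ℤ} (h : Even (m - n)) : sgn k m = sgn k n := by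
  rw [← sub_add_cancel m n, sgn_add, sgn_of_even h, one_mul]

theorem sgn_sum {ι : Type*} (s : Finset ι) (f : ι → ℤ) :
    sgn k (∑ i ∈ s, f i) = ∏ i ∈ s, sgn k (f i) := by
  classical
  induction s using Finset.induction_on with
  | empty => simp [sgn_zero]
  | insert i s hi ih => rw [Finset.sum_insert hi, Finset.prod_insert hi, sgn_add, ih]

theorem proj_of_mem {k : Type w} [Field k] {ι : Type} [DecidableEq ι] {M : Type u}
    [AddCommGroup M] [Module k M] {𝒜 : ι → Submodule k M} (h : DirectSum.IsInternal 𝒜)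
    (s : ι → Prop) [DecidablePred s] {i : ι} {x : M} (hx : x ∈ 𝒜 i) :
    proj h s x = if s i then x else 0 := by
  have e : decomp h x = DirectSum.of (fun i => 𝒜 i) i ⟨x, hx⟩ := by
    rw [decomp, LinearEquiv.symm_apply_eq]
    exact (DirectSum.coeAddMonoidHom_of 𝒜 i ⟨x, hx⟩).symm
  rw [proj, LinearMap.comp_apply, LinearEquiv.coe_coe, e]
  refine (DirectSum.toModule_lof k i _).trans ?_
  by_cases hs : s i
  · rw [if_pos hs, if_pos hs]; rfl
  · rw [if_neg hs, if_neg hs]; rfl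

theorem parity_apply_of_mem {k : Type w} [Field k] {M : Type u} [AddCommGroup M] [Module k M]
    {𝒜 : ℤ → Submodule k M} (h : DirectSum.IsInternal 𝒜) {i : ℤ} {x : M} (hx : x ∈ 𝒜 i) :
    parity h x = sgn k i • x := by
  rw [parity, LinearMap.sub_apply, proj_of_mem h _ hx, proj_of_mem h _ hx]
  rcases Int.even_or_odd i with hi | hi
  · rw [if_pos hi, if_neg (Int.not_odd_iff_even.2 hi), sgn_of_even hi, sub_zero, one_smul]
  · rw [if_neg (Int.not_even_iff_odd.2 hi), if_pos hi, sgn_of_odd hi, zero_sub, neg_one_smul]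

open Classical in
/-- The Koszul sign of passing from the order `r` to the order `r'`, for factors of degrees `a`. -/
def swapSign (k : Type w) [Field k] {C : Type} [Fintype C] (a : C → ℤ) (r r' : Ordering C) : k :=
  ∏ c, ∏ c', if r.1 c c' ∧ r'.1 c' c then sgn k (a c * a c') else 1

open Classical in
/-- The sign of moving an element of degree one past the factors that precede `c`. -/
def beforeSign (k : Type w) [Field k] {C : Type} [Fintype C] (a : C → ℤ) (r : Ordering C)
    (c : C) : k :=
  ∏ c', if r.1 c' c then sgn k (a c') else 1

theorem Ordering.irrefl {C : Type} (r : Ordering C) (c : C) : ¬ r.1 c c :=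
  have := r.2
  irrefl_of r.1 c

theorem Ordering.asymm {C : Type} (r : Ordering C) {c c' : C} (h : r.1 c c') : ¬ r.1 c' c :=
  have := r.2
  asymm_of r.1 h

theorem Ordering.total {C : Type} (r : Ordering C) {c c' : C} (h : c ≠ c') :
    r.1 c c' ∨ r.1 c' c := by
  have := r.2
  rcases trichotomous_of r.1 c c' with h' | h' | h'
  exacts [Or.inl h', absurd h' h, Or.inr h']

variable {C D : Type} [Fintype C] [Fintype D]

/-- The sign in the definition of the unordered tensor product, which counts inversions between odd
factors, is the Koszul sign for homogeneous factors. -/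
theorem koszulSign_odd [DecidableEq C] (a : C → ℤ) (r r' : Ordering C)
    [DecidablePred fun c => Odd (a c)] :
    DGVect.koszulSign k (Finset.univ.filter fun c => Odd (a c)) r r' = swapSign k a r r' := by
  classical
  rw [DGVect.koszulSign_eq, swapSign, Fintype.prod_prod_type]
  refine Finset.prod_congr rfl fun c _ => Finset.prod_congr rfl fun c' _ => ?_
  simp only [Finset.mem_filter, Finset.mem_univ, true_and]
  by_cases h : r.1 c c' ∧ r'.1 c' c
  · by_cases ho : Odd (a c) ∧ Odd (a c')
    · rw [if_pos ⟨ho.1, ho.2, h⟩, if_pos h, sgn_of_odd (ho.1.mul ho.2)]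
    · rw [if_neg fun h' => ho ⟨h'.1, h'.2.1⟩, if_pos h, sgn_of_even]
      rw [← Int.not_odd_iff_even, Int.odd_mul]
      exact ho
  · rw [if_neg fun h' => h h'.2.2, if_neg h]

theorem swapSign_map (σ : C ≃ D) (a : C → ℤ) (r r' : Ordering C) :
    swapSign k (a ∘ σ.symm) (r.map σ) (r'.map σ) = swapSign k a r r' := by
  classical
  rw [swapSign, swapSign, ← σ.symm.prod_comp]
  refine Finset.prod_congr rfl fun c _ => ?_
  rw [← σ.symm.prod_comp]
  rfl

theorem swapSign_sum (a : C → ℤ) (b : D → ℤ) (r r' : Ordering C) (s s' : Ordering D) :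
    swapSign k (Sum.elim a b) (r.sum s) (r'.sum s') = swapSign k a r r' * swapSign k b s s' := by
  classical
  simp only [swapSign, Fintype.prod_sum_type, Ordering.sum, Sum.lex_inl_inl, Sum.lex_inr_inr,
    Sum.lex_inr_inl, Sum.Lex.sep, and_false, false_and, if_false, Finset.prod_const_one, mul_one,
    one_mul, Sum.elim_inl, Sum.elim_inr]

/-- Exchanging two blocks of factors gives the Koszul sign of their total degrees. -/
theorem swapSign_comm (a : C → ℤ) (b : D → ℤ) (r : Ordering C) (s : Ordering D) :
    swapSign k (Sum.elim b a) ((r.sum s).map (Equiv.sumComm C D)) (s.sum r) =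
      sgn k ((∑ c, a c) * ∑ d, b d) := by
  classical
  have h1 : ∀ c c', ¬ (r.1 c c' ∧ r.1 c' c) := fun c c' h => r.asymm h.1 h.2
  have h2 : ∀ c c', ¬ (s.1 c c' ∧ s.1 c' c) := fun c c' h => s.asymm h.1 h.2
  simp only [swapSign, Fintype.prod_sum_type, Ordering.sum, Ordering.map, Equiv.sumComm_symm,
    Equiv.sumComm_apply, Sum.swap_inl, Sum.swap_inr, Sum.lex_inl_inl, Sum.lex_inr_inr,
    Sum.lex_inr_inl, Sum.Lex.sep, and_false, if_false, Finset.prod_const_one, mul_one,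
    one_mul, Sum.elim_inl, Sum.elim_inr, h1, h2, true_and, if_true, Finset.sum_mul_sum, sgn_sum]

theorem beforeSign_sum_inl (a : C → ℤ) (b : D → ℤ) (r : Ordering C) (s : Ordering D) (c : C) :
    beforeSign k (Sum.elim a b) (r.sum s) (Sum.inl c) = beforeSign k a r c := by
  classical
  simp only [beforeSign, Fintype.prod_sum_type, Ordering.sum, Sum.lex_inl_inl, Sum.lex_inr_inl,
    if_false, Finset.prod_const_one, mul_one, Sum.elim_inl]

theorem beforeSign_sum_inr (a : C → ℤ) (b : D → ℤ) (r : Ordering C) (s : Ordering D) (d : D) :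
    beforeSign k (Sum.elim a b) (r.sum s) (Sum.inr d) =
      sgn k (∑ c, a c) * beforeSign k b s d := by
  classical
  simp only [beforeSign, Fintype.prod_sum_type, Ordering.sum, Sum.lex_inr_inr, Sum.Lex.sep,
    if_true, Sum.elim_inl, Sum.elim_inr, sgn_sum]

theorem beforeSign_map (σ : C ≃ D) (a : C → ℤ) (r : Ordering C) (c : C) :
    beforeSign k (a ∘ σ.symm) (r.map σ) (σ c) = beforeSign k a r c := by
  classical
  rw [beforeSign, beforeSign, ← σ.prod_comp]
  simp only [Ordering.map, Equiv.symm_apply_apply, Function.comp_apply]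

/-- Raising the degree of one factor by one changes the sign of a reordering by the ratio of the
signs of moving an element of degree one to this factor. -/
theorem beforeSign_mul_swapSign [DecidableEq C] (a : C → ℤ) (r r' : Ordering C) (c : C) :
    swapSign k (Function.update a c (a c + 1)) r r' * beforeSign k a r c =
      swapSign k a r r' * beforeSign k a r' c := by
  classical
  have e : ∀ c₁ c₂, (if r.1 c₁ c₂ ∧ r'.1 c₂ c₁ then
      sgn k (Function.update a c (a c + 1) c₁ * Function.update a c (a c + 1) c₂) else (1 : k)) =
      (if r.1 c₁ c₂ ∧ r'.1 c₂ c₁ then sgn k (a c₁ * a c₂) else 1) *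
      ((if c₁ = c then (if r.1 c c₂ ∧ r'.1 c₂ c then sgn k (a c₂) else 1) else 1) *
      (if c₂ = c then (if r.1 c₁ c ∧ r'.1 c c₁ then sgn k (a c₁) else 1) else 1)) := by
    intro c₁ c₂
    by_cases h : r.1 c₁ c₂ ∧ r'.1 c₂ c₁
    · have hne : c₁ ≠ c₂ := fun h' => r.irrefl c₂ (h' ▸ h.1)
      by_cases h1 : c₁ = c
      · subst h1
        rw [if_pos h, if_pos h, if_pos rfl, if_pos h, if_neg hne.symm, Function.update_self,
          Function.update_of_ne hne.symm, add_mul, one_mul, sgn_add, mul_one]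
      · by_cases h2 : c₂ = c
        · subst h2
          rw [if_pos h, if_pos h, if_neg h1, if_pos rfl, if_pos h, Function.update_self,
            Function.update_of_ne hne, mul_add, mul_one, sgn_add, one_mul]
        · rw [if_pos h, if_pos h, if_neg h1, if_neg h2, Function.update_of_ne h1,
            Function.update_of_ne h2, mul_one, mul_one]
    · rw [if_neg h, if_neg h, one_mul]
      have h1 : (if c₁ = c then (if r.1 c c₂ ∧ r'.1 c₂ c then sgn k (a c₂) else 1) else 1)
          = (1 : k) := by
        split_ifs with h1 h2
        · exact absurd (h1 ▸ h2) h
        all_goals rfl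
      have h2 : (if c₂ = c then (if r.1 c₁ c ∧ r'.1 c c₁ then sgn k (a c₁) else 1) else 1)
          = (1 : k) := by
        split_ifs with h1 h2
        · exact absurd (h1 ▸ h2) h
        all_goals rfl
      rw [h1, h2, one_mul]
  simp only [swapSign, e, Finset.prod_mul_distrib]
  rw [mul_assoc]
  congr 1
  rw [Finset.prod_comm (f := fun x y => if y = c then _ else _)]
  simp only [Finset.prod_ite_irrel, Finset.prod_const_one, Finset.prod_ite_eq', Finset.mem_univ,
    if_true, beforeSign]
  rw [← Finset.prod_mul_distrib, ← Finset.prod_mul_distrib]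
  refine Finset.prod_congr rfl fun c' _ => ?_
  by_cases hc : c' = c
  · subst hc
    simp only [r.irrefl, r'.irrefl, false_and, if_false, mul_one]
  · rcases r.total hc with h | h <;> rcases r'.total hc with h' | h' <;>
      simp [h, h', r.asymm h, r'.asymm h', sgn_mul_self]

end Signs

/-! ### Unordered tensor products -/

namespace DGVect

open Properad.StableGrading (sgn_add sgn_mul_self)

variable {k : Type w} [Field k] (V : DGVect.{w, v} k)

/-- The vectors `x c` are homogeneous of degrees `a c`. -/
def Homog {C : Type} (a : C → ℤ) (x : C → V.carrier) : Prop := ∀ c, x c ∈ V.deg (a c)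

variable {V}

theorem Homog.comp {C D : Type} {a : C → ℤ} {x : C → V.carrier} (h : V.Homog a x) (f : D → C) :
    V.Homog (a ∘ f) (x ∘ f) := fun d => h (f d)

theorem Homog.elim {C D : Type} {a : C → ℤ} {x : C → V.carrier} {b : D → ℤ} {y : D → V.carrier}
    (h : V.Homog a x) (h' : V.Homog b y) : V.Homog (Sum.elim a b) (Sum.elim x y) := by
  rintro (c | d)
  exacts [h c, h' d]

theorem Homog.update_d {C : Type} [DecidableEq C] {a : C → ℤ} {x : C → V.carrier}
    (h : V.Homog a x) (c : C) :
    V.Homog (Function.update a c (a c + 1)) (Function.update x c (V.d (x c))) := by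
  intro c'
  by_cases hc : c' = c
  · subst hc
    simpa using V.d_deg (h c')
  · simpa [hc] using h c'

variable (V)

/-- Tensor products of homogeneous vectors suffice to test linear maps. -/
theorem tprod_hom_ext {C : Type} [Finite C] {M : Type*} [AddCommGroup M] [Module k M]
    {f g : V.T C →ₗ[k] M}
    (h : ∀ a x, V.Homog a x → f (PiTensorProduct.tprod k x) = g (PiTensorProduct.tprod k x)) :
    f = g := by
  classical
  refine PiTensorProduct.ext (Module.Basis.ext_multilinear
    (fun _ => V.internal.collectedBasis fun i => Module.Basis.ofVectorSpace k (V.deg i))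
    fun v => ?_)
  exact h (fun c => (v c).1) _ fun c => V.internal.collectedBasis_mem _ _

open Classical in
theorem part_tprod {C : Type} [Fintype C] (O : Finset C) {a : C → ℤ} {x : C → V.carrier}
    (h : V.Homog a x) : V.part O (PiTensorProduct.tprod k x) =
      if O = Finset.univ.filter (fun c => Odd (a c)) then PiTensorProduct.tprod k x else 0 := by
  rw [part, PiTensorProduct.map_tprod]
  split_ifs with hO
  · subst hO
    congr 1
    funext c
    by_cases hc : Odd (a c)
    · simp [Finset.piecewise, hc, V.proj_of_mem _ (h c)]
    · simp [Finset.piecewise, hc, V.proj_of_mem _ (h c), Int.not_odd_iff_even.1 hc]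
  · obtain ⟨c, hc⟩ : ∃ c, ¬ (c ∈ O ↔ Odd (a c)) := by
      by_contra hcon
      push Not at hcon
      exact hO (Finset.ext fun c => by simp [hcon c])
    refine MultilinearMap.map_coord_zero _ c ?_
    by_cases h1 : c ∈ O
    · have h2 : ¬ Odd (a c) := fun h2 => hc ⟨fun _ => h2, fun _ => h1⟩
      simp [Finset.piecewise, h1, V.proj_of_mem _ (h c), h2]
    · have h2 : Odd (a c) := by
        by_contra h2
        exact hc ⟨fun h => absurd h h1, fun h => absurd h h2⟩
      simp [Finset.piecewise, h1, V.proj_of_mem _ (h c), h2]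

theorem koszul_tprod {C : Type} [Fintype C] (r r' : Ordering C) {a : C → ℤ} {x : C → V.carrier}
    (h : V.Homog a x) : V.koszul r r' (PiTensorProduct.tprod k x) =
      swapSign k a r r' • PiTensorProduct.tprod k x := by
  classical
  rw [koszul, finsum_eq_sum_of_fintype, LinearMap.sum_apply]
  simp only [LinearMap.smul_apply, V.part_tprod _ h, smul_ite, smul_zero, Finset.sum_ite_eq',
    Finset.mem_univ, if_true, koszulSign_odd]

/-- The tensor product of the vectors `x c` in the order `r`, as an element of the unordered tensor
product. -/
def tp {C : Type} [Finite C] (r : Ordering C) (x : C → V.carrier) : V.odot C :=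
  (V.ev r).symm (PiTensorProduct.tprod k x)

theorem ev_tp {C : Type} [Fintype C] (r r' : Ordering C) {a : C → ℤ} {x : C → V.carrier}
    (h : V.Homog a x) : V.ev r' (V.tp r x) = swapSign k a r r' • PiTensorProduct.tprod k x :=
  V.koszul_tprod r r' h

theorem tp_eq {C : Type} [Fintype C] (r r' : Ordering C) {a : C → ℤ} {x : C → V.carrier}
    (h : V.Homog a x) : V.tp r x = swapSign k a r r' • V.tp r' x := by
  apply (V.ev r').injective
  rw [ev_tp V r r' h, map_smul, tp, LinearEquiv.apply_symm_apply]

/-- Linear maps out of the unordered tensor product agree if they agree on the tensor products of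
homogeneous vectors in one fixed order. -/
theorem odot_hom_ext {C : Type} [Finite C] (r : Ordering C) {M : Type*} [AddCommGroup M]
    [Module k M] {f g : V.odot C →ₗ[k] M}
    (h : ∀ a x, V.Homog a x → f (V.tp r x) = g (V.tp r x)) : f = g := by
  have := V.tprod_hom_ext (f := f ∘ₗ (V.ev r).symm.toLinearMap)
    (g := g ∘ₗ (V.ev r).symm.toLinearMap) h
  refine LinearMap.ext fun x => ?_
  simpa using LinearMap.congr_fun this (V.ev r x)

theorem relabel_tp {C D : Type} [Finite C] [Finite D] (σ : C ≃ D) (r : Ordering C) {a : C → ℤ}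
    {x : C → V.carrier} (h : V.Homog a x) :
    V.relabel σ (V.tp r x) = V.tp (r.map σ) (x ∘ σ.symm) := by
  cases nonempty_fintype C
  cases nonempty_fintype D
  rw [V.tp_eq (r.map σ) ((anyOrder C).map σ) (h.comp σ.symm), swapSign_map]
  simp only [relabel, LinearEquiv.trans_apply, V.ev_tp r _ h, map_smul,
    PiTensorProduct.reindex_tprod]
  rfl

/-- The tensor product of two elements of unordered tensor products. -/
def join (C D : Type) [Finite C] [Finite D] : V.odot C →ₗ[k] V.odot D →ₗ[k] V.odot (C ⊕ D) :=
  (TensorProduct.mk k _ _).compr₂ (V.split C D).symm.toLinearMap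

variable {C D C' D' X : Type} [Finite C] [Finite D] [Finite C'] [Finite D'] [Finite X]

theorem split_join (u : V.odot C) (v : V.odot D) : V.split C D (V.join C D u v) = u ⊗ₜ v :=
  LinearEquiv.apply_symm_apply _ _

theorem split_symm_tmul (u : V.odot C) (v : V.odot D) :
    (V.split C D).symm (u ⊗ₜ v) = V.join C D u v := rfl

/-- Concatenation of orders involves no sign. -/
theorem join_tp (r : Ordering C) (s : Ordering D) {a : C → ℤ} {x : C → V.carrier} {b : D → ℤ}
    {y : D → V.carrier} (h : V.Homog a x) (h' : V.Homog b y) :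
    V.join C D (V.tp r x) (V.tp s y) = V.tp (r.sum s) (Sum.elim x y) := by
  cases nonempty_fintype C
  cases nonempty_fintype D
  apply (V.split C D).injective
  rw [split_join, V.tp_eq r (anyOrder C) h, V.tp_eq s (anyOrder D) h',
    V.tp_eq (r.sum s) ((anyOrder C).sum (anyOrder D)) (h.elim h'), swapSign_sum, map_smul,
    TensorProduct.smul_tmul_smul]
  congr 1
  simp only [split, LinearEquiv.trans_apply, tp, LinearEquiv.apply_symm_apply]
  erw [PiTensorProduct.tmulEquiv_symm_apply]
  rfl

theorem sum_hom_ext {M : Type*} [AddCommGroup M] [Module k M] {f g : V.odot (C ⊕ D) →ₗ[k] M}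
    (h : ∀ u v, f (V.join C D u v) = g (V.join C D u v)) : f = g := by
  have : f ∘ₗ (V.split C D).symm.toLinearMap = g ∘ₗ (V.split C D).symm.toLinearMap :=
    TensorProduct.ext' h
  refine LinearMap.ext fun x => ?_
  simpa using LinearMap.congr_fun this (V.split C D x)

theorem bilin_ext {M : Type*} [AddCommGroup M] [Module k M]
    {f g : V.odot C →ₗ[k] V.odot D →ₗ[k] M} (r : Ordering C) (s : Ordering D)
    (h : ∀ a x b y, V.Homog a x → V.Homog b y → f (V.tp r x) (V.tp s y) = g (V.tp r x) (V.tp s y))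
    (u : V.odot C) (v : V.odot D) : f u v = g u v := by
  have : f = g := V.odot_hom_ext r fun a x hx => V.odot_hom_ext s fun b y hy => h a x b y hx hy
  rw [this]

/-! ### Relabelling of unordered tensor products -/

theorem relabel_trans (σ : C ≃ D) (τ : D ≃ X) (x : V.odot C) :
    V.relabel τ (V.relabel σ x) = V.relabel (σ.trans τ) x := by
  refine LinearMap.congr_fun (f := (V.relabel τ).toLinearMap ∘ₗ (V.relabel σ).toLinearMap)
    (g := (V.relabel (σ.trans τ)).toLinearMap) (V.odot_hom_ext (anyOrder C) fun a x hx => ?_) x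
  change V.relabel τ (V.relabel σ _) = V.relabel (σ.trans τ) _
  rw [V.relabel_tp _ _ hx, V.relabel_tp _ _ (hx.comp _), V.relabel_tp _ _ hx]
  rfl

theorem relabel_refl (x : V.odot C) : V.relabel (Equiv.refl C) x = x := by
  refine LinearMap.congr_fun (f := (V.relabel (Equiv.refl C)).toLinearMap)
    (g := LinearMap.id) (V.odot_hom_ext (anyOrder C) fun a x hx => ?_) x
  exact V.relabel_tp _ _ hx

theorem relabel_symm (σ : C ≃ D) : (V.relabel σ).symm = V.relabel σ.symm := by
  refine LinearEquiv.ext fun x => ?_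
  rw [LinearEquiv.symm_apply_eq, relabel_trans, Equiv.symm_trans_self, relabel_refl]

theorem relabel_join (σ : C ≃ C') (τ : D ≃ D') (u : V.odot C) (v : V.odot D) :
    V.relabel (Equiv.sumCongr σ τ) (V.join C D u v) =
      V.join C' D' (V.relabel σ u) (V.relabel τ v) := by
  refine V.bilin_ext (f := (V.join C D).compr₂ (V.relabel (Equiv.sumCongr σ τ)).toLinearMap)
    (g := (V.join C' D').compl₁₂ (V.relabel σ).toLinearMap (V.relabel τ).toLinearMap)
    (anyOrder C) (anyOrder D) (fun a x b y hx hy => ?_) u v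
  change V.relabel (Equiv.sumCongr σ τ) (V.join C D _ _) = V.join C' D' (V.relabel σ _)
    (V.relabel τ _)
  rw [V.join_tp _ _ hx hy, V.relabel_tp _ _ (hx.elim hy), V.relabel_tp _ _ hx,
    V.relabel_tp _ _ hy, V.join_tp _ _ (hx.comp _) (hy.comp _)]
  congr 1
  · refine Subtype.ext (funext fun p => funext fun q => propext ?_)
    rcases p with p | p <;> rcases q with q | q <;> simp [Ordering.map, Ordering.sum]
  · funext p
    rcases p with p | p <;> rfl

theorem relabel_assoc_join (u : V.odot C) (v : V.odot D) (t : V.odot X) :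
    V.relabel (Equiv.sumAssoc C D X) (V.join (C ⊕ D) X (V.join C D u v) t) =
      V.join C (D ⊕ X) u (V.join D X v t) := by
  have key : ∀ a x, V.Homog a x → ∀ (u : V.odot C) (v : V.odot D),
      V.relabel (Equiv.sumAssoc C D X) (V.join (C ⊕ D) X (V.join C D u v)
        (V.tp (anyOrder X) x)) = V.join C (D ⊕ X) u (V.join D X v (V.tp (anyOrder X) x)) := by
    intro c z hz
    refine V.bilin_ext (f := ((V.join C D).compr₂ ((V.join (C ⊕ D) X).flip
        (V.tp (anyOrder X) z))).compr₂ (V.relabel (Equiv.sumAssoc C D X)).toLinearMap)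
      (g := (V.join C (D ⊕ X)).compl₂ ((V.join D X).flip (V.tp (anyOrder X) z)))
      (anyOrder C) (anyOrder D) (fun a x b y hx hy => ?_)
    change V.relabel (Equiv.sumAssoc C D X) (V.join (C ⊕ D) X (V.join C D _ _) _) =
      V.join C (D ⊕ X) _ (V.join D X _ _)
    rw [V.join_tp _ _ hx hy, V.join_tp _ _ (hx.elim hy) hz, V.join_tp _ _ hy hz,
      V.join_tp _ _ hx (hy.elim hz), V.relabel_tp _ _ ((hx.elim hy).elim hz)]
    congr 1
    · refine Subtype.ext (funext fun p => funext fun q => propext ?_)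
      rcases p with p | p | p <;> rcases q with q | q | q <;>
        simp [Ordering.map, Ordering.sum]
    · funext p
      rcases p with p | p | p <;> rfl
  refine LinearMap.congr_fun (f := (V.relabel (Equiv.sumAssoc C D X)).toLinearMap ∘ₗ
      V.join (C ⊕ D) X (V.join C D u v))
    (g := V.join C (D ⊕ X) u ∘ₗ V.join D X v)
    (V.odot_hom_ext (anyOrder X) fun c z hz => ?_) t
  exact key c z hz u v

/-! ### Parity and braiding of unordered tensor products -/

theorem onT_tp_of_diag (f : Ordering C → (V.T C →ₗ[k] V.T C)) (r : Ordering C) {a : C → ℤ}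
    {x : C → V.carrier} (h : V.Homog a x) (s : k)
    (hf : f (anyOrder C) (PiTensorProduct.tprod k x) = s • PiTensorProduct.tprod k x) :
    V.onT f (V.tp r x) = s • V.tp r x := by
  cases nonempty_fintype C
  rw [V.tp_eq r (anyOrder C) h, smul_comm, map_smul]
  congr 1
  simp only [onT, LinearMap.comp_apply, LinearEquiv.coe_coe, tp, LinearEquiv.apply_symm_apply, hf,
    map_smul]

theorem odd_card_odd_iff {ι : Type*} [Fintype ι] (a : ι → ℤ) [DecidablePred fun c => Odd (a c)] :
    Odd (Finset.univ.filter fun c => Odd (a c)).card ↔ Odd (∑ c, a c) := by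
  have h : Even (∑ c, (a c - if Odd (a c) then 1 else 0)) := by
    refine Finset.even_sum _ fun c _ => ?_
    split_ifs with h
    · exact h.sub_odd odd_one
    · simpa using h
  rw [Finset.sum_sub_distrib, ← Finset.sum_filter, Finset.sum_const, nsmul_one, Int.even_sub'] at h
  rw [h, Int.odd_coe_nat]

open Classical in
theorem sum_part_tprod {C : Type} [Fintype C] (p : ℕ → Prop) {a : C → ℤ} {x : C → V.carrier}
    (h : V.Homog a x) :
    (∑ᶠ O : {O : Finset C // p O.card}, V.part O.1) (PiTensorProduct.tprod k x) =
      (if p (Finset.univ.filter fun c => Odd (a c)).card then (1 : k) else 0) •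
        PiTensorProduct.tprod k x := by
  rw [finsum_eq_sum_of_fintype, LinearMap.sum_apply]
  simp only [V.part_tprod _ h]
  split_ifs with hp
  · rw [Finset.sum_eq_single ⟨_, hp⟩, if_pos rfl, one_smul]
    · exact fun O _ hO => if_neg fun h => hO (Subtype.ext h)
    · exact fun h => absurd (Finset.mem_univ _) h
  · rw [zero_smul]
    exact Finset.sum_eq_zero fun O _ => if_neg fun hO => hp (by rw [← hO]; exact O.2)

open Classical in
theorem odotOdd_tp [Fintype C] (r : Ordering C) {a : C → ℤ} {x : C → V.carrier}
    (h : V.Homog a x) :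
    V.odotOdd C (V.tp r x) = (if Odd (∑ c, a c) then (1 : k) else 0) • V.tp r x := by
  refine V.onT_tp_of_diag _ r h _ ?_
  rw [V.sum_part_tprod Odd h]
  simp only [odd_card_odd_iff]

open Classical in
theorem odotEven_tp [Fintype C] (r : Ordering C) {a : C → ℤ} {x : C → V.carrier}
    (h : V.Homog a x) :
    V.odotEven C (V.tp r x) = (if Odd (∑ c, a c) then (0 : k) else 1) • V.tp r x := by
  refine V.onT_tp_of_diag _ r h _ ?_
  rw [V.sum_part_tprod Even h]
  simp only [← Nat.not_odd_iff_even, odd_card_odd_iff, ite_not]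

theorem odotParity_tp [Fintype C] (r : Ordering C) {a : C → ℤ} {x : C → V.carrier}
    (h : V.Homog a x) : V.odotParity C (V.tp r x) = sgn k (∑ c, a c) • V.tp r x := by
  rw [odotParity, LinearMap.sub_apply, V.odotEven_tp r h, V.odotOdd_tp r h]
  split_ifs with ho
  · rw [sgn_of_odd ho, zero_smul, zero_sub, one_smul]
    exact (neg_one_smul k _).symm
  · rw [sgn_of_even (Int.not_odd_iff_even.1 ho), zero_smul, sub_zero]

theorem odotEven_add_odotOdd (x : V.odot C) : V.odotEven C x + V.odotOdd C x = x := by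
  cases nonempty_fintype C
  refine LinearMap.congr_fun (f := V.odotEven C + V.odotOdd C) (g := LinearMap.id)
    (V.odot_hom_ext (anyOrder C) fun a x hx => ?_) x
  rw [LinearMap.add_apply, V.odotEven_tp _ hx, V.odotOdd_tp _ hx]
  split_ifs <;> simp

theorem odotParity_odotParity (x : V.odot C) : V.odotParity C (V.odotParity C x) = x := by
  cases nonempty_fintype C
  refine LinearMap.congr_fun (f := V.odotParity C ∘ₗ V.odotParity C) (g := LinearMap.id)
    (V.odot_hom_ext (anyOrder C) fun a x hx => ?_) x
  rw [LinearMap.comp_apply, V.odotParity_tp _ hx, map_smul, V.odotParity_tp _ hx, smul_smul,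
    sgn_mul_self, one_smul, LinearMap.id_apply]

theorem odotParity_relabel (σ : C ≃ D) (x : V.odot C) :
    V.odotParity D (V.relabel σ x) = V.relabel σ (V.odotParity C x) := by
  cases nonempty_fintype C
  cases nonempty_fintype D
  refine LinearMap.congr_fun (f := V.odotParity D ∘ₗ (V.relabel σ).toLinearMap)
    (g := (V.relabel σ).toLinearMap ∘ₗ V.odotParity C)
    (V.odot_hom_ext (anyOrder C) fun a x hx => ?_) x
  simp only [LinearMap.comp_apply, LinearEquiv.coe_coe]
  rw [V.odotParity_tp _ hx, map_smul, V.relabel_tp _ _ hx, V.odotParity_tp _ (hx.comp _)]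
  simp only [Function.comp_apply, Equiv.sum_comp]

theorem odotParity_join (u : V.odot C) (v : V.odot D) :
    V.odotParity (C ⊕ D) (V.join C D u v) =
      V.join C D (V.odotParity C u) (V.odotParity D v) := by
  cases nonempty_fintype C
  cases nonempty_fintype D
  refine V.bilin_ext (f := (V.join C D).compr₂ (V.odotParity (C ⊕ D)))
    (g := (V.join C D).compl₁₂ (V.odotParity C) (V.odotParity D))
    (anyOrder C) (anyOrder D) (fun a x b y hx hy => ?_) u v
  simp only [LinearMap.compr₂_apply, LinearMap.compl₁₂_apply]
  rw [V.join_tp _ _ hx hy, V.odotParity_tp _ (hx.elim hy), V.odotParity_tp _ hx,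
    V.odotParity_tp _ hy, map_smul, map_smul, LinearMap.smul_apply, V.join_tp _ _ hx hy, smul_smul,
    Fintype.sum_sum_type, sgn_add, mul_comm]
  rfl

/-- The braiding of unordered tensor products is the exchange with the Koszul sign. -/
theorem relabel_comm_join (u : V.odot C) (v : V.odot D) :
    V.relabel (Equiv.sumComm C D) (V.join C D u v) =
      V.join D C v (V.odotEven C u) + V.join D C (V.odotParity D v) (V.odotOdd C u) := by
  cases nonempty_fintype C
  cases nonempty_fintype D
  refine V.bilin_ext (f := (V.join C D).compr₂ (V.relabel (Equiv.sumComm C D)).toLinearMap)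
    (g := ((V.join D C).compl₂ (V.odotEven C) +
      (V.join D C).compl₁₂ (V.odotParity D) (V.odotOdd C)).flip)
    (anyOrder C) (anyOrder D) (fun a x b y hx hy => ?_) u v
  have he : Sum.elim x y ∘ (Equiv.sumComm C D).symm = Sum.elim y x := by
    funext p
    rcases p with p | p <;> rfl
  simp only [LinearMap.compr₂_apply, LinearMap.compl₁₂_apply, LinearMap.flip_apply,
    LinearMap.add_apply, LinearMap.compl₂_apply, LinearEquiv.coe_coe]
  rw [V.join_tp _ _ hx hy, V.relabel_tp _ _ (hx.elim hy), he,
    V.tp_eq _ ((anyOrder D).sum (anyOrder C)) (hy.elim hx), swapSign_comm, V.odotParity_tp _ hy,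
    V.odotEven_tp _ hx, V.odotOdd_tp _ hx, map_smul, map_smul, map_smul, LinearMap.smul_apply,
    V.join_tp _ _ hy hx]
  split_ifs with h
  · simp only [zero_smul, one_smul, zero_add]
    congr 1
    refine sgn_eq_of_even_sub ?_
    rw [← sub_one_mul]
    exact (h.sub_odd odd_one).mul_right _
  · simp only [zero_smul, one_smul, add_zero]
    rw [sgn_of_even ((Int.not_odd_iff_even.1 h).mul_right _), one_smul]

/-! ### Degrees in unordered tensor products -/

theorem tp_mem_odotDeg [Fintype C] (r : Ordering C) {a : C → ℤ} {x : C → V.carrier}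
    (h : V.Homog a x) : V.tp r x ∈ V.odotDeg C (∑ c, a c) := by
  rw [V.tp_eq r (anyOrder C) h]
  refine Submodule.smul_mem _ _ (Submodule.mem_comap.2 (Submodule.subset_span
    ⟨a, x, h, finsum_eq_sum_of_fintype _, ?_⟩))
  exact LinearEquiv.apply_symm_apply _ _

theorem odotDeg_le [Fintype C] (r : Ordering C) {e : ℤ} {S : Submodule k (V.odot C)}
    (h : ∀ a x, V.Homog a x → ∑ c, a c = e → V.tp r x ∈ S) : V.odotDeg C e ≤ S := by
  intro x hx
  obtain ⟨t, rfl⟩ := (V.ev (anyOrder C)).symm.surjective x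
  have hx' := Submodule.mem_comap.1 hx
  rw [LinearEquiv.coe_coe, LinearEquiv.apply_symm_apply] at hx'
  clear hx
  change t ∈ S.comap (V.ev (anyOrder C)).symm.toLinearMap
  refine Submodule.span_le.2 ?_ hx'
  rintro _ ⟨a, y, hy, he, rfl⟩
  rw [finsum_eq_sum_of_fintype] at he
  change V.tp (anyOrder C) y ∈ S
  rw [V.tp_eq _ r hy]
  exact S.smul_mem _ (h a y hy he)

theorem odotParity_of_mem {e : ℤ} {x : V.odot C} (hx : x ∈ V.odotDeg C e) :
    V.odotParity C x = sgn k e • x := by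
  cases nonempty_fintype C
  have := V.odotDeg_le (anyOrder C) (e := e)
    (S := LinearMap.ker (V.odotParity C - sgn k e • LinearMap.id)) (fun a x h he => by
      simp [V.odotParity_tp _ h, he]) hx
  simpa [sub_eq_zero] using this

theorem relabel_mem (σ : C ≃ D) {e : ℤ} {x : V.odot C} (hx : x ∈ V.odotDeg C e) :
    V.relabel σ x ∈ V.odotDeg D e := by
  cases nonempty_fintype C
  cases nonempty_fintype D
  refine V.odotDeg_le (anyOrder C) (S := (V.odotDeg D e).comap (V.relabel σ).toLinearMap)
    (fun a x h he => ?_) hx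
  rw [Submodule.mem_comap, LinearEquiv.coe_coe, V.relabel_tp _ _ h]
  convert V.tp_mem_odotDeg _ (h.comp σ.symm) using 1
  simp only [Function.comp_apply, Equiv.sum_comp, he]

theorem join_mem {e e' : ℤ} {u : V.odot C} {v : V.odot D} (hu : u ∈ V.odotDeg C e)
    (hv : v ∈ V.odotDeg D e') : V.join C D u v ∈ V.odotDeg (C ⊕ D) (e + e') := by
  cases nonempty_fintype C
  cases nonempty_fintype D
  refine V.odotDeg_le (anyOrder C) (S := (V.odotDeg (C ⊕ D) (e + e')).comap ((V.join C D).flip v))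
    (fun a x h he => ?_) hu
  refine V.odotDeg_le (anyOrder D) (S := (V.odotDeg (C ⊕ D) (e + e')).comap (V.join C D _))
    (fun b y h' he' => ?_) hv
  rw [Submodule.mem_comap, V.join_tp _ _ h h']
  convert V.tp_mem_odotDeg _ (h.elim h') using 1
  simp [Fintype.sum_sum_type, he, he']

theorem odotDeg_sum_le {e : ℤ} {S : Submodule k (V.odot (C ⊕ D))}
    (h : ∀ e₁ e₂ u v, e₁ + e₂ = e → u ∈ V.odotDeg C e₁ → v ∈ V.odotDeg D e₂ →
      V.join C D u v ∈ S) : V.odotDeg (C ⊕ D) e ≤ S := by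
  cases nonempty_fintype C
  cases nonempty_fintype D
  refine V.odotDeg_le ((anyOrder C).sum (anyOrder D)) fun a x hx he => ?_
  have := V.join_tp (anyOrder C) (anyOrder D) (hx.comp Sum.inl) (hx.comp Sum.inr)
  rw [Sum.elim_comp_inl_inr] at this
  rw [← this]
  refine h _ _ _ _ ?_ (V.tp_mem_odotDeg _ (hx.comp _)) (V.tp_mem_odotDeg _ (hx.comp _))
  rw [← he, Fintype.sum_sum_type]
  rfl

/-! ### The differential of unordered tensor products -/

theorem odotD_tp [Fintype C] [DecidableEq C] (r : Ordering C) {a : C → ℤ} {x : C → V.carrier}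
    (h : V.Homog a x) : V.odotD C (V.tp r x) =
      ∑ c, beforeSign k a r c • V.tp r (Function.update x c (V.d (x c))) := by
  have key : V.odotD C (V.tp (anyOrder C) x) = ∑ c, beforeSign k a (anyOrder C) c •
      V.tp (anyOrder C) (Function.update x c (V.d (x c))) := by
    simp only [odotD, onT, LinearMap.comp_apply, LinearEquiv.coe_coe, tp,
      LinearEquiv.apply_symm_apply]
    rw [finsum_eq_sum_of_fintype, LinearMap.sum_apply, map_sum]
    refine Finset.sum_congr rfl fun c _ => ?_
    rw [← map_smul, PiTensorProduct.map_tprod, beforeSign, ← MultilinearMap.map_smul_univ]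
    congr 2
    funext c'
    split_ifs with h1 h2
    · have hc : c' ≠ c := fun hc => (anyOrder C).irrefl c (hc ▸ h1)
      rw [Function.update_of_ne hc, parity_apply_of_mem V.internal (h c')]
    · subst h2
      rw [Function.update_self, one_smul]
    · rw [Function.update_of_ne h2, one_smul, LinearMap.id_apply]
  rw [V.tp_eq r (anyOrder C) h, map_smul, key, Finset.smul_sum]
  refine Finset.sum_congr rfl fun c _ => ?_
  rw [V.tp_eq r (anyOrder C) (h.update_d c), smul_smul, smul_smul, ← beforeSign_mul_swapSign,
    mul_comm]

theorem odotD_relabel (σ : C ≃ D) (x : V.odot C) :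
    V.odotD D (V.relabel σ x) = V.relabel σ (V.odotD C x) := by
  classical
  cases nonempty_fintype C
  cases nonempty_fintype D
  refine LinearMap.congr_fun (f := V.odotD D ∘ₗ (V.relabel σ).toLinearMap)
    (g := (V.relabel σ).toLinearMap ∘ₗ V.odotD C)
    (V.odot_hom_ext (anyOrder C) fun a x hx => ?_) x
  simp only [LinearMap.comp_apply, LinearEquiv.coe_coe]
  rw [V.odotD_tp _ hx, map_sum, V.relabel_tp _ _ hx, V.odotD_tp _ (hx.comp _), ← σ.sum_comp]
  refine Finset.sum_congr rfl fun c _ => ?_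
  rw [map_smul, V.relabel_tp _ _ (hx.update_d c), beforeSign_map, Function.update_comp_equiv]
  simp

theorem odotD_join (u : V.odot C) (v : V.odot D) :
    V.odotD (C ⊕ D) (V.join C D u v) =
      V.join C D (V.odotD C u) v + V.join C D (V.odotParity C u) (V.odotD D v) := by
  classical
  cases nonempty_fintype C
  cases nonempty_fintype D
  refine V.bilin_ext (f := (V.join C D).compr₂ (V.odotD (C ⊕ D)))
    (g := (V.join C D).comp (V.odotD C) +
      (V.join C D).compl₁₂ (V.odotParity C) (V.odotD D))
    (anyOrder C) (anyOrder D) (fun a x b y hx hy => ?_) u v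
  simp only [LinearMap.compr₂_apply, LinearMap.compl₁₂_apply, LinearMap.add_apply,
    LinearMap.comp_apply]
  rw [V.join_tp _ _ hx hy, V.odotD_tp _ (hx.elim hy), V.odotD_tp _ hx, V.odotD_tp _ hy,
    V.odotParity_tp _ hx, Fintype.sum_sum_type, map_sum, map_sum, LinearMap.sum_apply]
  congr 1
  · refine Finset.sum_congr rfl fun c _ => ?_
    rw [map_smul, LinearMap.smul_apply, V.join_tp _ _ (hx.update_d c) hy, beforeSign_sum_inl,
      Sum.elim_inl, Sum.update_elim_inl]
  · refine Finset.sum_congr rfl fun c _ => ?_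
    rw [map_smul, map_smul, LinearMap.smul_apply, V.join_tp _ _ hx (hy.update_d c),
      beforeSign_sum_inr, Sum.elim_inr, Sum.update_elim_inr, smul_smul, mul_comm]

end DGVect

/-! ### Linear maps applied to some of the factors -/

namespace DGVect

open Properad.StableGrading (sgn_add sgn_mul_self)

variable {k : Type w} [Field k] (V : DGVect.{w, v} k)

variable {C D C' D' X X' Y U W U' W' : Type} [Finite C] [Finite D] [Finite C'] [Finite D']
  [Finite X] [Finite X'] [Finite Y] [Finite U] [Finite W] [Finite U'] [Finite W']

/-- The map `f ⊗ id` on unordered tensor products, which involves no sign. -/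
def ext (X : Type) [Finite X] (f : V.E C D) : V.E (C ⊕ X) (D ⊕ X) :=
  (V.split C X).symm.toLinearMap ∘ₗ LinearMap.rTensor (V.odot X) f ∘ₗ (V.split D X).toLinearMap

/-- Relabelling as a linear map. -/
abbrev relabMap (σ : C ≃ D) : V.E D C := (V.relabel σ).toLinearMap

/-- The map `f` applied to the factors of `⊙_U V` that correspond under `e` to the inputs of `f`;
the outcome is relabelled by `e'`. -/
def locate (e : U ≃ D ⊕ X) (e' : C ⊕ X ≃ W) (f : V.E C D) : V.E W U :=
  V.relabMap e' ∘ₗ V.ext X f ∘ₗ V.relabMap e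

theorem ext_join (f : V.E C D) (u : V.odot D) (v : V.odot X) :
    V.ext X f (V.join D X u v) = V.join C X (f u) v := by
  simp only [ext, LinearMap.comp_apply, LinearEquiv.coe_coe, split_join, LinearMap.rTensor_tmul,
    split_symm_tmul]

theorem ext_comp (f : V.E C D) (g : V.E D U) : V.ext X (f ∘ₗ g) = V.ext X f ∘ₗ V.ext X g :=
  V.sum_hom_ext fun u v => by simp only [LinearMap.comp_apply, ext_join]

theorem ext_smul (c : k) (f : V.E C D) : V.ext X (c • f) = c • V.ext X f :=
  V.sum_hom_ext fun u v => by
    simp only [LinearMap.smul_apply, ext_join, map_smul]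

theorem ext_relabMap (σ : C ≃ D) :
    V.ext X (V.relabMap σ) = V.relabMap (Equiv.sumCongr σ (Equiv.refl X)) :=
  V.sum_hom_ext fun u v => by
    simp only [LinearEquiv.coe_coe, ext_join, relabel_join, relabel_refl]

theorem relabMap_comp_relabMap (σ : C ≃ D) (τ : D ≃ X) :
    V.relabMap τ ∘ₗ V.relabMap σ = V.relabMap (σ.trans τ) :=
  LinearMap.ext fun x => V.relabel_trans σ τ x

theorem relabMap_refl : V.relabMap (Equiv.refl C) = LinearMap.id :=
  LinearMap.ext fun x => V.relabel_refl x

theorem homAct_eq (ρ : C ≃ C') (σ : D ≃ D') (f : V.E C D) :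
    V.homAct ρ σ f = V.relabMap ρ ∘ₗ f ∘ₗ V.relabMap σ.symm := by
  refine LinearMap.ext fun x => ?_
  change V.relabel ρ (f ((V.relabel σ).symm x)) = V.relabel ρ (f (V.relabel σ.symm x))
  rw [relabel_symm]

theorem relabMap_comp_ext (τ : X ≃ X') (f : V.E C D) :
    V.relabMap (Equiv.sumCongr (Equiv.refl C) τ) ∘ₗ V.ext X f =
      V.ext X' f ∘ₗ V.relabMap (Equiv.sumCongr (Equiv.refl D) τ) :=
  V.sum_hom_ext fun u v => by
    simp only [LinearMap.comp_apply, LinearEquiv.coe_coe, ext_join, relabel_join, relabel_refl]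

theorem ext_ext (f : V.E C D) : V.ext Y (V.ext X f) =
    V.locate (Equiv.sumAssoc D X Y) (Equiv.sumAssoc C X Y).symm f := by
  have h : V.relabMap (Equiv.sumAssoc C X Y) ∘ₗ V.ext Y (V.ext X f) =
      V.ext (X ⊕ Y) f ∘ₗ V.relabMap (Equiv.sumAssoc D X Y) := by
    refine V.sum_hom_ext fun u v => ?_
    refine LinearMap.congr_fun (f := (V.relabMap (Equiv.sumAssoc C X Y) ∘ₗ V.ext Y (V.ext X f)) ∘ₗ
      (V.join (D ⊕ X) Y).flip v) (g := (V.ext (X ⊕ Y) f ∘ₗ V.relabMap (Equiv.sumAssoc D X Y)) ∘ₗ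
      (V.join (D ⊕ X) Y).flip v) (V.sum_hom_ext fun s t => ?_) u
    simp only [LinearMap.comp_apply, LinearMap.flip_apply, LinearEquiv.coe_coe, ext_join,
      relabel_assoc_join]
  rw [locate, ← h, ← LinearMap.comp_assoc, relabMap_comp_relabMap, Equiv.self_trans_symm,
    relabMap_refl, LinearMap.id_comp]

theorem ext_eq_locate (f : V.E C D) :
    V.ext X f = V.locate (Equiv.refl (D ⊕ X)) (Equiv.refl (C ⊕ X)) f := by
  rw [locate, relabMap_refl, relabMap_refl, LinearMap.id_comp, LinearMap.comp_id]

theorem relabMap_comp_locate (e : U ≃ D ⊕ X) (e' : C ⊕ X ≃ W) (f : V.E C D) (σ : W ≃ W') :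
    V.relabMap σ ∘ₗ V.locate e e' f = V.locate e (e'.trans σ) f := by
  rw [locate, locate, ← LinearMap.comp_assoc, relabMap_comp_relabMap]

theorem locate_comp_relabMap (e : U ≃ D ⊕ X) (e' : C ⊕ X ≃ W) (f : V.E C D) (σ : U' ≃ U) :
    V.locate e e' f ∘ₗ V.relabMap σ = V.locate (σ.trans e) e' f := by
  rw [locate, locate, LinearMap.comp_assoc, LinearMap.comp_assoc, relabMap_comp_relabMap]

/-- The outcome of a located map does not depend on the names of the factors. -/
theorem relabMap_comp_locate_comm {e : U ≃ D ⊕ X} {e' : C ⊕ X ≃ W} {e₁ : U' ≃ D ⊕ X'}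
    {e₁' : C ⊕ X' ≃ W'} (f : V.E C D) (τ : X ≃ X') (σ : U ≃ U') (ρ : W ≃ W')
    (h : ∀ s, Equiv.sumCongr (Equiv.refl D) τ (e s) = e₁ (σ s))
    (h' : ∀ s, ρ (e' s) = e₁' (Equiv.sumCongr (Equiv.refl C) τ s)) :
    V.relabMap ρ ∘ₗ V.locate e e' f = V.locate e₁ e₁' f ∘ₗ V.relabMap σ := by
  rw [relabMap_comp_locate, locate_comp_relabMap]
  have h1 : e'.trans ρ = (Equiv.sumCongr (Equiv.refl C) τ).trans e₁' := Equiv.ext h'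
  have h2 : σ.trans e₁ = e.trans (Equiv.sumCongr (Equiv.refl D) τ) :=
    Equiv.ext fun s => (h s).symm
  rw [h1, h2, locate, locate, ← relabMap_comp_relabMap, ← relabMap_comp_relabMap,
    LinearMap.comp_assoc, ← LinearMap.comp_assoc _ (V.ext X f), relabMap_comp_ext,
    LinearMap.comp_assoc]

theorem ext_locate (e : U ≃ D ⊕ X) (e' : C ⊕ X ≃ W) (f : V.E C D) :
    V.ext Y (V.locate e e' f) =
      V.locate ((Equiv.sumCongr e (Equiv.refl Y)).trans (Equiv.sumAssoc D X Y))
        ((Equiv.sumAssoc C X Y).symm.trans (Equiv.sumCongr e' (Equiv.refl Y))) f := by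
  rw [locate, ext_comp, ext_comp, ext_relabMap, ext_relabMap, ext_ext, locate_comp_relabMap,
    relabMap_comp_locate]

theorem locate_comp (e : U ≃ D ⊕ X) (e' : C ⊕ X ≃ W) (f : V.E C C') (g : V.E C' D) :
    V.locate e e' (f ∘ₗ g) = V.locate (Equiv.refl _) e' f ∘ₗ V.locate e (Equiv.refl _) g := by
  rw [locate, locate, locate, ext_comp]
  simp only [relabMap_refl, LinearMap.id_comp, LinearMap.comp_id]
  rfl

theorem locate_locate (e : U ≃ D ⊕ X) (e' : C ⊕ X ≃ W) (e₁ : U' ≃ U ⊕ Y) (e₁' : W ⊕ Y ≃ W')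
    (f : V.E C D) : V.locate e₁ e₁' (V.locate e e' f) =
      V.locate (e₁.trans ((Equiv.sumCongr e (Equiv.refl Y)).trans (Equiv.sumAssoc D X Y)))
        (((Equiv.sumAssoc C X Y).symm.trans (Equiv.sumCongr e' (Equiv.refl Y))).trans e₁') f := by
  rw [locate, ext_locate, locate_comp_relabMap, relabMap_comp_locate]

/-! ### Parity, degree and differential of linear maps -/

theorem homParity_apply (f : V.E C D) (x : V.odot D) :
    V.homParity C D f x = V.odotParity C (f (V.odotParity D x)) := rfl

theorem homParity_comp (f : V.E C C') (g : V.E C' D) :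
    V.homParity C D (f ∘ₗ g) = V.homParity C C' f ∘ₗ V.homParity C' D g :=
  LinearMap.ext fun x => by
    simp only [homParity_apply, LinearMap.comp_apply, odotParity_odotParity]

theorem homParity_relabMap (σ : C ≃ D) : V.homParity D C (V.relabMap σ) = V.relabMap σ :=
  LinearMap.ext fun x => by
    simp only [homParity_apply, LinearEquiv.coe_coe, odotParity_relabel, odotParity_odotParity]

theorem homParity_ext (f : V.E C D) :
    V.homParity (C ⊕ X) (D ⊕ X) (V.ext X f) = V.ext X (V.homParity C D f) :=
  V.sum_hom_ext fun u v => by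
    simp only [homParity_apply, odotParity_join, ext_join, odotParity_odotParity]

theorem homParity_locate (e : U ≃ D ⊕ X) (e' : C ⊕ X ≃ W) (f : V.E C D) :
    V.homParity W U (V.locate e e' f) = V.locate e e' (V.homParity C D f) := by
  rw [locate, homParity_comp, homParity_comp, homParity_ext, homParity_relabMap, homParity_relabMap]
  rfl

theorem homD_apply (f : V.E C D) (x : V.odot D) :
    V.homD C D f x = V.odotD C (f x) - V.homParity C D f (V.odotD D x) := rfl

theorem homD_comp (f : V.E C C') (g : V.E C' D) :
    V.homD C D (f ∘ₗ g) = V.homD C C' f ∘ₗ g + V.homParity C C' f ∘ₗ V.homD C' D g :=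
  LinearMap.ext fun x => by
    rw [homD_apply, homParity_comp]
    simp only [LinearMap.add_apply, LinearMap.comp_apply, homD_apply, map_sub]
    abel

theorem homD_relabMap (σ : C ≃ D) : V.homD D C (V.relabMap σ) = 0 :=
  LinearMap.ext fun x => by
    rw [homD_apply, homParity_relabMap, LinearEquiv.coe_coe, odotD_relabel]
    exact sub_self _

theorem homD_ext (f : V.E C D) :
    V.homD (C ⊕ X) (D ⊕ X) (V.ext X f) = V.ext X (V.homD C D f) :=
  V.sum_hom_ext fun u v => by
    rw [homD_apply, homParity_ext, odotD_join]
    simp only [ext_join, map_add, homD_apply, odotD_join, map_sub, LinearMap.sub_apply]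
    rw [V.homParity_apply f (V.odotParity D u), odotParity_odotParity]
    abel

theorem homD_locate (e : U ≃ D ⊕ X) (e' : C ⊕ X ≃ W) (f : V.E C D) :
    V.homD W U (V.locate e e' f) = V.locate e e' (V.homD C D f) := by
  rw [locate, homD_comp, homD_comp, homD_relabMap, homD_relabMap, homD_ext, homParity_relabMap,
    LinearMap.comp_zero, add_zero, LinearMap.zero_comp, zero_add]
  rfl

theorem homParity_of_mem {i : ℤ} {f : V.E C D} (hf : f ∈ V.homDeg C D i) :
    V.homParity C D f = sgn k i • f := by
  cases nonempty_fintype D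
  refine V.odot_hom_ext (anyOrder D) fun a x hx => ?_
  have h := V.tp_mem_odotDeg (anyOrder D) hx
  rw [homParity_apply, V.odotParity_of_mem h, map_smul, map_smul, V.odotParity_of_mem (hf _ _ h),
    smul_smul, sgn_add, ← mul_assoc, sgn_mul_self, one_mul, LinearMap.smul_apply]

theorem comp_mem_homDeg {i j : ℤ} {f : V.E C C'} {g : V.E C' D} (hf : f ∈ V.homDeg C C' i)
    (hg : g ∈ V.homDeg C' D j) : f ∘ₗ g ∈ V.homDeg C D (i + j) := fun e x hx => by
  have := hf _ _ (hg e x hx)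
  rwa [add_assoc, add_comm j] at this

theorem relabMap_mem_homDeg (σ : C ≃ D) : V.relabMap σ ∈ V.homDeg D C 0 := fun e x hx => by
  rw [add_zero]
  exact V.relabel_mem σ hx

theorem ext_mem_homDeg {i : ℤ} {f : V.E C D} (hf : f ∈ V.homDeg C D i) :
    V.ext X f ∈ V.homDeg (C ⊕ X) (D ⊕ X) i := fun e x hx => by
  refine V.odotDeg_sum_le (S := (V.odotDeg (C ⊕ X) (e + i)).comap (V.ext X f))
    (fun e₁ e₂ u v he hu hv => ?_) hx
  rw [Submodule.mem_comap, ext_join, ← he, add_right_comm]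
  exact V.join_mem (hf _ _ hu) hv

theorem locate_mem_homDeg {i : ℤ} (e : U ≃ D ⊕ X) (e' : C ⊕ X ≃ W) {f : V.E C D}
    (hf : f ∈ V.homDeg C D i) : V.locate e e' f ∈ V.homDeg W U i := by
  have := V.comp_mem_homDeg (V.relabMap_mem_homDeg e')
    (V.comp_mem_homDeg (V.ext_mem_homDeg (X := X) hf) (V.relabMap_mem_homDeg e))
  rwa [add_zero, zero_add] at this

theorem homAct_mem_homDeg {i : ℤ} (ρ : C ≃ C') (σ : D ≃ D') {f : V.E C D}
    (hf : f ∈ V.homDeg C D i) : V.homAct ρ σ f ∈ V.homDeg C' D' i := by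
  rw [homAct_eq]
  have := V.comp_mem_homDeg (V.relabMap_mem_homDeg ρ)
    (V.comp_mem_homDeg hf (V.relabMap_mem_homDeg σ.symm))
  rwa [add_zero, zero_add] at this

theorem homD_homAct (ρ : C ≃ C') (σ : D ≃ D') (f : V.E C D) :
    V.homD C' D' (V.homAct ρ σ f) = V.homAct ρ σ (V.homD C D f) := by
  rw [homAct_eq, homAct_eq, homD_comp, homD_comp, homD_relabMap, homD_relabMap, homParity_relabMap,
    LinearMap.comp_zero, add_zero, LinearMap.zero_comp, zero_add]

theorem odotParity_odotEven (x : V.odot C) : V.odotParity C (V.odotEven C x) = V.odotEven C x := by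
  cases nonempty_fintype C
  refine LinearMap.congr_fun (f := V.odotParity C ∘ₗ V.odotEven C) (g := V.odotEven C)
    (V.odot_hom_ext (anyOrder C) fun a x hx => ?_) x
  rw [LinearMap.comp_apply, V.odotEven_tp _ hx, map_smul, V.odotParity_tp _ hx]
  split_ifs with h
  · rw [zero_smul, zero_smul]
  · rw [sgn_of_even (Int.not_odd_iff_even.1 h), one_smul]

theorem odotParity_odotOdd (x : V.odot C) : V.odotParity C (V.odotOdd C x) = -V.odotOdd C x := by
  cases nonempty_fintype C
  refine LinearMap.congr_fun (f := V.odotParity C ∘ₗ V.odotOdd C) (g := -V.odotOdd C)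
    (V.odot_hom_ext (anyOrder C) fun a x hx => ?_) x
  rw [LinearMap.comp_apply, LinearMap.neg_apply, V.odotOdd_tp _ hx, map_smul,
    V.odotParity_tp _ hx]
  split_ifs with h
  · rw [sgn_of_odd h, one_smul, one_smul]
    exact neg_one_smul k (V.tp (anyOrder C) x)
  · simp

/-- Conjugating `g ⊗ id` by the braiding gives the map `id ⊗ g`, with its Koszul sign. -/
theorem locate_comm_join (g : V.E C' D') (u : V.odot D) (v : V.odot D') :
    V.locate (Equiv.sumComm D D') (Equiv.sumComm C' D) g (V.join D D' u v) =
      V.join D C' (V.odotEven D u) (g v) +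
        V.join D C' (V.odotOdd D u) (V.homParity C' D' g v) := by
  have he : ∀ p : V.odot C', V.odotEven C' p + V.odotOdd C' p = p := V.odotEven_add_odotOdd
  have h1 : ∀ p : V.odot C', V.relabel (Equiv.sumComm C' D) (V.join C' D p (V.odotEven D u)) =
      V.join D C' (V.odotEven D u) p := fun p => by
    rw [relabel_comm_join, odotParity_odotEven, ← map_add, he]
  have h2 : ∀ p : V.odot C', V.relabel (Equiv.sumComm C' D) (V.join C' D p (V.odotOdd D u)) =
      V.join D C' (V.odotOdd D u) (V.odotParity C' p) := fun p => by
    rw [relabel_comm_join, odotParity_odotOdd, map_neg, LinearMap.neg_apply, ← sub_eq_add_neg,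
      ← map_sub]
    rfl
  rw [locate, LinearMap.comp_apply, LinearMap.comp_apply, LinearEquiv.coe_coe, LinearEquiv.coe_coe,
    relabel_comm_join, map_add, map_add, ext_join, ext_join, h1, h2]
  rfl

/-- Maps applied to disjoint sets of factors commute up to the Koszul sign. -/
theorem ext_interchange {i j : ℤ} {f : V.E C D} {g : V.E C' D'} (hf : f ∈ V.homDeg C D i)
    (hg : g ∈ V.homDeg C' D' j) :
    V.ext C' f ∘ₗ V.locate (Equiv.sumComm D D') (Equiv.sumComm C' D) g =
      sgn k (i * j) •
        V.locate (Equiv.sumComm C D') (Equiv.sumComm C' C) g ∘ₗ V.ext D' f := by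
  have hp : ∀ u, V.odotParity C (f u) = sgn k i • f (V.odotParity D u) := fun u => by
    have := LinearMap.congr_fun (V.homParity_of_mem hf) (V.odotParity D u)
    rwa [homParity_apply, odotParity_odotParity] at this
  refine V.sum_hom_ext fun u v => ?_
  have hu := V.odotEven_add_odotOdd u
  have hfu := V.odotEven_add_odotOdd (f u)
  simp only [LinearMap.smul_apply, LinearMap.comp_apply, locate_comm_join, ext_join, map_add,
    V.homParity_of_mem hg, map_smul]
  rcases Int.even_or_odd j with h | h
  · rw [sgn_of_even h, sgn_of_even (h.mul_left i), one_smul, one_smul, one_smul,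
      ← LinearMap.add_apply, ← LinearMap.add_apply, ← map_add, ← map_add, ← map_add, hu, hfu]
  · have hs : sgn k (i * j) = sgn k i := by
      refine sgn_eq_of_even_sub ?_
      rw [← mul_sub_one]
      exact (h.sub_odd odd_one).mul_left _
    have e1 : ∀ z : V.odot (C ⊕ C'), sgn k j • z = -z := fun z => by
      rw [sgn_of_odd h]
      exact neg_one_smul k z
    have e2 : ∀ p q : V.odot C, V.join C C' p (g v) - V.join C C' q (g v) =
        V.join C C' (p - q) (g v) := fun p q => by
      rw [map_sub]
      rfl
    rw [hs, e1, e1, ← sub_eq_add_neg, ← sub_eq_add_neg, e2, e2, ← map_sub]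
    change V.join C C' (f (V.odotParity D u)) (g v) =
      sgn k i • V.join C C' (V.odotParity C (f u)) (g v)
    rw [hp, map_smul, LinearMap.smul_apply, smul_smul, sgn_mul_self, one_smul]

/-! ### The operations of the endomorphism properad -/

/-- The relabelling that exchanges the glued outputs `A` for the inputs `B`. -/
def middleEquiv (D C : Type) {A B : Type} (η : B ≃ A) : (C ⊕ A) ⊕ D ≃ (D ⊕ B) ⊕ C :=
  (Equiv.sumComm (C ⊕ A) D).trans
    ((Equiv.sumCongr (Equiv.refl D)
      ((Equiv.sumComm C A).trans (Equiv.sumCongr η.symm (Equiv.refl C)))).trans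
        (Equiv.sumAssoc D B C).symm)

theorem middle_split {A B : Type} [Finite A] [Finite B] (η : B ≃ A) (x : V.odot (D ⊕ (C ⊕ A))) :
    (V.split (D ⊕ B) C).symm (V.middle D C η (V.split D (C ⊕ A) x)) =
      V.relabel (Equiv.sumAssoc D B C).symm (V.relabel (Equiv.sumCongr (Equiv.refl D)
        ((Equiv.sumComm C A).trans (Equiv.sumCongr η.symm (Equiv.refl C)))) x) := by
  have key : ∀ (u : V.odot D) (y : V.odot (A ⊕ C)), (V.split (D ⊕ B) C).symm
      ((TensorProduct.congr (V.split D B).symm (LinearEquiv.refl k _))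
        ((TensorProduct.assoc k _ _ _).symm (u ⊗ₜ[k]
          (TensorProduct.congr (V.relabel η.symm) (LinearEquiv.refl k _)) (V.split A C y)))) =
      V.relabel (Equiv.sumAssoc D B C).symm (V.join D (B ⊕ C) u
        (V.relabel (Equiv.sumCongr η.symm (Equiv.refl C)) y)) := by
    intro u y
    refine LinearMap.congr_fun (f := (V.split (D ⊕ B) C).symm.toLinearMap ∘ₗ
      (TensorProduct.congr (V.split D B).symm (LinearEquiv.refl k _)).toLinearMap ∘ₗ
      (TensorProduct.assoc k _ _ _).symm.toLinearMap ∘ₗ TensorProduct.mk k _ _ u ∘ₗ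
      (TensorProduct.congr (V.relabel η.symm) (LinearEquiv.refl k _)).toLinearMap ∘ₗ
      (V.split A C).toLinearMap)
      (g := (V.relabel (Equiv.sumAssoc D B C).symm).toLinearMap ∘ₗ V.join D (B ⊕ C) u ∘ₗ
        (V.relabel (Equiv.sumCongr η.symm (Equiv.refl C))).toLinearMap)
      (V.sum_hom_ext fun s t => ?_) y
    simp only [LinearMap.comp_apply, LinearEquiv.coe_coe, split_join, TensorProduct.congr_tmul,
      TensorProduct.mk_apply, TensorProduct.assoc_symm_tmul, LinearEquiv.refl_apply,
      split_symm_tmul, relabel_join, relabel_refl]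
    rw [← V.relabel_symm (Equiv.sumAssoc D B C), LinearEquiv.eq_symm_apply, relabel_assoc_join]
  refine LinearMap.congr_fun (f := (V.split (D ⊕ B) C).symm.toLinearMap ∘ₗ
    (V.middle D C η).toLinearMap ∘ₗ (V.split D (C ⊕ A)).toLinearMap)
    (g := (V.relabel (Equiv.sumAssoc D B C).symm).toLinearMap ∘ₗ
      (V.relabel (Equiv.sumCongr (Equiv.refl D) ((Equiv.sumComm C A).trans
        (Equiv.sumCongr η.symm (Equiv.refl C))))).toLinearMap) (V.sum_hom_ext fun s t => ?_) x
  simp only [LinearMap.comp_apply, LinearEquiv.coe_coe, split_join, relabel_join, relabel_refl,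
    ← relabel_trans]
  rw [← key]
  rfl

theorem idTensor_split (f : V.E C' D') (x : V.odot (D ⊕ D')) :
    (V.split D C').symm (V.idTensor D D' C' f (V.split D D' x)) =
      V.locate (Equiv.sumComm D D') (Equiv.sumComm C' D) f x := by
  refine LinearMap.congr_fun (f := (V.split D C').symm.toLinearMap ∘ₗ V.idTensor D D' C' f ∘ₗ
    (V.split D D').toLinearMap) (V.sum_hom_ext fun u v => ?_) x
  simp only [LinearMap.comp_apply, LinearEquiv.coe_coe, split_join, locate_comm_join, idTensor,
    LinearMap.add_apply, TensorProduct.map_tmul, map_add, split_symm_tmul]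

/-- The operation along `η` as a composite of located maps: first `f`, acting on the inputs `D₂`,
then `g`, acting on `D₁` and on the outputs of `f` glued to it. -/
theorem homComp_eq {C₁ D₁ C₂ D₂ A B : Type} [Finite C₁] [Finite D₁] [Finite C₂] [Finite D₂]
    [Finite A] [Finite B] (η : B ≃ A) (g : V.E C₁ (D₁ ⊕ B)) (f : V.E (C₂ ⊕ A) D₂) :
    V.homComp η g f = V.locate (Equiv.refl _) (Equiv.refl _) g ∘ₗ
      V.locate (Equiv.sumComm D₁ D₂) (middleEquiv D₁ C₂ η) f := by
  refine LinearMap.ext fun x => ?_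
  change (V.split C₁ C₂).symm (LinearMap.rTensor (V.odot C₂) g (V.middle D₁ C₂ η
    (V.idTensor D₁ D₂ (C₂ ⊕ A) f (V.split D₁ D₂ x)))) = _
  obtain ⟨y, hy⟩ : ∃ y, V.idTensor D₁ D₂ (C₂ ⊕ A) f (V.split D₁ D₂ x) = V.split D₁ (C₂ ⊕ A) y :=
    ⟨_, ((V.split _ _).apply_symm_apply _).symm⟩
  obtain ⟨z, hz⟩ : ∃ z, V.middle D₁ C₂ η (V.split D₁ (C₂ ⊕ A) y) = V.split (D₁ ⊕ B) C₂ z :=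
    ⟨_, ((V.split _ _).apply_symm_apply _).symm⟩
  have hy' := V.idTensor_split f x
  have hz' := V.middle_split η y
  rw [hy, LinearEquiv.symm_apply_apply] at hy'
  rw [hz, LinearEquiv.symm_apply_apply] at hz'
  rw [hy, hz, ← ext_eq_locate, LinearMap.comp_apply, middleEquiv, ← relabMap_comp_locate,
    LinearMap.comp_apply, ← hy', LinearEquiv.coe_coe, ← relabel_trans, ← hz']
  rfl

end DGVect

/-! ### The axioms of a properad for the endomorphism properad -/

namespace DGVect

open Properad.StableGrading (sgn_add sgn_mul_self)

variable {k : Type w} [Field k] (V : DGVect.{w, v} k)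

theorem locate_relabMap {C C' X U W : Type} [Finite C] [Finite C'] [Finite X] [Finite U] [Finite W]
    (e : U ≃ C ⊕ X) (e' : C' ⊕ X ≃ W) (σ : C ≃ C') :
    V.locate e e' (V.relabMap σ) =
      V.relabMap (e.trans ((Equiv.sumCongr σ (Equiv.refl X)).trans e')) := by
  rw [locate, ext_relabMap, relabMap_comp_relabMap, relabMap_comp_relabMap]
  rfl

theorem relabMap_comp_locate_assoc {C D X U W W' S : Type} [Finite C] [Finite D] [Finite X]
    [Finite U] [Finite W] [Finite W'] [Finite S] (e : U ≃ D ⊕ X) (e' : C ⊕ X ≃ W) (f : V.E C D)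
    (σ : W ≃ W') (g : V.E U S) :
    V.relabMap σ ∘ₗ V.locate e e' f ∘ₗ g = V.locate e (e'.trans σ) f ∘ₗ g := by
  rw [← LinearMap.comp_assoc, relabMap_comp_locate]

section Congr

variable {C₁ D₁ X₁ X₁' C₂ D₂ X₂ X₂' C₃ D₃ X₃ X₃' W U U' S S' T : Type} [Finite C₁] [Finite D₁]
  [Finite X₁] [Finite X₁'] [Finite C₂] [Finite D₂] [Finite X₂] [Finite X₂'] [Finite C₃] [Finite D₃]
  [Finite X₃] [Finite X₃'] [Finite W] [Finite U] [Finite U'] [Finite S] [Finite S'] [Finite T]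

/-- Comparison of composites of two located maps: besides renamings of the factors on which the maps
do not act, only the total relabellings between consecutive maps matter. -/
theorem locate_comp_congr {a : U ≃ D₁ ⊕ X₁} {a' : C₁ ⊕ X₁ ≃ W} {a₁ : U' ≃ D₁ ⊕ X₁'}
    {a₁' : C₁ ⊕ X₁' ≃ W} {b : S ≃ D₂ ⊕ X₂} {b' : C₂ ⊕ X₂ ≃ U} {b₁ : S ≃ D₂ ⊕ X₂'}
    {b₁' : C₂ ⊕ X₂' ≃ U'} (f : V.E C₁ D₁) (g : V.E C₂ D₂) (τ₁ : X₁ ≃ X₁') (τ₂ : X₂ ≃ X₂')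
    (h₁ : ∀ s, a' s = a₁' (Equiv.sumCongr (Equiv.refl C₁) τ₁ s))
    (h₂ : ∀ s, Equiv.sumCongr (Equiv.refl D₁) τ₁ (a (b' s)) =
      a₁ (b₁' (Equiv.sumCongr (Equiv.refl C₂) τ₂ s)))
    (h₃ : ∀ s, Equiv.sumCongr (Equiv.refl D₂) τ₂ (b s) = b₁ s) :
    V.locate a a' f ∘ₗ V.locate b b' g = V.locate a₁ a₁' f ∘ₗ V.locate b₁ b₁' g := by
  have h := V.relabMap_comp_locate_comm g τ₂ (Equiv.refl S)
    ((a.trans (Equiv.sumCongr (Equiv.refl D₁) τ₁)).trans a₁.symm) (e := b) (e' := b') (e₁ := b₁)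
    (e₁' := b₁') h₃ (fun s => by
      rw [Equiv.trans_apply, Equiv.trans_apply, h₂, Equiv.symm_apply_apply])
  have h' := V.relabMap_comp_locate_comm f τ₁
    ((a.trans (Equiv.sumCongr (Equiv.refl D₁) τ₁)).trans a₁.symm) (Equiv.refl W) (e := a)
    (e' := a') (e₁ := a₁) (e₁' := a₁') (fun s => by
      rw [Equiv.trans_apply, Equiv.trans_apply, Equiv.apply_symm_apply]) h₁
  rw [relabMap_refl, LinearMap.comp_id] at h
  rw [relabMap_refl, LinearMap.id_comp] at h'
  rw [h', LinearMap.comp_assoc, h]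

/-- Comparison of composites of three located maps. -/
theorem locate_comp_comp_congr {a : U ≃ D₁ ⊕ X₁} {a' : C₁ ⊕ X₁ ≃ W} {a₁ : U' ≃ D₁ ⊕ X₁'}
    {a₁' : C₁ ⊕ X₁' ≃ W} {b : S ≃ D₂ ⊕ X₂} {b' : C₂ ⊕ X₂ ≃ U} {b₁ : S' ≃ D₂ ⊕ X₂'}
    {b₁' : C₂ ⊕ X₂' ≃ U'} {c : T ≃ D₃ ⊕ X₃} {c' : C₃ ⊕ X₃ ≃ S} {c₁ : T ≃ D₃ ⊕ X₃'}
    {c₁' : C₃ ⊕ X₃' ≃ S'} (f : V.E C₁ D₁) (g : V.E C₂ D₂) (l : V.E C₃ D₃) (τ₁ : X₁ ≃ X₁')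
    (τ₂ : X₂ ≃ X₂') (τ₃ : X₃ ≃ X₃')
    (h₁ : ∀ s, a' s = a₁' (Equiv.sumCongr (Equiv.refl C₁) τ₁ s))
    (h₂ : ∀ s, Equiv.sumCongr (Equiv.refl D₁) τ₁ (a (b' s)) =
      a₁ (b₁' (Equiv.sumCongr (Equiv.refl C₂) τ₂ s)))
    (h₃ : ∀ s, Equiv.sumCongr (Equiv.refl D₂) τ₂ (b (c' s)) =
      b₁ (c₁' (Equiv.sumCongr (Equiv.refl C₃) τ₃ s)))
    (h₄ : ∀ s, Equiv.sumCongr (Equiv.refl D₃) τ₃ (c s) = c₁ s) :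
    V.locate a a' f ∘ₗ V.locate b b' g ∘ₗ V.locate c c' l =
      V.locate a₁ a₁' f ∘ₗ V.locate b₁ b₁' g ∘ₗ V.locate c₁ c₁' l := by
  have h := V.locate_comp_congr g l τ₂ τ₃ (a := b) (b := c) (a₁ := b₁)
    (a' := b'.trans ((a.trans (Equiv.sumCongr (Equiv.refl D₁) τ₁)).trans a₁.symm)) (b' := c')
    (b₁ := c₁) (a₁' := b₁') (b₁' := c₁')
    (fun s => by
      simp only [Equiv.trans_apply]
      rw [h₂, Equiv.symm_apply_apply]) h₃ h₄
  have h' := V.relabMap_comp_locate_comm f τ₁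
    ((a.trans (Equiv.sumCongr (Equiv.refl D₁) τ₁)).trans a₁.symm) (Equiv.refl W) (e := a)
    (e' := a') (e₁ := a₁) (e₁' := a₁') (fun s => by
      rw [Equiv.trans_apply, Equiv.trans_apply, Equiv.apply_symm_apply]) h₁
  rw [relabMap_refl, LinearMap.id_comp] at h'
  rw [h', LinearMap.comp_assoc, ← h, relabMap_comp_locate_assoc]

end Congr

section Interchange

variable {C D C' D' Z Xa Xb Xc Xd U S W T S' W' : Type} [Finite C] [Finite D] [Finite C']
  [Finite D'] [Finite Z] [Finite Xa] [Finite Xb] [Finite Xc] [Finite Xd] [Finite U] [Finite S]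
  [Finite W] [Finite T] [Finite S'] [Finite W']

/-- `(α ⊔ β) ⊔ γ ≃ β ⊔ (α ⊔ γ)`. -/
def pullSecond (α β γ : Type) : (α ⊕ β) ⊕ γ ≃ β ⊕ (α ⊕ γ) :=
  (Equiv.sumCongr (Equiv.sumComm α β) (Equiv.refl γ)).trans (Equiv.sumAssoc β α γ)

/-- The interchange law in the presence of further factors `Z` on which neither map acts. -/
theorem locate_interchange_std {i j : ℤ} {f : V.E C D} {g : V.E C' D'}
    (hf : f ∈ V.homDeg C D i) (hg : g ∈ V.homDeg C' D' j) :
    V.locate (Equiv.sumAssoc D C' Z) (Equiv.sumAssoc C C' Z).symm f ∘ₗ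
        V.locate (pullSecond D D' Z) (pullSecond D C' Z).symm g =
      sgn k (i * j) • V.locate (pullSecond C D' Z) (pullSecond C C' Z).symm g ∘ₗ
        V.locate (Equiv.sumAssoc D D' Z) (Equiv.sumAssoc C D' Z).symm f := by
  have h := congrArg (V.ext Z) (V.ext_interchange hf hg)
  rw [ext_smul, ext_comp, ext_comp, ext_ext, ext_ext, ext_locate, ext_locate] at h
  exact h

/-- Located maps that act on disjoint sets of factors commute up to the Koszul sign. -/
theorem locate_interchange {i j : ℤ} {f : V.E C D} {g : V.E C' D'} (hf : f ∈ V.homDeg C D i)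
    (hg : g ∈ V.homDeg C' D' j) {a : U ≃ D ⊕ Xa} {a' : C ⊕ Xa ≃ W} {b : S ≃ D' ⊕ Xb}
    {b' : C' ⊕ Xb ≃ U} {c : T ≃ D' ⊕ Xc} {c' : C' ⊕ Xc ≃ W'} {d : S' ≃ D ⊕ Xd} {d' : C ⊕ Xd ≃ T}
    (τa : C' ⊕ Z ≃ Xa) (τb : D ⊕ Z ≃ Xb) (τc : C ⊕ Z ≃ Xc) (τd : D' ⊕ Z ≃ Xd) (σ : S ≃ S')
    (ρ : W ≃ W')
    (h₁ : ∀ s, Equiv.sumCongr (Equiv.refl D) τa (Equiv.sumAssoc D C' Z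
      ((pullSecond D C' Z).symm s)) = a (b' (Equiv.sumCongr (Equiv.refl C') τb s)))
    (h₂ : ∀ s, Equiv.sumCongr (Equiv.refl D') τc (pullSecond C D' Z
      ((Equiv.sumAssoc C D' Z).symm s)) = c (d' (Equiv.sumCongr (Equiv.refl C) τd s)))
    (h₃ : ∀ s, Equiv.sumCongr (Equiv.refl D) τd (Equiv.sumAssoc D D' Z s) =
      d (σ (b.symm (Equiv.sumCongr (Equiv.refl D') τb (pullSecond D D' Z s)))))
    (h₄ : ∀ s, ρ (a' (Equiv.sumCongr (Equiv.refl C) τa (Equiv.sumAssoc C C' Z s))) =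
      c' (Equiv.sumCongr (Equiv.refl C') τc (pullSecond C C' Z s))) :
    V.relabMap ρ ∘ₗ V.locate a a' f ∘ₗ V.locate b b' g =
      sgn k (i * j) • V.locate c c' g ∘ₗ V.locate d d' f ∘ₗ V.relabMap σ := by
  let iS : (D ⊕ D') ⊕ Z ≃ S :=
    ((pullSecond D D' Z).trans (Equiv.sumCongr (Equiv.refl D') τb)).trans b.symm
  let iU : (D ⊕ C') ⊕ Z ≃ U :=
    ((Equiv.sumAssoc D C' Z).trans (Equiv.sumCongr (Equiv.refl D) τa)).trans a.symm
  let iW : (C ⊕ C') ⊕ Z ≃ W :=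
    ((Equiv.sumAssoc C C' Z).trans (Equiv.sumCongr (Equiv.refl C) τa)).trans a'
  let jT : (C ⊕ D') ⊕ Z ≃ T :=
    ((pullSecond C D' Z).trans (Equiv.sumCongr (Equiv.refl D') τc)).trans c.symm
  have e₁ := V.relabMap_comp_locate_comm f τa iU iW (e := Equiv.sumAssoc D C' Z)
    (e' := (Equiv.sumAssoc C C' Z).symm) (e₁ := a) (e₁' := a') (fun s => by simp [iU])
    (fun s => by simp [iW])
  have e₂ := V.relabMap_comp_locate_comm g τb iS iU (e := pullSecond D D' Z)
    (e' := (pullSecond D C' Z).symm) (e₁ := b) (e₁' := b') (fun s => by simp [iS])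
    (fun s => by simp only [iU, Equiv.trans_apply, h₁, Equiv.symm_apply_apply])
  have e₃ := V.relabMap_comp_locate_comm g τc jT (iW.trans ρ) (e := pullSecond C D' Z)
    (e' := (pullSecond C C' Z).symm) (e₁ := c) (e₁' := c') (fun s => by simp [jT])
    (fun s => by
      simp only [iW, Equiv.trans_apply, h₄, Equiv.apply_symm_apply])
  have e₄ := V.relabMap_comp_locate_comm f τd (iS.trans σ) jT (e := Equiv.sumAssoc D D' Z)
    (e' := (Equiv.sumAssoc C D' Z).symm) (e₁ := d) (e₁' := d')
    (fun s => by simp only [iS, Equiv.trans_apply, h₃])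
    (fun s => by simp only [jT, Equiv.trans_apply, h₂, Equiv.symm_apply_apply])
  have hc : ∀ F G : V.E W' S, F ∘ₗ V.relabMap iS = G ∘ₗ V.relabMap iS → F = G := fun F G h => by
    have := congrArg (· ∘ₗ V.relabMap iS.symm) h
    simpa only [LinearMap.comp_assoc, relabMap_comp_relabMap, Equiv.symm_trans_self, relabMap_refl,
      LinearMap.comp_id] using this
  refine hc _ _ ?_
  rw [LinearMap.comp_assoc, LinearMap.comp_assoc, ← e₂,
    ← LinearMap.comp_assoc _ _ (V.locate a a' f), ← e₁, LinearMap.comp_assoc,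
    V.locate_interchange_std hf hg, LinearMap.smul_comp,
    LinearMap.comp_assoc, LinearMap.comp_assoc, relabMap_comp_relabMap, ← e₄, LinearMap.comp_smul,
    LinearMap.comp_smul, ← LinearMap.comp_assoc _ (V.relabMap jT), ← e₃,
    ← V.relabMap_comp_relabMap iW ρ]
  rfl

/-- The interchange law for composites following a third located map, up to renaming the factors
on which the maps do not act. -/
theorem locate_interchange_comp {C₃ D₃ X X' R : Type} [Finite C₃] [Finite D₃] [Finite X]
    [Finite X'] [Finite R] {i j : ℤ} {f : V.E C D} {g : V.E C' D'} (l : V.E C₃ D₃)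
    (hf : f ∈ V.homDeg C D i) (hg : g ∈ V.homDeg C' D' j) {a : U ≃ D ⊕ Xa} {a' : C ⊕ Xa ≃ W}
    {b : S ≃ D' ⊕ Xb} {b' : C' ⊕ Xb ≃ U} {c : T ≃ D' ⊕ Xc} {c' : C' ⊕ Xc ≃ W} {d : S' ≃ D ⊕ Xd}
    {d' : C ⊕ Xd ≃ T} {m : R ≃ D₃ ⊕ X} {m' : C₃ ⊕ X ≃ S} {m₁ : R ≃ D₃ ⊕ X'} {m₁' : C₃ ⊕ X' ≃ S'}
    (τa : C' ⊕ Z ≃ Xa) (τb : D ⊕ Z ≃ Xb) (τc : C ⊕ Z ≃ Xc) (τd : D' ⊕ Z ≃ Xd) (τ : X ≃ X')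
    (h₁ : ∀ s, Equiv.sumCongr (Equiv.refl D) τa (Equiv.sumAssoc D C' Z
      ((pullSecond D C' Z).symm s)) = a (b' (Equiv.sumCongr (Equiv.refl C') τb s)))
    (h₂ : ∀ s, Equiv.sumCongr (Equiv.refl D') τc (pullSecond C D' Z
      ((Equiv.sumAssoc C D' Z).symm s)) = c (d' (Equiv.sumCongr (Equiv.refl C) τd s)))
    (h₃ : ∀ s, a' (Equiv.sumCongr (Equiv.refl C) τa (Equiv.sumAssoc C C' Z s)) =
      c' (Equiv.sumCongr (Equiv.refl C') τc (pullSecond C C' Z s)))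
    (h₄ : ∀ s, Equiv.sumCongr (Equiv.refl D) τd (Equiv.sumAssoc D D' Z ((pullSecond D D' Z).symm
      (Equiv.sumCongr (Equiv.refl D') τb.symm (b (m' s))))) =
      d (m₁' (Equiv.sumCongr (Equiv.refl C₃) τ s)))
    (h₅ : ∀ s, Equiv.sumCongr (Equiv.refl D₃) τ (m s) = m₁ s) :
    V.locate a a' f ∘ₗ V.locate b b' g ∘ₗ V.locate m m' l =
      sgn k (i * j) • V.locate c c' g ∘ₗ V.locate d d' f ∘ₗ V.locate m₁ m₁' l := by
  let σ : S ≃ S' := ((((b.trans (Equiv.sumCongr (Equiv.refl D') τb.symm)).trans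
    (pullSecond D D' Z).symm).trans (Equiv.sumAssoc D D' Z)).trans
      (Equiv.sumCongr (Equiv.refl D) τd)).trans d.symm
  have h := V.locate_interchange hf hg (a := a) (a' := a') (b := b) (b' := b') (c := c) (c' := c')
    (d := d) (d' := d') τa τb τc τd σ (Equiv.refl W) h₁ h₂ (fun s => by
    simp [σ]) h₃
  have h' := V.relabMap_comp_locate_comm l τ (Equiv.refl R) σ (e := m) (e' := m') (e₁ := m₁)
    (e₁' := m₁') h₅ (fun s => by
      simp only [σ, Equiv.trans_apply, h₄, Equiv.symm_apply_apply])
  rw [relabMap_refl, LinearMap.id_comp] at h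
  rw [relabMap_refl, LinearMap.comp_id] at h'
  rw [← LinearMap.comp_assoc, h, ← h']
  rfl

/-- The interchange law for composites followed by a third located map, up to renaming the
factors on which the maps do not act. -/
theorem comp_locate_interchange {C₃ D₃ X X' R : Type} [Finite C₃] [Finite D₃] [Finite X]
    [Finite X'] [Finite R] {i j : ℤ} {f : V.E C D} {g : V.E C' D'} (l : V.E C₃ D₃)
    (hf : f ∈ V.homDeg C D i) (hg : g ∈ V.homDeg C' D' j) {a : U ≃ D ⊕ Xa} {a' : C ⊕ Xa ≃ W}
    {b : S ≃ D' ⊕ Xb} {b' : C' ⊕ Xb ≃ U} {c : T ≃ D' ⊕ Xc} {c' : C' ⊕ Xc ≃ W'} {d : S ≃ D ⊕ Xd}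
    {d' : C ⊕ Xd ≃ T} {m : W ≃ D₃ ⊕ X} {m' : C₃ ⊕ X ≃ R} {m₁ : W' ≃ D₃ ⊕ X'} {m₁' : C₃ ⊕ X' ≃ R}
    (τa : C' ⊕ Z ≃ Xa) (τb : D ⊕ Z ≃ Xb) (τc : C ⊕ Z ≃ Xc) (τd : D' ⊕ Z ≃ Xd) (τ : X ≃ X')
    (h₁ : ∀ s, Equiv.sumCongr (Equiv.refl D) τa (Equiv.sumAssoc D C' Z
      ((pullSecond D C' Z).symm s)) = a (b' (Equiv.sumCongr (Equiv.refl C') τb s)))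
    (h₂ : ∀ s, Equiv.sumCongr (Equiv.refl D') τc (pullSecond C D' Z
      ((Equiv.sumAssoc C D' Z).symm s)) = c (d' (Equiv.sumCongr (Equiv.refl C) τd s)))
    (h₃ : ∀ s, Equiv.sumCongr (Equiv.refl D) τd (Equiv.sumAssoc D D' Z
      ((pullSecond D D' Z).symm (Equiv.sumCongr (Equiv.refl D') τb.symm (b s)))) = d s)
    (h₄ : ∀ s, Equiv.sumCongr (Equiv.refl D₃) τ (m (a' (Equiv.sumCongr (Equiv.refl C) τa
      (Equiv.sumAssoc C C' Z s)))) =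
      m₁ (c' (Equiv.sumCongr (Equiv.refl C') τc (pullSecond C C' Z s))))
    (h₅ : ∀ s, m' s = m₁' (Equiv.sumCongr (Equiv.refl C₃) τ s)) :
    V.locate m m' l ∘ₗ V.locate a a' f ∘ₗ V.locate b b' g =
      sgn k (i * j) • V.locate m₁ m₁' l ∘ₗ V.locate c c' g ∘ₗ V.locate d d' f := by
  let ρ : W ≃ W' := ((((a'.symm.trans (Equiv.sumCongr (Equiv.refl C) τa.symm)).trans
    (Equiv.sumAssoc C C' Z).symm).trans (pullSecond C C' Z)).trans
      (Equiv.sumCongr (Equiv.refl C') τc)).trans c'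
  have h := V.locate_interchange hf hg (a := a) (a' := a') (b := b) (b' := b') (c := c) (c' := c')
    (d := d) (d' := d') τa τb τc τd (Equiv.refl S) ρ h₁ h₂ (fun s => by
    rw [Equiv.refl_apply, ← h₃]
    simp) (fun s => by simp [ρ])
  have h' := V.relabMap_comp_locate_comm l τ ρ (Equiv.refl R) (e := m) (e' := m') (e₁ := m₁)
    (e₁' := m₁') (fun s => by
      obtain ⟨t, rfl⟩ := a'.surjective s
      obtain ⟨t, rfl⟩ := (Equiv.sumCongr (Equiv.refl C) τa).surjective t
      obtain ⟨t, rfl⟩ := (Equiv.sumAssoc C C' Z).surjective t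
      rw [h₄]
      simp [ρ]) h₅
  rw [relabMap_refl, LinearMap.comp_id] at h
  rw [relabMap_refl, LinearMap.id_comp] at h'
  rw [h', LinearMap.comp_assoc, h, LinearMap.comp_smul]

end Interchange

theorem homAct_refl {C D : Type} [Finite C] [Finite D] (f : V.E C D) :
    V.homAct (Equiv.refl C) (Equiv.refl D) f = f := by
  rw [homAct_eq, Equiv.refl_symm, relabMap_refl, relabMap_refl, LinearMap.comp_id,
    LinearMap.id_comp]

theorem homAct_homAct {C D C' D' C'' D'' : Type} [Finite C] [Finite D] [Finite C'] [Finite D']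
    [Finite C''] [Finite D''] (ρ : C ≃ C') (σ : D ≃ D') (ρ' : C' ≃ C'') (σ' : D' ≃ D'')
    (f : V.E C D) : V.homAct ρ' σ' (V.homAct ρ σ f) = V.homAct (ρ.trans ρ') (σ.trans σ') f := by
  simp only [homAct_eq, ← relabMap_comp_relabMap, Equiv.symm_trans, LinearMap.comp_assoc]

theorem homAct_homComp {C₁ D₁ C₂ D₂ A B C₁' D₁' C₂' D₂' A' B' : Type} [Finite C₁] [Finite D₁]
    [Finite C₂] [Finite D₂] [Finite A] [Finite B] [Finite C₁'] [Finite D₁']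
    [Finite C₂'] [Finite D₂'] [Finite A'] [Finite B'] (η : B ≃ A)
    (ρ₁ : C₁ ≃ C₁') (σ₁ : D₁ ≃ D₁') (β : B ≃ B') (ρ₂ : C₂ ≃ C₂') (σ₂ : D₂ ≃ D₂') (α : A ≃ A')
    (x : V.E C₁ (D₁ ⊕ B)) (y : V.E (C₂ ⊕ A) D₂) :
    V.homAct (Equiv.sumCongr ρ₁ ρ₂) (Equiv.sumCongr σ₁ σ₂) (V.homComp η x y) =
      V.homComp ((β.symm.trans η).trans α) (V.homAct ρ₁ (Equiv.sumCongr σ₁ β) x)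
        (V.homAct (Equiv.sumCongr ρ₂ α) σ₂ y) := by
  simp only [homAct_eq, homComp_eq, locate_comp, locate_relabMap,
    relabMap_comp_locate, relabMap_comp_locate_assoc, LinearMap.comp_assoc, locate_comp_relabMap]
  refine V.locate_comp_congr x y ρ₂ σ₁ ?_ ?_ ?_
  · rintro (s | s) <;> rfl
  · rintro ((s | s) | s) <;> simp [middleEquiv]
  · intro s
    obtain ⟨s, rfl⟩ := (Equiv.sumCongr σ₁ σ₂).surjective s
    rcases s with s | s <;> simp

theorem homComp_assoc {C₁ D₁ C₂ D₂ C₃ D₃ A₁ B₁ A₂ B₂ A₃ B₃ : Type} [Finite C₁] [Finite D₁]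
    [Finite C₂] [Finite D₂] [Finite C₃] [Finite D₃] [Finite A₁] [Finite B₁] [Finite A₂]
    [Finite B₂] [Finite A₃] [Finite B₃] (η₁ : B₁ ≃ A₁) (η₂ : B₂ ≃ A₂)
    (η₃ : B₃ ≃ A₃) (x : V.E C₁ ((D₁ ⊕ B₃) ⊕ B₁)) (y : V.E (C₂ ⊕ A₁) (D₂ ⊕ B₂))
    (z : V.E (C₃ ⊕ (A₃ ⊕ A₂)) D₃) :
    V.homAct (Equiv.sumAssoc C₁ C₂ C₃) (Equiv.sumAssoc D₁ D₂ D₃)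
      (V.homComp (Equiv.sumCongr η₃ η₂)
        (V.homAct (Equiv.refl _) (Equiv.sumSumSumComm D₁ B₃ D₂ B₂) (V.homComp η₁ x y)) z) =
      V.homComp (Equiv.sumCongr η₁ η₃) (V.homAct (Equiv.refl _) (assocSwap D₁ B₃ B₁) x)
        (V.homAct (Equiv.sumSumSumComm C₂ A₁ C₃ A₃) (Equiv.refl _)
          (V.homComp η₂ y (V.homAct (Equiv.sumAssoc C₃ A₃ A₂).symm (Equiv.refl _) z))) := by
  simp only [homAct_eq, homComp_eq, locate_comp, locate_locate, locate_relabMap,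
    relabMap_comp_locate, relabMap_comp_locate_assoc, LinearMap.comp_assoc, locate_comp_relabMap]
  refine V.locate_comp_comp_congr x y z (Equiv.refl _)
    ((Equiv.sumComm _ _).trans ((Equiv.sumCongr (Equiv.refl C₃) ((Equiv.sumComm D₁ B₃).trans
      (Equiv.sumCongr η₃ (Equiv.refl D₁)))).trans (Equiv.sumAssoc C₃ A₃ D₁).symm))
    (Equiv.sumComm D₁ D₂) ?_ ?_ ?_ ?_
  · rintro (s | s | s) <;> rfl
  · rintro ((s | s) | (s | s) | s) <;> simp [middleEquiv, assocSwap]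
  · rintro ((s | s | s) | s | s) <;> simp [middleEquiv]
  · rintro (s | s | s) <;> rfl

theorem homComp_par_out {C₁ D₁ C₂ D₂ C₃ D₃ A B A' B' : Type} [Finite C₁] [Finite D₁] [Finite C₂]
    [Finite D₂] [Finite C₃] [Finite D₃] [Finite A] [Finite B] [Finite A'] [Finite B']
    (η : B ≃ A) (η' : B' ≃ A') {i j : ℤ} {x : V.E C₁ (D₁ ⊕ B)}
    {y : V.E C₂ (D₂ ⊕ B')} (z : V.E ((C₃ ⊕ A) ⊕ A') D₃) (hx : x ∈ V.homDeg _ _ i)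
    (hy : y ∈ V.homDeg _ _ j) :
    V.homComp η x (V.homAct (Equiv.sumAssoc C₂ C₃ A).symm (Equiv.refl _) (V.homComp η' y z)) =
      sgn k (i * j) • V.homAct (swapL C₂ C₁ C₃) (swapL D₂ D₁ D₃)
        (V.homComp η' y (V.homAct (Equiv.sumAssoc C₁ C₃ A').symm (Equiv.refl _)
          (V.homComp η x (V.homAct (swapR C₃ A A') (Equiv.refl _) z)))) := by
  simp only [homAct_eq, homComp_eq, locate_comp, locate_locate, locate_relabMap,
    relabMap_comp_locate, relabMap_comp_locate_assoc, LinearMap.comp_assoc, locate_comp_relabMap]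
  refine V.locate_interchange_comp (Z := C₃) z hx hy (Equiv.refl (C₂ ⊕ C₃))
    (((Equiv.sumCongr ((Equiv.sumCongr (Equiv.refl D₁) η).trans (Equiv.sumComm D₁ A))
      (Equiv.refl C₃)).trans (swapR A D₁ C₃)).trans
        (Equiv.sumCongr (Equiv.sumComm A C₃) (Equiv.refl D₁))) (Equiv.refl (C₁ ⊕ C₃))
    (((Equiv.sumCongr ((Equiv.sumCongr (Equiv.refl D₂) η').trans (Equiv.sumComm D₂ A'))
      (Equiv.refl C₃)).trans (swapR A' D₂ C₃)).trans
        (Equiv.sumCongr (Equiv.sumComm A' C₃) (Equiv.refl D₂)))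
    (Equiv.sumComm D₂ D₁) ?_ ?_ ?_ ?_ ?_
  · rintro (s | (s | s) | s) <;> simp [middleEquiv, pullSecond, swapR]
  · rintro (s | (s | s) | s) <;> simp [middleEquiv, pullSecond, swapR]
  · rintro ((s | s) | s) <;> rfl
  · rintro (((s | s) | s) | s | s) <;> simp [middleEquiv, pullSecond, swapR]
  · rintro (s | s | s) <;> rfl

theorem homComp_par_in {C₁ D₁ C₂ D₂ C₃ D₃ A B A' B' : Type} [Finite C₁] [Finite D₁] [Finite C₂]
    [Finite D₂] [Finite C₃] [Finite D₃] [Finite A] [Finite B] [Finite A'] [Finite B']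
    (η : B ≃ A) (η' : B' ≃ A') {i j : ℤ} (x : V.E C₁ ((D₁ ⊕ B) ⊕ B')) {y : V.E (C₂ ⊕ A) D₂}
    {z : V.E (C₃ ⊕ A') D₃} (hy : y ∈ V.homDeg _ _ i) (hz : z ∈ V.homDeg _ _ j) :
    V.homComp η (V.homAct (Equiv.refl _) (swapR D₁ B D₃) (V.homComp η' x z)) y =
      sgn k (i * j) • V.homAct (swapR C₁ C₂ C₃) (swapR D₁ D₂ D₃)
        (V.homComp η' (V.homAct (Equiv.refl _) (swapR D₁ B' D₂)
          (V.homComp η (V.homAct (Equiv.refl _) (swapR D₁ B B') x) y)) z) := by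
  simp only [homAct_eq, homComp_eq, locate_comp, locate_locate, locate_relabMap,
    relabMap_comp_locate, relabMap_comp_locate_assoc, LinearMap.comp_assoc, locate_comp_relabMap]
  rw [mul_comm i j]
  refine V.comp_locate_interchange (Z := D₁) x hz hy
    (((Equiv.sumCongr (Equiv.sumCongr (Equiv.refl C₂) η.symm) (Equiv.refl D₁)).trans
      ((Equiv.sumAssoc C₂ B D₁).trans ((Equiv.sumComm C₂ (B ⊕ D₁)).trans
        (Equiv.sumCongr (Equiv.sumComm B D₁) (Equiv.refl C₂))))))
    (Equiv.sumComm D₃ D₁)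
    (((Equiv.sumCongr (Equiv.sumCongr (Equiv.refl C₃) η'.symm) (Equiv.refl D₁)).trans
      ((Equiv.sumAssoc C₃ B' D₁).trans ((Equiv.sumComm C₃ (B' ⊕ D₁)).trans
        (Equiv.sumCongr (Equiv.sumComm B' D₁) (Equiv.refl C₃))))))
    (Equiv.sumComm D₂ D₁)
    (Equiv.sumComm C₃ C₂) ?_ ?_ ?_ ?_ ?_
  · rintro ((s | s) | s | s) <;> rfl
  · rintro ((s | s) | s | s) <;> rfl
  · rintro ((s | s) | s) <;> rfl
  · rintro (((s | s) | s | s) | s) <;> rfl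
  · rintro (s | s | s) <;> rfl

end DGVect

/-! ### Degrees and differentials of operations -/

namespace DGVect

variable {k : Type w} [Field k] (V : DGVect.{w, v} k)

theorem homComp_mem_homDeg {C₁ D₁ C₂ D₂ A B : Type} [Finite C₁] [Finite D₁] [Finite C₂] [Finite D₂]
    [Finite A] [Finite B] (η : B ≃ A) {i j : ℤ} {g : V.E C₁ (D₁ ⊕ B)} {f : V.E (C₂ ⊕ A) D₂}
    (hg : g ∈ V.homDeg _ _ i) (hf : f ∈ V.homDeg _ _ j) :
    V.homComp η g f ∈ V.homDeg _ _ (i + j) := by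
  rw [homComp_eq]
  exact V.comp_mem_homDeg (V.locate_mem_homDeg _ _ hg) (V.locate_mem_homDeg _ _ hf)

theorem homD_homComp {C₁ D₁ C₂ D₂ A B : Type} [Finite C₁] [Finite D₁] [Finite C₂] [Finite D₂]
    [Finite A] [Finite B] (η : B ≃ A) {i : ℤ} {g : V.E C₁ (D₁ ⊕ B)} (f : V.E (C₂ ⊕ A) D₂)
    (hg : g ∈ V.homDeg _ _ i) : V.homD _ _ (V.homComp η g f) =
      V.homComp η (V.homD _ _ g) f + sgn k i • V.homComp η g (V.homD _ _ f) := by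
  rw [← LinearMap.smul_apply, ← map_smul, ← V.homParity_of_mem hg]
  simp only [homComp_eq, homD_comp, homD_locate, homParity_locate]

end DGVect

/-! ### Extension of equivariant maps from the generators to the free properad -/

section Extension

variable {k : Type w} [Field k] {P : Properad.{w, u} k}

namespace Properad.StableGrading

/-- An equivariant family of degree zero maps from the generators `↑ξ` of the free properad to the
endomorphism properad of `V`. -/
structure GenMap (𝒢 : P.StableGrading) (V : DGVect.{w, v} k) where
  toFun : ∀ (C D : Type) [Finite C] [Finite D] (G : ℕ) (i : ℤ), 𝒢.DualPart C D G i →ₗ[k] V.E C D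
  map_act : ∀ {C D C' D' : Type} [Finite C] [Finite D] [Finite C'] [Finite D'] (ρ : C ≃ C')
    (σ : D ≃ D') (G : ℕ) (i : ℤ) (ξ : 𝒢.DualPart C D G i),
    V.homAct ρ σ (toFun C D G i ξ) = toFun C' D' G i (𝒢.dualAct ρ σ G i ξ)
  map_deg : ∀ {C D : Type} [Finite C] [Finite D] (G : ℕ) (i : ℤ) (ξ : 𝒢.DualPart C D G i),
    toFun C D G i ξ ∈ V.homDeg C D (1 - i)

variable {𝒢 : P.StableGrading} {V : DGVect.{w, v} k} (γ : 𝒢.GenMap V)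

/-- The value of a formal composite. -/
def evalMon : {C D : Type} → 𝒢.Mon C D → [Finite C] → [Finite D] → V.E C D
  | _, _, @Mon.gen _ _ _ _ C D _ _ G i ξ, _, _ => γ.toFun C D G i ξ
  | _, _, @Mon.act _ _ _ _ _ _ _ _ _ _ _ _ ρ σ a, _, _ => V.homAct ρ σ (evalMon a)
  | _, _, @Mon.comp _ _ _ _ _ _ _ _ _ _ _ _ _ _ _ _ _ η a b, _, _ =>
      V.homComp η (evalMon a) (evalMon b)

/-- The value of a linear combination of formal composites. -/
def evalLin (C D : Type) [Finite C] [Finite D] : 𝒢.Lin C D →ₗ[k] V.E C D :=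
  Finsupp.linearCombination k (fun a => evalMon γ a)

theorem evalLin_lin {C D : Type} [Finite C] [Finite D] (a : 𝒢.Mon C D) :
    evalLin γ C D a.lin = evalMon γ a := by
  simp [evalLin, Mon.lin]

theorem evalMon_mem {C D : Type} (a : 𝒢.Mon C D) :
    ∀ [Finite C] [Finite D], evalMon γ a ∈ V.homDeg C D a.deg := by
  induction a with
  | gen G i ξ => intro _ _; exact γ.map_deg G i ξ
  | act ρ σ a ih => intro _ _; exact V.homAct_mem_homDeg ρ σ ih
  | comp η a b iha ihb => intro _ _; exact V.homComp_mem_homDeg η iha ihb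

theorem evalLin_linAct {C D C' D' : Type} [Finite C] [Finite D] [Finite C'] [Finite D'] (ρ : C ≃ C')
    (σ : D ≃ D') (x : 𝒢.Lin C D) :
    evalLin γ C' D' (linAct ρ σ x) = V.homAct ρ σ (evalLin γ C D x) := by
  induction x using lin_ind with
  | h a => rw [linAct_lin, evalLin_lin, evalLin_lin, evalMon]
  | h0 => simp only [map_zero]
  | hadd x y hx hy => simp only [map_add, hx, hy]
  | hsmul c x hx => simp only [map_smul, hx]

theorem evalLin_linComp {C₁ D₁ C₂ D₂ A B : Type} [Finite C₁] [Finite D₁] [Finite C₂] [Finite D₂]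
    [Finite A] [Finite B] [Nonempty B] (η : B ≃ A) (x : 𝒢.Lin C₁ (D₁ ⊕ B))
    (y : 𝒢.Lin (C₂ ⊕ A) D₂) :
    evalLin γ _ _ (linComp η x y) = V.homComp η (evalLin γ _ _ x) (evalLin γ _ _ y) := by
  induction x using lin_ind with
  | h a =>
    induction y using lin_ind with
    | h b => rw [linComp_lin, evalLin_lin, evalLin_lin, evalLin_lin, evalMon]
    | h0 => simp only [map_zero]
    | hadd x y hx hy => simp only [map_add, hx, hy]
    | hsmul c x hx => simp only [map_smul, hx]
  | h0 => simp only [map_zero, LinearMap.zero_apply]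
  | hadd x y hx hy => simp only [map_add, LinearMap.add_apply, hx, hy]
  | hsmul c x hx => simp only [map_smul, LinearMap.smul_apply, hx]

/-- The relations of the free properad hold in the endomorphism properad. -/
theorem evalLin_rel {C D : Type} {x : 𝒢.Lin C D} (hx : Rel x) :
    ∀ [Finite C] [Finite D], evalLin γ C D x = 0 := by
  induction hx with
  | zero =>
    intro _ _
    rw [map_zero]
  | add _ _ hx hy =>
    intro _ _
    rw [map_add, hx, hy, add_zero]
  | smul c _ hx =>
    intro _ _
    rw [map_smul, hx, smul_zero]
  | act ρ σ _ hx =>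
    intro _ _
    rw [evalLin_linAct, hx, map_zero]
  | comp_left η y _ hx =>
    intro _ _
    rw [evalLin_linComp, hx, map_zero, LinearMap.zero_apply]
  | comp_right η x _ hy =>
    intro _ _
    rw [evalLin_linComp, hy, map_zero]
  | gen_add G i ξ ζ =>
    intro _ _
    rw [map_sub, map_add, evalLin_lin, evalLin_lin, evalLin_lin, sub_eq_zero]
    exact map_add _ _ _
  | gen_smul G i c ξ =>
    intro _ _
    rw [map_sub, map_smul, evalLin_lin, evalLin_lin, sub_eq_zero]
    exact map_smul _ _ _
  | gen_act ρ σ G i ξ =>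
    intro _ _
    rw [map_sub, evalLin_lin, evalLin_lin, sub_eq_zero]
    exact γ.map_act ρ σ G i ξ
  | act_refl a =>
    intro _ _
    rw [map_sub, evalLin_lin, evalLin_lin, sub_eq_zero]
    exact V.homAct_refl _
  | act_act ρ σ ρ' σ' a =>
    intro _ _
    rw [map_sub, evalLin_lin, evalLin_lin, sub_eq_zero]
    exact V.homAct_homAct ρ σ ρ' σ' _
  | act_comp η ρ₁ σ₁ β ρ₂ σ₂ α a b =>
    intro _ _
    rw [map_sub, evalLin_lin, evalLin_lin, sub_eq_zero]
    exact V.homAct_homComp η ρ₁ σ₁ β ρ₂ σ₂ α _ _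
  | assoc η₁ η₂ η₃ a b c =>
    intro _ _
    rw [map_sub, evalLin_lin, evalLin_lin, sub_eq_zero]
    exact V.homComp_assoc η₁ η₂ η₃ _ _ _
  | par_out η η' a b c =>
    intro _ _
    rw [map_sub, map_smul, evalLin_lin, evalLin_lin, sub_eq_zero]
    exact V.homComp_par_out η η' _ (evalMon_mem γ a) (evalMon_mem γ b)
  | par_in η η' a b c =>
    intro _ _
    rw [map_sub, map_smul, evalLin_lin, evalLin_lin, sub_eq_zero]
    exact V.homComp_par_in η η' _ (evalMon_mem γ b) (evalMon_mem γ c)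

/-- The extension of a map from the generators to the free properad. -/
def evalFree (γ : 𝒢.GenMap V) (C D : Type) [Finite C] [Finite D] : 𝒢.Free C D →ₗ[k] V.E C D :=
  Submodule.liftQ (M₂ := V.E C D) (τ₁₂ := RingHom.id k) (𝒢.relSub C D) (evalLin γ C D)
    (fun _ hx => LinearMap.mem_ker.2 (evalLin_rel γ hx))

theorem evalFree_cls {C D : Type} [Finite C] [Finite D] (x : 𝒢.Lin C D) :
    evalFree γ C D (𝒢.cls C D x) = evalLin γ C D x := rfl

theorem evalFree_incl {C D : Type} [Finite C] [Finite D] (G : ℕ) (i : ℤ)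
    (ξ : 𝒢.DualPart C D G i) : evalFree γ C D (𝒢.incl C D G i ξ) = γ.toFun C D G i ξ := by
  change evalFree γ C D (𝒢.cls C D (Mon.gen G i ξ).lin) = _
  rw [evalFree_cls, evalLin_lin]
  rfl

theorem evalFree_freeAct {C D C' D' : Type} [Finite C] [Finite D] [Finite C'] [Finite D']
    (ρ : C ≃ C') (σ : D ≃ D') (x : 𝒢.Free C D) :
    evalFree γ C' D' (freeAct ρ σ x) = V.homAct ρ σ (evalFree γ C D x) := by
  obtain ⟨x, rfl⟩ := Submodule.Quotient.mk_surjective _ x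
  exact evalLin_linAct γ ρ σ x

theorem evalFree_freeComp {C₁ D₁ C₂ D₂ A B : Type} [Finite C₁] [Finite D₁] [Finite C₂] [Finite D₂]
    [Finite A] [Finite B] [Nonempty B] (η : B ≃ A) (x : 𝒢.Free C₁ (D₁ ⊕ B))
    (y : 𝒢.Free (C₂ ⊕ A) D₂) :
    evalFree γ _ _ (freeComp η x y) = V.homComp η (evalFree γ _ _ x) (evalFree γ _ _ y) := by
  obtain ⟨x, rfl⟩ := Submodule.Quotient.mk_surjective _ x
  obtain ⟨y, rfl⟩ := Submodule.Quotient.mk_surjective _ y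
  exact evalLin_linComp γ η x y

theorem evalFree_mem {C D : Type} [Finite C] [Finite D] {i : ℤ} {x : 𝒢.Free C D}
    (hx : x ∈ freeDeg C D i) : evalFree γ C D x ∈ V.homDeg C D i := by
  induction x, hx using freeDeg_ind with
  | h a ha =>
    rw [evalFree_cls, evalLin_lin, ← ha]
    exact evalMon_mem γ a
  | h0 => rw [map_zero]; exact zero_mem _
  | hadd x y _ _ hx hy => rw [map_add]; exact add_mem hx hy
  | hsmul c x _ hx => rw [map_smul]; exact Submodule.smul_mem _ _ hx

/-- By the Leibniz rule on both sides, compatibility with the differentials need only be checked on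
generators. -/
theorem evalFree_freeD
    (h : ∀ {C D : Type} [Finite C] [Finite D] (G : ℕ) (i : ℤ) (ξ : 𝒢.DualPart C D G i),
      evalFree γ C D (𝒢.incl C D G (i - 1) (𝒢.dualD C D G i ξ) + 𝒢.quad C D G i ξ) =
        V.homD C D (γ.toFun C D G i ξ))
    {C D : Type} [Finite C] [Finite D] (x : 𝒢.Free C D) :
    evalFree γ C D (𝒢.freeD C D x) = V.homD C D (evalFree γ C D x) := by
  have key : ∀ {C D : Type} (a : 𝒢.Mon C D) [Finite C] [Finite D],
      evalFree γ C D (𝒢.dMon a) = V.homD C D (evalMon γ a) := by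
    intro C D a
    induction a with
    | gen G i ξ => intro _ _; exact h G i ξ
    | act ρ σ a ih =>
      intro _ _
      rw [dMon, evalFree_freeAct, ih, evalMon, V.homD_homAct]
    | comp η a b iha ihb =>
      intro _ _
      rw [dMon, map_add, map_smul, evalFree_freeComp, evalFree_freeComp, iha, ihb, evalFree_cls,
        evalFree_cls, evalLin_lin, evalLin_lin, evalMon,
        V.homD_homComp η _ (evalMon_mem γ a)]
  induction x using free_ind with
  | h a =>
    rw [evalFree_cls, evalLin_lin, ← key]
    change evalFree γ C D (𝒢.dLin C D a.lin) = _
    rw [dLin_lin]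
  | h0 => simp only [map_zero]
  | hadd x y hx hy => simp only [map_add, hx, hy]
  | hsmul c x hx => simp only [map_smul, hx]

end Properad.StableGrading

end Extension

/-! ### Contraction of `P ⊗ End` with functionals on `P` -/

section Contraction

variable {k : Type w} [Field k] {P : Properad.{w, u} k}

/-- If `Γ` evaluates its two arguments at `x` and at `y`, then `dualContract Γ` is evaluation at
`x ⊗ y`, with the same factor `z`. -/
theorem dualContract_eval {X : Type u} {Y : Type u'} {W : Type v} [AddCommGroup X] [Module k X]
    [AddCommGroup Y] [Module k Y] [AddCommGroup W] [Module k W] [Module.Finite k X]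
    [Module.Finite k Y] (Γ : Module.Dual k X →ₗ[k] Module.Dual k Y →ₗ[k] W) (x : X) (y : Y) (z : W)
    (h : ∀ ζ θ, Γ ζ θ = (ζ x * θ y) • z) (b : Module.Dual k (X ⊗[k] Y)) :
    dualContract Γ b = b (x ⊗ₜ y) • z := by
  obtain ⟨t, rfl⟩ := (TensorProduct.dualDistribEquiv k X Y).surjective b
  simp only [dualContract, LinearMap.comp_apply, LinearEquiv.coe_coe, LinearEquiv.symm_apply_apply]
  induction t using TensorProduct.induction_on with
  | zero => simp
  | tmul ζ θ => rw [TensorProduct.lift.tmul, h]; rfl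
  | add s t hs ht => rw [map_add, map_add, LinearMap.add_apply, add_smul, hs, ht]

namespace Properad.StableGrading

variable (𝒢 : P.StableGrading) (V : DGVect.{w, v} k)

/-- The subspace `P(C, D, G) ⊗ Hom(⊙_D V, ⊙_C V)`. -/
def total (C D : Type) [Finite C] [Finite D] (G : ℕ) : Submodule k (𝒢.PE V C D) :=
  LinearMap.range (TensorProduct.map (⨆ i, 𝒢.bi C D G i : Submodule k (P.obj C D)).subtype
    (LinearMap.id : V.E C D →ₗ[k] _))

/-- The part of degree `1` of `P(C, D, G) ⊗ Hom(⊙_D V, ⊙_C V)`. -/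
def totalOne (C D : Type) [Finite C] [Finite D] (G : ℕ) : Submodule k (𝒢.PE V C D) :=
  Submodule.span k {t : 𝒢.PE V C D | ∃ (j : ℤ) (p : P.obj C D) (f : V.E C D),
    p ∈ 𝒢.bi C D G j ∧ f ∈ V.homDeg C D (1 - j) ∧ t = p ⊗ₜ[k] f}

variable {𝒢 V}

section

variable {C D C' D' : Type} [Finite C] [Finite D] [Finite C'] [Finite D'] {G : ℕ}

theorem tmul_mem_total {i : ℤ} {p : P.obj C D} (hp : p ∈ 𝒢.bi C D G i) (f : V.E C D) :
    p ⊗ₜ[k] f ∈ 𝒢.total V C D G :=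
  ⟨⟨p, le_iSup (fun i => 𝒢.bi C D G i) i hp⟩ ⊗ₜ f, rfl⟩

theorem total_ind {q : 𝒢.PE V C D → Prop} (h0 : q 0) (hadd : ∀ x y, q x → q y → q (x + y))
    (h : ∀ i, ∀ p ∈ 𝒢.bi C D G i, ∀ f : V.E C D, q (p ⊗ₜ f)) {X : 𝒢.PE V C D}
    (hX : X ∈ 𝒢.total V C D G) : q X := by
  obtain ⟨t, rfl⟩ := hX
  induction t using TensorProduct.induction_on with
  | zero => rwa [map_zero]
  | add x y hx hy => rw [map_add]; exact hadd _ _ hx hy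
  | tmul p f =>
    rw [TensorProduct.map_tmul]
    obtain ⟨p, hp⟩ := p
    change q (p ⊗ₜ f)
    induction hp using Submodule.iSup_induction' with
    | mem i p hp => exact h i p hp f
    | zero => rwa [TensorProduct.zero_tmul]
    | add x y _ _ hx hy => rw [TensorProduct.add_tmul]; exact hadd _ _ hx hy

theorem totalOne_ind {q : 𝒢.PE V C D → Prop} (h0 : q 0) (hadd : ∀ x y, q x → q y → q (x + y))
    (h : ∀ i, ∀ p ∈ 𝒢.bi C D G i, ∀ f ∈ V.homDeg C D (1 - i), q (p ⊗ₜ f)) {X : 𝒢.PE V C D}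
    (hX : X ∈ 𝒢.totalOne V C D G) : q X := by
  rw [totalOne] at hX
  induction hX using Submodule.closure_induction with
  | zero => exact h0
  | add x y _ _ hx hy => exact hadd x y hx hy
  | smul_mem c x hx =>
    obtain ⟨i, p, f, hp, hf, rfl⟩ := hx
    rw [TensorProduct.smul_tmul']
    exact h i _ (Submodule.smul_mem _ c hp) f hf

theorem peAct_mem_total (ρ : C ≃ C') (σ : D ≃ D') {X : 𝒢.PE V C D} (hX : X ∈ 𝒢.total V C D G) :
    𝒢.peAct V ρ σ X ∈ 𝒢.total V C' D' G :=
  total_ind (q := fun X => 𝒢.peAct V ρ σ X ∈ 𝒢.total V C' D' G)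
    (by rw [map_zero]; exact zero_mem _)
    (fun _ _ hx hy => by rw [map_add]; exact add_mem hx hy)
    (fun _ _ hp _ => tmul_mem_total (𝒢.act_mem ρ σ hp) _) hX

theorem peAct_mem_totalOne (ρ : C ≃ C') (σ : D ≃ D') {X : 𝒢.PE V C D}
    (hX : X ∈ 𝒢.totalOne V C D G) : 𝒢.peAct V ρ σ X ∈ 𝒢.totalOne V C' D' G :=
  totalOne_ind (q := fun X => 𝒢.peAct V ρ σ X ∈ 𝒢.totalOne V C' D' G)
    (by rw [map_zero]; exact zero_mem _)
    (fun _ _ hx hy => by rw [map_add]; exact add_mem hx hy)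
    (fun i _ hp _ hf => Submodule.subset_span
      ⟨i, _, _, 𝒢.act_mem ρ σ hp, V.homAct_mem_homDeg ρ σ hf, rfl⟩) hX

theorem peAct_refl (X : 𝒢.PE V C D) : 𝒢.peAct V (Equiv.refl C) (Equiv.refl D) X = X := by
  induction X using TensorProduct.induction_on with
  | zero => rw [map_zero]
  | add x y hx hy => rw [map_add, hx, hy]
  | tmul p f =>
    rw [peAct, TensorProduct.map_tmul, P.act_refl, V.homAct_refl]

theorem peAct_peAct {C'' D'' : Type} [Finite C''] [Finite D''] (ρ : C ≃ C') (σ : D ≃ D')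
    (ρ' : C' ≃ C'') (σ' : D' ≃ D'') (X : 𝒢.PE V C D) :
    𝒢.peAct V ρ' σ' (𝒢.peAct V ρ σ X) = 𝒢.peAct V (ρ.trans ρ') (σ.trans σ') X := by
  induction X using TensorProduct.induction_on with
  | zero => simp only [map_zero]
  | add x y hx hy => simp only [map_add, hx, hy]
  | tmul p f =>
    simp only [peAct, TensorProduct.map_tmul, P.act_act, V.homAct_homAct]

theorem contract_tmul (i : ℤ) (ξ : 𝒢.DualPart C D G i) (p : P.obj C D) (f : V.E C D) :
    𝒢.contract V C D G i ξ (p ⊗ₜ f) = ξ (𝒢.pr C D G i p) • f := rfl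

variable (𝒢 V) in
/-- The contraction of a fixed element, as a linear function of the functional. -/
def contractLeft (C D : Type) [Finite C] [Finite D] (G : ℕ) (i : ℤ) :
    𝒢.PE V C D →ₗ[k] 𝒢.DualPart C D G i →ₗ[k] V.E C D :=
  LinearMap.flip
    { toFun := fun ξ => 𝒢.contract V C D G i ξ
      map_add' := fun ξ ζ => TensorProduct.ext' fun p f => by
        simp only [contract_tmul, LinearMap.add_apply, add_smul]
      map_smul' := fun c ξ => TensorProduct.ext' fun p f => by
        simp only [contract_tmul, LinearMap.smul_apply, RingHom.id_apply, smul_eq_mul, mul_smul] }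

theorem contractLeft_apply (i : ℤ) (X : 𝒢.PE V C D) (ξ : 𝒢.DualPart C D G i) :
    𝒢.contractLeft V C D G i X ξ = 𝒢.contract V C D G i ξ X := rfl

theorem contract_peAct (ρ : C ≃ C') (σ : D ≃ D') (i : ℤ) (ξ : 𝒢.DualPart C D G i)
    (X : 𝒢.PE V C D) : 𝒢.contract V C' D' G i (𝒢.dualAct ρ σ G i ξ) (𝒢.peAct V ρ σ X) =
      V.homAct ρ σ (𝒢.contract V C D G i ξ X) := by
  induction X using TensorProduct.induction_on with
  | zero => simp only [map_zero]
  | add x y hx hy => simp only [map_add, hx, hy]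
  | tmul p f =>
    rw [peAct, TensorProduct.map_tmul, contract_tmul, contract_tmul, dualAct_apply, P.act_act,
      Equiv.self_trans_symm, Equiv.self_trans_symm, P.act_refl, map_smul]

theorem contract_mem_homDeg (i : ℤ) (ξ : 𝒢.DualPart C D G i) {X : 𝒢.PE V C D}
    (hX : X ∈ 𝒢.totalOne V C D G) : 𝒢.contract V C D G i ξ X ∈ V.homDeg C D (1 - i) := by
  refine totalOne_ind (q := fun X => 𝒢.contract V C D G i ξ X ∈ V.homDeg C D (1 - i))
    (by rw [map_zero]; exact zero_mem _)
    (fun _ _ hx hy => by rw [map_add]; exact add_mem hx hy) (fun j p hp f hf => ?_) hX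
  rw [contract_tmul]
  by_cases h : j = i
  · subst h
    exact Submodule.smul_mem _ _ hf
  · rw [pr_of_mem_ne hp (fun h' => h (Prod.mk.inj h').2), map_zero, zero_smul]
    exact zero_mem _

variable (𝒢) in
/-- As `P(C, D, G)` is finite dimensional, it is concentrated in finitely many degrees. -/
theorem finite_degrees (C D : Type) [Finite C] [Finite D] (G : ℕ) :
    {i | 𝒢.bi C D G i ≠ ⊥}.Finite := by
  have := 𝒢.finite C D G
  have hind : iSupIndep fun i => 𝒢.bi C D G i :=
    (𝒢.internal C D).submodule_iSupIndep.comp (f := fun i : ℤ => (G, i))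
      (fun i j h => (Prod.mk.inj h).2)
  set S : Submodule k (P.obj C D) := ⨆ i, 𝒢.bi C D G i with hS
  have h' : iSupIndep fun i => (𝒢.bi C D G i).comap S.subtype := by
    intro i
    refine Submodule.disjoint_def.2 fun x hx hx' => ?_
    have hle : (⨆ j, ⨆ _ : j ≠ i, (𝒢.bi C D G j).comap S.subtype) ≤
        (⨆ j, ⨆ _ : j ≠ i, 𝒢.bi C D G j).comap S.subtype :=
      iSup₂_le fun j hj => Submodule.comap_mono (le_iSup₂_of_le j hj le_rfl)
    exact Subtype.ext (Submodule.disjoint_def.1 (hind i) x hx (hle hx'))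
  refine (WellFoundedGT.finite_ne_bot_of_iSupIndep h').subset fun i hi h => hi ?_
  rw [Submodule.eq_bot_iff]
  intro x hx
  have hxS : x ∈ S := le_iSup (fun i => 𝒢.bi C D G i) i hx
  have h2 : (⟨x, hxS⟩ : S) ∈ (𝒢.bi C D G i).comap S.subtype := hx
  rw [h] at h2
  exact congrArg Subtype.val ((Submodule.mem_bot k).1 h2)

variable (𝒢) in
/-- The degrees in which `P(C, D, G)` does not vanish. -/
def degrees (C D : Type) [Finite C] [Finite D] (G : ℕ) : Finset ℤ :=
  (𝒢.finite_degrees C D G).toFinset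

theorem eq_zero_of_notMem_degrees {i : ℤ} (hi : i ∉ 𝒢.degrees C D G) {p : P.obj C D}
    (hp : p ∈ 𝒢.bi C D G i) : p = 0 := by
  rw [degrees, Set.Finite.mem_toFinset, Set.mem_ofPred_eq, not_not] at hi
  rwa [hi, Submodule.mem_bot] at hp

theorem dual_eq_zero_of_notMem_degrees {i : ℤ} (hi : i ∉ 𝒢.degrees C D G)
    (ξ : 𝒢.DualPart C D G i) : ξ = 0 :=
  LinearMap.ext fun x => by
    have hx : x = 0 := Subtype.ext (eq_zero_of_notMem_degrees hi x.2)
    rw [hx, map_zero, map_zero]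

/-- The element of `P(C, D, G) ⊗ Hom(⊙_D V, ⊙_C V)` with given contractions: `∑ pₐ ⊗ φ(pₐ^#)` for a
homogeneous basis `pₐ`. -/
def expand (φ : ∀ i : ℤ, 𝒢.DualPart C D G i →ₗ[k] V.E C D) : 𝒢.PE V C D :=
  haveI := fun i => 𝒢.bi_finite C D G i
  ∑ i ∈ 𝒢.degrees C D G, ∑ a, (Module.finBasis k (𝒢.bi C D G i) a : P.obj C D) ⊗ₜ[k]
    φ i ((Module.finBasis k (𝒢.bi C D G i)).coord a)

theorem expand_mem (φ : ∀ i : ℤ, 𝒢.DualPart C D G i →ₗ[k] V.E C D) :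
    expand φ ∈ 𝒢.total V C D G :=
  sum_mem fun _ _ => sum_mem fun _ _ => tmul_mem_total (Subtype.property _) _

theorem expand_mem_totalOne (φ : ∀ i : ℤ, 𝒢.DualPart C D G i →ₗ[k] V.E C D)
    (h : ∀ i ξ, φ i ξ ∈ V.homDeg C D (1 - i)) : expand φ ∈ 𝒢.totalOne V C D G :=
  sum_mem fun i _ => sum_mem fun _ _ =>
    Submodule.subset_span ⟨i, _, _, Subtype.property _, h i _, rfl⟩

theorem contract_expand (φ : ∀ i : ℤ, 𝒢.DualPart C D G i →ₗ[k] V.E C D) (i : ℤ)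
    (ξ : 𝒢.DualPart C D G i) : 𝒢.contract V C D G i ξ (expand φ) = φ i ξ := by
  have := fun i => 𝒢.bi_finite C D G i
  by_cases hi : i ∈ 𝒢.degrees C D G
  · rw [expand, map_sum, Finset.sum_eq_single_of_mem i hi]
    · simp only [map_sum, contract_tmul, pr_of_mem (Subtype.property _), Subtype.coe_eta,
        ← map_smul]
      rw [← map_sum]
      congr 1
      exact (Module.finBasis k (𝒢.bi C D G i)).sum_dual_apply_smul_coord ξ
    · intro j _ hj
      rw [map_sum]
      refine Finset.sum_eq_zero fun a _ => ?_
      rw [contract_tmul, pr_of_mem_ne (Subtype.property _) (fun h => hj (Prod.mk.inj h).2),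
        map_zero, zero_smul]
  · rw [dual_eq_zero_of_notMem_degrees hi ξ, map_zero, ← contractLeft_apply, map_zero]

theorem expand_contract {X : 𝒢.PE V C D} (hX : X ∈ 𝒢.total V C D G) :
    expand (fun i => 𝒢.contractLeft V C D G i X) = X := by
  have := fun i => 𝒢.bi_finite C D G i
  refine total_ind (q := fun X => expand (fun i => 𝒢.contractLeft V C D G i X) = X) ?_ ?_ ?_ hX
  · simp only [expand, map_zero, LinearMap.zero_apply, TensorProduct.tmul_zero,
      Finset.sum_const_zero]
  · intro x y hx hy
    simp only [expand] at hx hy ⊢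
    simp only [map_add, LinearMap.add_apply, TensorProduct.tmul_add, Finset.sum_add_distrib, hx, hy]
  · intro i p hp f
    simp only [expand, contractLeft_apply, contract_tmul]
    by_cases hi : i ∈ 𝒢.degrees C D G
    · rw [Finset.sum_eq_single_of_mem i hi]
      · simp only [pr_of_mem hp, ← TensorProduct.smul_tmul, ← Submodule.coe_smul]
        rw [← TensorProduct.sum_tmul, ← Submodule.coe_sum]
        simp only [Module.Basis.coord_apply]
        rw [(Module.finBasis k (𝒢.bi C D G i)).sum_repr]
      · intro j _ hj
        refine Finset.sum_eq_zero fun a _ => ?_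
        rw [pr_of_mem_ne hp (fun h => hj (Prod.mk.inj h).2.symm), map_zero, zero_smul,
          TensorProduct.tmul_zero]
    · simp only [eq_zero_of_notMem_degrees hi hp, map_zero, zero_smul, TensorProduct.tmul_zero,
        TensorProduct.zero_tmul, Finset.sum_const_zero]

/-- An element of `P(C, D, G) ⊗ Hom(⊙_D V, ⊙_C V)` is determined by its contractions. -/
theorem total_ext {X Y : 𝒢.PE V C D} (hX : X ∈ 𝒢.total V C D G) (hY : Y ∈ 𝒢.total V C D G)
    (h : ∀ i ξ, 𝒢.contract V C D G i ξ X = 𝒢.contract V C D G i ξ Y) : X = Y := by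
  rw [← expand_contract hX, ← expand_contract hY]
  congr 1
  funext i
  exact LinearMap.ext (h i)

end

end Properad.StableGrading

end Contraction

/-! ### Contraction of the composition in `P ⊗ End` -/

section Composition

variable {k : Type w} [Field k] {P : Properad.{w, u} k}

theorem dualContract_zero_left {X : Type u} {Y : Type u'} {W : Type v} [AddCommGroup X]
    [Module k X] [AddCommGroup Y] [Module k Y] [AddCommGroup W] [Module k W] [Module.Finite k X]
    [Module.Finite k Y] (b : Module.Dual k (X ⊗[k] Y)) :
    dualContract (0 : Module.Dual k X →ₗ[k] Module.Dual k Y →ₗ[k] W) b = 0 := by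
  have h : TensorProduct.lift (0 : Module.Dual k X →ₗ[k] Module.Dual k Y →ₗ[k] W) = 0 :=
    TensorProduct.ext' fun _ _ => rfl
  rw [dualContract, h, LinearMap.zero_comp, LinearMap.zero_apply]

theorem dualContract_add_left {X : Type u} {Y : Type u'} {W : Type v} [AddCommGroup X]
    [Module k X] [AddCommGroup Y] [Module k Y] [AddCommGroup W] [Module k W] [Module.Finite k X]
    [Module.Finite k Y] (Γ Γ' : Module.Dual k X →ₗ[k] Module.Dual k Y →ₗ[k] W)
    (b : Module.Dual k (X ⊗[k] Y)) :
    dualContract (Γ + Γ') b = dualContract Γ b + dualContract Γ' b := by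
  have h : TensorProduct.lift (Γ + Γ') = TensorProduct.lift Γ + TensorProduct.lift Γ' :=
    TensorProduct.ext' fun _ _ => rfl
  rw [dualContract, h, LinearMap.add_comp, LinearMap.add_apply]
  rfl

theorem map_dualContract {X : Type u} {Y : Type u'} {W : Type*} {W' : Type*} [AddCommGroup X]
    [Module k X] [AddCommGroup Y] [Module k Y] [AddCommGroup W] [Module k W] [AddCommGroup W']
    [Module k W'] [Module.Finite k X] [Module.Finite k Y]
    (Γ : Module.Dual k X →ₗ[k] Module.Dual k Y →ₗ[k] W)
    (Γ' : Module.Dual k X →ₗ[k] Module.Dual k Y →ₗ[k] W')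
    (F : W →ₗ[k] W') (h : ∀ ζ θ, F (Γ ζ θ) = Γ' ζ θ) (b : Module.Dual k (X ⊗[k] Y)) :
    F (dualContract Γ b) = dualContract Γ' b := by
  have h' : F ∘ₗ TensorProduct.lift Γ = TensorProduct.lift Γ' :=
    TensorProduct.ext' fun ζ θ => h ζ θ
  rw [dualContract, dualContract, ← h', LinearMap.comp_assoc]
  rfl

namespace Properad.StableGrading

variable {𝒢 : P.StableGrading} {V : DGVect.{w, v} k}

theorem glue_tmul {C₁ D₁ C₂ D₂ A B : Type} [Finite C₁] [Finite D₁] [Finite C₂] [Finite D₂]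
    [Finite A] [Finite B] [Nonempty B] (η : B ≃ A) (G : ℕ) {G₂ : ℕ} {i j : ℤ}
    (p : P.obj C₁ (D₁ ⊕ B)) {f : V.E C₁ (D₁ ⊕ B)} {q : P.obj (C₂ ⊕ A) D₂}
    (g : V.E (C₂ ⊕ A) D₂) (hf : f ∈ V.homDeg _ _ (1 - i)) (hq : q ∈ 𝒢.bi _ _ G₂ j) :
    𝒢.glue V η G ((p ⊗ₜ f) ⊗ₜ (q ⊗ₜ g)) =
      (sgn k ((1 - i) * j) • 𝒢.prG _ _ G (P.comp η p q)) ⊗ₜ V.homComp η f g := by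
  have hq' := 𝒢.bi_le _ _ _ _ hq
  have key : 𝒢.middleFlip V C₁ (D₁ ⊕ B) (C₂ ⊕ A) D₂ ((p ⊗ₜ f) ⊗ₜ (q ⊗ₜ g)) =
      sgn k ((1 - i) * j) • ((p ⊗ₜ q) ⊗ₜ (f ⊗ₜ g)) := by
    simp only [middleFlip, LinearMap.comp_apply, LinearMap.add_apply, TensorProduct.map_tmul,
      LinearMap.id_apply, map_add, LinearEquiv.coe_coe, proj_of_mem _ _ hq',
      TensorProduct.tensorTensorTensorComm_tmul, V.homParity_of_mem hf]
    rcases Int.even_or_odd j with hj | hj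
    · rw [if_pos hj, if_neg (Int.not_odd_iff_even.2 hj), sgn_of_even (hj.mul_left _), one_smul]
      simp
    · have hs : sgn k ((1 - i) * j) = sgn k (1 - i) := by
        refine sgn_eq_of_even_sub ?_
        have : (1 - i) * j - (1 - i) = (1 - i) * (j - 1) := by ring
        rw [this]
        exact (hj.sub_odd odd_one).mul_left _
      rw [if_neg (Int.not_even_iff_odd.2 hj), if_pos hj, hs]
      simp only [TensorProduct.tmul_zero, TensorProduct.zero_tmul, zero_add,
        TensorProduct.tmul_smul, ← TensorProduct.smul_tmul']
  rw [glue, LinearMap.comp_apply, key, map_smul, TensorProduct.map_tmul, LinearMap.comp_apply,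
    TensorProduct.lift.tmul, TensorProduct.lift.tmul, TensorProduct.smul_tmul']

theorem pr_act_prG {C D C' D' : Type} [Finite C] [Finite D] [Finite C'] [Finite D'] (ρ : C ≃ C')
    (σ : D ≃ D') (G : ℕ) (i : ℤ) (x : P.obj C D) :
    𝒢.pr C' D' G i (P.act ρ σ (𝒢.prG C D G x)) = 𝒢.pr C' D' G i (P.act ρ σ x) := by
  induction x using 𝒢.bi_ind with
  | h G' i' x hx =>
    classical
    have h := proj_of_mem (𝒜 := fun p : ℕ × ℤ => 𝒢.bi C D p.1 p.2) (𝒢.internal C D)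
      (fun p => p.1 = G) (i := (G', i')) hx
    rw [prG, h]
    split_ifs with hG
    · rfl
    · rw [pr_of_mem_ne (𝒢.act_mem ρ σ hx) (fun h' => hG (Prod.mk.inj h').1), map_zero, map_zero]
  | hadd x y hx hy => simp only [map_add, hx, hy]

theorem prG_mem {C D : Type} [Finite C] [Finite D] (G : ℕ) (x : P.obj C D) (f : V.E C D) :
    𝒢.prG C D G x ⊗ₜ f ∈ 𝒢.total V C D G := by
  induction x using 𝒢.bi_ind with
  | h G' i' x hx =>
    classical
    have h := proj_of_mem (𝒜 := fun p : ℕ × ℤ => 𝒢.bi C D p.1 p.2) (𝒢.internal C D)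
      (fun p => p.1 = G) (i := (G', i')) hx
    rw [prG, h]
    split_ifs with hG
    · cases hG; exact tmul_mem_total hx f
    · rw [TensorProduct.zero_tmul]; exact zero_mem _
  | hadd x y hx hy => rw [map_add, TensorProduct.add_tmul]; exact add_mem hx hy

theorem glue_mem_total {C₁ D₁ C₂ D₂ A B : Type} [Finite C₁] [Finite D₁] [Finite C₂] [Finite D₂]
    [Finite A] [Finite B] [Nonempty B] (η : B ≃ A) (G : ℕ)
    (X : 𝒢.PE V C₁ (D₁ ⊕ B) ⊗[k] 𝒢.PE V (C₂ ⊕ A) D₂) : 𝒢.glue V η G X ∈ 𝒢.total V _ _ G := by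
  rw [glue, LinearMap.comp_apply]
  generalize 𝒢.middleFlip V C₁ (D₁ ⊕ B) (C₂ ⊕ A) D₂ X = t
  induction t using TensorProduct.induction_on with
  | zero => rw [map_zero]; exact zero_mem _
  | add x y hx hy => rw [map_add]; exact add_mem hx hy
  | tmul x f => exact prG_mem G _ _

section Term

variable {C₁ C₂ D₁ D₂ C D : Type} [Finite C₁] [Finite C₂] [Finite D₁] [Finite D₂] [Finite C]
  [Finite D] (e : C₁ ⊕ C₂ ≃ C) (f : D₁ ⊕ D₂ ≃ D) (n : ℕ) (G₁ G₂ : ℕ) (G : ℕ) (l : ℤ)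

variable (𝒢) in
/-- The transpose of the component of the operation of `P` in the indicated bidegrees. -/
def cocomp (i j : ℤ) : 𝒢.DualPart C D G l →ₗ[k] Module.Dual k
    (𝒢.bi C₁ (D₁ ⊕ Fin (n + 1)) G₁ i ⊗[k] 𝒢.bi (C₂ ⊕ Fin (n + 1)) D₂ G₂ j) :=
  (𝒢.pr C D G l ∘ₗ P.act e f ∘ₗ TensorProduct.lift
    ((P.comp (Equiv.refl (Fin (n + 1)))).compl₁₂
      (𝒢.bi C₁ (D₁ ⊕ Fin (n + 1)) G₁ i).subtype
      (𝒢.bi (C₂ ⊕ Fin (n + 1)) D₂ G₂ j).subtype)).lcomp k k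

/-- The bilinear map `(ζ, θ) ↦ ζ(X) ∘ θ(Y)` on functionals. -/
def contractPair (X : 𝒢.PE V C₁ (D₁ ⊕ Fin (n + 1))) (Y : 𝒢.PE V (C₂ ⊕ Fin (n + 1)) D₂) (i j : ℤ) :
    𝒢.DualPart C₁ (D₁ ⊕ Fin (n + 1)) G₁ i →ₗ[k] 𝒢.DualPart (C₂ ⊕ Fin (n + 1)) D₂ G₂ j →ₗ[k]
      V.E C D :=
  ((V.homComp (Equiv.refl (Fin (n + 1)))).compl₁₂
    (𝒢.contractLeft V C₁ (D₁ ⊕ Fin (n + 1)) G₁ i X)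
    (𝒢.contractLeft V (C₂ ⊕ Fin (n + 1)) D₂ G₂ j Y)).compr₂ (V.homAct e f)

/-- The contraction of `X` and `Y` with the dual of the operation, evaluated on `ξ`: the sum over
all degrees `i`, `j` of the two factors, with the sign of the differential of the cobar complex. -/
def contractSum (ξ : 𝒢.DualPart C D G l) (X : 𝒢.PE V C₁ (D₁ ⊕ Fin (n + 1)))
    (Y : 𝒢.PE V (C₂ ⊕ Fin (n + 1)) D₂) : V.E C D :=
  haveI := 𝒢.bi_finite C₁ (D₁ ⊕ Fin (n + 1)) G₁
  haveI := 𝒢.bi_finite (C₂ ⊕ Fin (n + 1)) D₂ G₂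
  ∑ i ∈ 𝒢.degrees C₁ (D₁ ⊕ Fin (n + 1)) G₁, ∑ j ∈ 𝒢.degrees (C₂ ⊕ Fin (n + 1)) D₂ G₂,
    sgn k (i * (1 + j)) •
      dualContract (contractPair e f n G₁ G₂ X Y i j) (𝒢.cocomp e f n G₁ G₂ G l i j ξ)

theorem contractSum_zero_left (ξ : 𝒢.DualPart C D G l) (Y : 𝒢.PE V (C₂ ⊕ Fin (n + 1)) D₂) :
    contractSum (C₁ := C₁) (D₁ := D₁) e f n G₁ G₂ G l ξ 0 Y = 0 := by
  have h : ∀ i j, contractPair (𝒢 := 𝒢) (C₁ := C₁) (D₁ := D₁) e f n G₁ G₂ 0 Y i j = 0 :=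
    fun i j => LinearMap.ext₂ fun ζ θ => by simp [contractPair]
  simp only [contractSum, h, dualContract_zero_left, smul_zero, Finset.sum_const_zero]

theorem contractSum_zero_right (ξ : 𝒢.DualPart C D G l) (X : 𝒢.PE V C₁ (D₁ ⊕ Fin (n + 1))) :
    contractSum (C₂ := C₂) (D₂ := D₂) e f n G₁ G₂ G l ξ X 0 = 0 := by
  have h : ∀ i j, contractPair (𝒢 := 𝒢) (C₂ := C₂) (D₂ := D₂) e f n G₁ G₂ X 0 i j = 0 :=
    fun i j => LinearMap.ext₂ fun ζ θ => by simp [contractPair]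
  simp only [contractSum, h, dualContract_zero_left, smul_zero, Finset.sum_const_zero]

theorem contractSum_add_left (ξ : 𝒢.DualPart C D G l) (X X' : 𝒢.PE V C₁ (D₁ ⊕ Fin (n + 1)))
    (Y : 𝒢.PE V (C₂ ⊕ Fin (n + 1)) D₂) : contractSum e f n G₁ G₂ G l ξ (X + X') Y =
      contractSum e f n G₁ G₂ G l ξ X Y + contractSum e f n G₁ G₂ G l ξ X' Y := by
  have h : ∀ i j, contractPair (𝒢 := 𝒢) e f n G₁ G₂ (X + X') Y i j =
      contractPair e f n G₁ G₂ X Y i j + contractPair e f n G₁ G₂ X' Y i j :=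
    fun i j => LinearMap.ext₂ fun ζ θ => by simp [contractPair]
  simp only [contractSum, h, dualContract_add_left, smul_add, Finset.sum_add_distrib]

theorem contractSum_add_right (ξ : 𝒢.DualPart C D G l) (X : 𝒢.PE V C₁ (D₁ ⊕ Fin (n + 1)))
    (Y Y' : 𝒢.PE V (C₂ ⊕ Fin (n + 1)) D₂) : contractSum e f n G₁ G₂ G l ξ X (Y + Y') =
      contractSum e f n G₁ G₂ G l ξ X Y + contractSum e f n G₁ G₂ G l ξ X Y' := by
  have h : ∀ i j, contractPair (𝒢 := 𝒢) e f n G₁ G₂ X (Y + Y') i j =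
      contractPair e f n G₁ G₂ X Y i j + contractPair e f n G₁ G₂ X Y' i j :=
    fun i j => LinearMap.ext₂ fun ζ θ => by simp [contractPair]
  simp only [contractSum, h, dualContract_add_left, smul_add, Finset.sum_add_distrib]

/-- On pure tensors only the term for the degrees of the two factors survives. -/
theorem contractSum_tmul (ξ : 𝒢.DualPart C D G l) {i₀ j₀ : ℤ} {p : P.obj C₁ (D₁ ⊕ Fin (n + 1))}
    {q : P.obj (C₂ ⊕ Fin (n + 1)) D₂} (hp : p ∈ 𝒢.bi _ _ G₁ i₀) (hq : q ∈ 𝒢.bi _ _ G₂ j₀)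
    (f₀ : V.E C₁ (D₁ ⊕ Fin (n + 1))) (g₀ : V.E (C₂ ⊕ Fin (n + 1)) D₂) :
    contractSum e f n G₁ G₂ G l ξ (p ⊗ₜ f₀) (q ⊗ₜ g₀) = (sgn k (i₀ * (1 + j₀)) *
      ξ (𝒢.pr C D G l (P.act e f (P.comp (Equiv.refl (Fin (n + 1))) p q)))) •
        V.homAct e f (V.homComp (Equiv.refl (Fin (n + 1))) f₀ g₀) := by
  have := 𝒢.bi_finite C₁ (D₁ ⊕ Fin (n + 1)) G₁
  have := 𝒢.bi_finite (C₂ ⊕ Fin (n + 1)) D₂ G₂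
  have key : ∀ i j, dualContract (contractPair e f n G₁ G₂ (p ⊗ₜ f₀) (q ⊗ₜ g₀) i j)
      (𝒢.cocomp e f n G₁ G₂ G l i j ξ) =
      ξ (𝒢.pr C D G l (P.act e f (P.comp (Equiv.refl (Fin (n + 1)))
        (𝒢.pr C₁ (D₁ ⊕ Fin (n + 1)) G₁ i p : P.obj _ _)
        (𝒢.pr (C₂ ⊕ Fin (n + 1)) D₂ G₂ j q : P.obj _ _)))) •
        V.homAct e f (V.homComp (Equiv.refl (Fin (n + 1))) f₀ g₀) := by
    intro i j
    refine (dualContract_eval _ (𝒢.pr C₁ (D₁ ⊕ Fin (n + 1)) G₁ i p)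
      (𝒢.pr (C₂ ⊕ Fin (n + 1)) D₂ G₂ j q) _ (fun ζ θ => ?_) _).trans rfl
    simp only [contractPair, LinearMap.compr₂_apply, LinearMap.compl₁₂_apply, contractLeft_apply,
      contract_tmul, map_smul, LinearMap.smul_apply, smul_smul, mul_comm]
  simp only [contractSum, key]
  rw [Finset.sum_eq_single i₀, Finset.sum_eq_single j₀]
  · rw [pr_of_mem hp, pr_of_mem hq, smul_smul]
  · intro j _ hj
    rw [pr_of_mem_ne hq (fun h => hj (Prod.mk.inj h).2.symm)]
    simp
  · intro hj
    simp [eq_zero_of_notMem_degrees hj hq]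
  · intro i _ hi
    refine Finset.sum_eq_zero fun j _ => ?_
    rw [pr_of_mem_ne hp (fun h => hi (Prod.mk.inj h).2.symm)]
    simp
  · intro hi
    refine Finset.sum_eq_zero fun j _ => ?_
    simp [eq_zero_of_notMem_degrees hi hp]

/-- Contracting a composite in `P ⊗ End` with `ξ` amounts to contracting its two factors with the
dual of the operation, evaluated on `ξ`, up to the sign `(-1)^|ξ|`. -/
theorem contract_glue (ξ : 𝒢.DualPart C D G l) {X : 𝒢.PE V C₁ (D₁ ⊕ Fin (n + 1))}
    {Y : 𝒢.PE V (C₂ ⊕ Fin (n + 1)) D₂} (hX : X ∈ 𝒢.totalOne V _ _ G₁)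
    (hY : Y ∈ 𝒢.totalOne V _ _ G₂) :
    𝒢.contract V C D G l ξ (𝒢.peAct V e f (𝒢.glue V (Equiv.refl (Fin (n + 1))) G (X ⊗ₜ Y))) =
      sgn k l • contractSum e f n G₁ G₂ G l ξ X Y := by
  refine totalOne_ind (q := fun X => 𝒢.contract V C D G l ξ (𝒢.peAct V e f
    (𝒢.glue V (Equiv.refl (Fin (n + 1))) G (X ⊗ₜ Y))) =
      sgn k l • contractSum e f n G₁ G₂ G l ξ X Y) ?_ ?_ ?_ hX
  · simp only [contractSum_zero_left, TensorProduct.zero_tmul, map_zero, smul_zero]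
  · intro X X' h h'
    simp only [contractSum_add_left, TensorProduct.add_tmul, map_add, smul_add, h, h']
  intro i₀ p hp f₀ hf₀
  refine totalOne_ind (q := fun Y => 𝒢.contract V C D G l ξ (𝒢.peAct V e f
    (𝒢.glue V (Equiv.refl (Fin (n + 1))) G ((p ⊗ₜ f₀) ⊗ₜ Y))) =
      sgn k l • contractSum e f n G₁ G₂ G l ξ (p ⊗ₜ f₀) Y) ?_ ?_ ?_ hY
  · simp only [contractSum_zero_right, TensorProduct.tmul_zero, map_zero, smul_zero]
  · intro Y Y' h h'
    simp only [contractSum_add_right, TensorProduct.tmul_add, map_add, smul_add, h, h']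
  intro j₀ q hq g₀ _
  rw [glue_tmul (i := i₀) (j := j₀) _ G p g₀ hf₀ hq, contractSum_tmul e f n G₁ G₂ G l ξ hp hq,
    peAct, TensorProduct.map_tmul, contract_tmul, map_smul, map_smul, pr_act_prG, map_smul,
    smul_eq_mul, smul_smul, ← mul_assoc]
  congr 1
  by_cases h : l = i₀ + j₀
  · congr 1
    -- modulo `2`, `(1 - i) j ≡ (i + j) + i (1 + j)`
    rw [← sgn_add]
    refine sgn_eq_of_even_sub ⟨-(i₀ + i₀ * j₀), ?_⟩
    rw [h]; ring
  · rw [pr_deg_zero (P.act_deg e f (P.comp_deg (Equiv.refl (Fin (n + 1))) (𝒢.bi_le _ _ _ _ hp)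
      (𝒢.bi_le _ _ _ _ hq))) h, map_zero, mul_zero, mul_zero]

theorem evalFree_quadPart (γ : 𝒢.GenMap V) {X : 𝒢.PE V C₁ (D₁ ⊕ Fin (n + 1))}
    {Y : 𝒢.PE V (C₂ ⊕ Fin (n + 1)) D₂} (hX : ∀ i, γ.toFun _ _ G₁ i = 𝒢.contractLeft V _ _ G₁ i X)
    (hY : ∀ i, γ.toFun _ _ G₂ i = 𝒢.contractLeft V _ _ G₂ i Y) (i j : ℤ)
    (ξ : 𝒢.DualPart C D G l) :
    haveI := 𝒢.bi_finite C₁ (D₁ ⊕ Fin (n + 1)) G₁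
    haveI := 𝒢.bi_finite (C₂ ⊕ Fin (n + 1)) D₂ G₂
    evalFree γ C D (𝒢.quadPart e f n (G₁, i) (G₂, j) G l ξ) =
      ((n + 1).factorial : k)⁻¹ • sgn k (i * (1 + j)) •
        dualContract (contractPair e f n G₁ G₂ X Y i j) (𝒢.cocomp e f n G₁ G₂ G l i j ξ) := by
  have := 𝒢.bi_finite C₁ (D₁ ⊕ Fin (n + 1)) G₁
  have := 𝒢.bi_finite (C₂ ⊕ Fin (n + 1)) D₂ G₂
  rw [quadPart, LinearMap.smul_apply, map_smul, smul_smul, mul_comm, LinearMap.comp_apply]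
  refine congrArg _ (map_dualContract (W := 𝒢.Free C D) (W' := V.E C D) _
    (contractPair e f n G₁ G₂ X Y i j) (evalFree γ C D) (fun ζ θ => ?_)
    (𝒢.cocomp e f n G₁ G₂ G l i j ξ))
  simp only [contractPair, LinearMap.compr₂_apply, LinearMap.compl₁₂_apply]
  rw [evalFree_freeAct, evalFree_freeComp, evalFree_incl, evalFree_incl, hX, hY]

end Term

end Properad.StableGrading

end Composition

/-! ### Finiteness of the quadratic part of the differential -/

section Equation

variable {k : Type w} [Field k] {P : Properad.{w, u} k}

namespace Properad.StableGrading

variable {𝒢 : P.StableGrading} {V : DGVect.{w, v} k}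

section Finiteness

variable (𝒢) (C D : Type) [Finite C] [Finite D] (G : ℕ)

/-- The indices of the nonzero contributions to the composition in `P ⊗ End`. -/
def glueIndex : Set ((Set C × Set D) × ℕ × ℕ × ℕ) :=
  {s | ∃ x ∈ (⨆ i, 𝒢.bi s.1.1 (s.1.2 ⊕ Fin (s.2.1 + 1)) s.2.2.1 i : Submodule k _),
    ∃ y ∈ (⨆ i, 𝒢.bi (↥(s.1.1)ᶜ ⊕ Fin (s.2.1 + 1)) ↥(s.1.2)ᶜ s.2.2.2 i : Submodule k _),
      𝒢.prG _ _ G (P.comp (Equiv.refl (Fin (s.2.1 + 1))) x y) ≠ 0}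

/-- The finiteness condition on the operations, applied to each of the finitely many
decompositions. -/
theorem finite_glueIndex : (𝒢.glueIndex C D G).Finite := by
  have h : ∀ a : Set C × Set D, {t : ℕ × ℕ × ℕ | (a, t) ∈ 𝒢.glueIndex C D G}.Finite :=
    fun a => 𝒢.finitary a.1 a.2 ↥(a.1)ᶜ ↥(a.2)ᶜ G
  refine (Set.finite_iUnion fun a => (h a).image (Prod.mk a)).subset fun s hs => ?_
  exact Set.mem_iUnion.2 ⟨s.1, s.2, hs, rfl⟩

/-- Sorting the bidegrees of the two factors by genus and degree. -/
def bidegreeEquiv (α : Type) : (α × ℕ × ℕ × ℕ) × ℤ × ℤ ≃ α × ℕ × (ℕ × ℤ) × (ℕ × ℤ) where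
  toFun t := (t.1.1, t.1.2.1, (t.1.2.2.1, t.2.1), (t.1.2.2.2, t.2.2))
  invFun t := ((t.1, t.2.1, t.2.2.1.1, t.2.2.2.1), t.2.2.1.2, t.2.2.2.2)
  left_inv _ := rfl
  right_inv _ := rfl

/-- The degrees of the two factors that occur for a given index of the composition. -/
def glueDegrees (s : (Set C × Set D) × ℕ × ℕ × ℕ) : Finset (ℤ × ℤ) :=
  𝒢.degrees s.1.1 (s.1.2 ⊕ Fin (s.2.1 + 1)) s.2.2.1 ×ˢ
    𝒢.degrees (↥(s.1.1)ᶜ ⊕ Fin (s.2.1 + 1)) ↥(s.1.2)ᶜ s.2.2.2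

variable {C D}

open Classical in
/-- A nonzero term of the quadratic part of the differential has its index in the finite set
`glueIndex` and its degrees in `glueDegrees`. -/
theorem quadPart_ne_zero (l : ℤ) (t : ((Set C × Set D) × ℕ × ℕ × ℕ) × ℤ × ℤ)
    (h : 𝒢.quadPart (Equiv.Set.sumCompl t.1.1.1) (Equiv.Set.sumCompl t.1.1.2) t.1.2.1
      (t.1.2.2.1, t.2.1) (t.1.2.2.2, t.2.2) G l ≠ 0) :
    t.1 ∈ 𝒢.glueIndex C D G ∧ t.2 ∈ 𝒢.glueDegrees C D t.1 := by
  obtain ⟨⟨⟨S, T⟩, n, G₁, G₂⟩, i, j⟩ := t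
  have key : ¬ ∀ x ∈ 𝒢.bi S (T ⊕ Fin (n + 1)) G₁ i, ∀ y ∈ 𝒢.bi (↥Sᶜ ⊕ Fin (n + 1)) ↥Tᶜ G₂ j,
      𝒢.prG _ _ G (P.comp (Equiv.refl (Fin (n + 1))) x y) = 0 := by
    refine fun hxy => h (LinearMap.ext fun ξ => ?_)
    have := 𝒢.bi_finite S (T ⊕ Fin (n + 1)) G₁ i
    have := 𝒢.bi_finite (↥Sᶜ ⊕ Fin (n + 1)) ↥Tᶜ G₂ j
    rw [quadPart, LinearMap.smul_apply, LinearMap.comp_apply, LinearMap.zero_apply]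
    refine (congrArg _ ?_).trans (smul_zero _)
    refine (Submodule.mem_bot k).1 (mem_of_eq_zero _ _ ?_)
    refine TensorProduct.ext' fun x y => ?_
    simp only [LinearMap.lcomp_apply, LinearMap.comp_apply, TensorProduct.lift.tmul,
      LinearMap.compl₁₂_apply, Submodule.subtype_apply, LinearMap.zero_apply]
    rw [← pr_act_prG, hxy _ x.2 _ y.2, map_zero, map_zero, map_zero]
  push Not at key
  obtain ⟨x, hx, y, hy, hxy⟩ := key
  refine ⟨⟨x, le_iSup (fun i => 𝒢.bi S (T ⊕ Fin (n + 1)) G₁ i) i hx, y,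
    le_iSup (fun i => 𝒢.bi (↥Sᶜ ⊕ Fin (n + 1)) ↥Tᶜ G₂ i) j hy, hxy⟩, ?_⟩
  refine Finset.mem_product.2 ⟨?_, ?_⟩ <;> by_contra hd
  · exact hxy (by simp [eq_zero_of_notMem_degrees hd hx])
  · exact hxy (by simp [eq_zero_of_notMem_degrees hd hy])

open Classical in
/-- The quadratic part of the differential of a generator is a finite sum. -/
theorem map_quad {W : Type*} [AddCommGroup W] [Module k W] (F : 𝒢.Free C D →ₗ[k] W) (l : ℤ)
    (ξ : 𝒢.DualPart C D G l) : F (𝒢.quad C D G l ξ) =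
      ∑ᶠ s : (Set C × Set D) × ℕ × ℕ × ℕ, ∑ p ∈ 𝒢.glueDegrees C D s,
        F (𝒢.quadPart (Equiv.Set.sumCompl s.1.1) (Equiv.Set.sumCompl s.1.2) s.2.1
          (s.2.2.1, p.1) (s.2.2.2, p.2) G l ξ) := by
  have hfin : (Function.support fun t : ((Set C × Set D) × ℕ × ℕ × ℕ) × ℤ × ℤ =>
      𝒢.quadPart (Equiv.Set.sumCompl t.1.1.1) (Equiv.Set.sumCompl t.1.1.2) t.1.2.1
        (t.1.2.2.1, t.2.1) (t.1.2.2.2, t.2.2) G l).Finite := by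
    refine ((𝒢.finite_glueIndex C D G).biUnion fun s _ =>
      (𝒢.glueDegrees C D s).finite_toSet.image (Prod.mk s)).subset fun t ht => ?_
    obtain ⟨h1, h2⟩ := 𝒢.quadPart_ne_zero G l t ht
    exact Set.mem_biUnion h1 ⟨t.2, h2, rfl⟩
  -- By `hfin` the sum defining `quad` is not the value `0` assigned to sums with infinite support.
  rw [quad, ← finsum_comp_equiv (bidegreeEquiv (Set C × Set D))]
  refine (AddMonoidHom.map_finsum (F ∘ₗ LinearMap.applyₗ (R := k) ξ).toAddMonoidHom hfin).trans
    ((finsum_curry _ ?_).trans ?_)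
  · refine hfin.subset fun t ht h => ht ?_
    exact (congrArg (F ∘ₗ LinearMap.applyₗ (R := k) ξ) h).trans (map_zero _)
  · refine finsum_congr fun s => ?_
    refine finsum_eq_sum_of_support_subset _ fun p hp => ?_
    refine (𝒢.quadPart_ne_zero G l (s, p) fun h => hp ?_).2
    change F (𝒢.quadPart _ _ _ (s.2.2.1, p.1) (s.2.2.2, p.2) G l ξ) = 0
    rw [h, LinearMap.zero_apply, map_zero]

end Finiteness

/-! ### Families and maps on the generators -/

theorem mem_inv_iff {L : 𝒢.Family V} : L ∈ 𝒢.inv V ↔ ∀ m n G, L m n G ∈ 𝒢.total V _ _ G ∧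
    ∀ (ρ : Fin m ≃ Fin m) (σ : Fin n ≃ Fin n), 𝒢.peAct V ρ σ (L m n G) = L m n G := Iff.rfl

/-- For an invariant family the relabelling along arbitrary bijections is independent of their
choice. -/
theorem peAct_eq_transport {L : 𝒢.Family V} (hL : L ∈ 𝒢.inv V) {m n : ℕ} {C D : Type} [Finite C]
    [Finite D] (e : Fin m ≃ C) (f : Fin n ≃ D) (G : ℕ) :
    𝒢.peAct V e f (L m n G) = 𝒢.transport V L C D G := by
  obtain rfl : m = Nat.card C := (Nat.card_eq_of_equiv_fin e.symm).symm
  obtain rfl : n = Nat.card D := (Nat.card_eq_of_equiv_fin f.symm).symm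
  have h := (hL _ _ G).2 (e.trans (Finite.equivFin C)) (f.trans (Finite.equivFin D))
  rw [transport]
  conv_rhs => rw [← h]
  rw [peAct_peAct, Equiv.trans_assoc, Equiv.trans_assoc, Equiv.self_trans_symm,
    Equiv.self_trans_symm, Equiv.trans_refl, Equiv.trans_refl]

theorem transport_fin {L : 𝒢.Family V} (hL : L ∈ 𝒢.inv V) (m n G : ℕ) :
    𝒢.transport V L (Fin m) (Fin n) G = L m n G := by
  rw [← peAct_eq_transport hL (Equiv.refl _) (Equiv.refl _), peAct_refl]

theorem peAct_transport {L : 𝒢.Family V} (hL : L ∈ 𝒢.inv V) {C D C' D' : Type} [Finite C]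
    [Finite D] [Finite C'] [Finite D'] (ρ : C ≃ C') (σ : D ≃ D') (G : ℕ) :
    𝒢.peAct V ρ σ (𝒢.transport V L C D G) = 𝒢.transport V L C' D' G := by
  rw [transport, peAct_peAct, peAct_eq_transport hL]

theorem transport_mem_totalOne {L : 𝒢.Family V} (hL : 𝒢.IsHomogeneous V L 1) (C D : Type)
    [Finite C] [Finite D] (G : ℕ) : 𝒢.transport V L C D G ∈ 𝒢.totalOne V C D G :=
  peAct_mem_totalOne _ _ (hL _ _ G)

/-- The map on the generators given by contraction with an invariant family of degree `1`. -/
def genMap (L : 𝒢.Family V) (hL : L ∈ 𝒢.inv V) (hL1 : 𝒢.IsHomogeneous V L 1) : 𝒢.GenMap V where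
  toFun C D _ _ G i := 𝒢.contractLeft V C D G i (𝒢.transport V L C D G)
  map_act ρ σ G i ξ := by
    rw [contractLeft_apply, contractLeft_apply, ← contract_peAct, peAct_transport hL]
  map_deg G i ξ := contract_mem_homDeg i ξ (transport_mem_totalOne hL1 _ _ G)

/-- The family with contractions prescribed by a map on the generators. -/
def GenMap.family (γ : 𝒢.GenMap V) : 𝒢.Family V := fun m n G =>
  expand (γ.toFun (Fin m) (Fin n) G)

theorem GenMap.family_isHomogeneous (γ : 𝒢.GenMap V) : 𝒢.IsHomogeneous V γ.family 1 :=
  fun _ _ G => expand_mem_totalOne _ (γ.map_deg G)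

theorem GenMap.family_mem_inv (γ : 𝒢.GenMap V) : γ.family ∈ 𝒢.inv V := by
  refine mem_inv_iff.2 fun m n G => ⟨expand_mem _, fun ρ σ => ?_⟩
  refine total_ext (peAct_mem_total ρ σ (expand_mem _)) (expand_mem _) fun i ξ => ?_
  obtain ⟨ζ, rfl⟩ : ∃ ζ, 𝒢.dualAct ρ σ G i ζ = ξ := by
    refine ⟨𝒢.dualAct ρ.symm σ.symm G i ξ, LinearMap.ext fun x => ?_⟩
    obtain ⟨y, rfl⟩ : ∃ y, 𝒢.pr _ _ G i y = x := ⟨x, pr_of_mem x.2⟩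
    rw [dualAct_apply, dualAct_apply, P.act_act, Equiv.symm_symm, Equiv.symm_symm,
      Equiv.symm_trans_self, Equiv.symm_trans_self, P.act_refl]
  rw [contract_peAct, GenMap.family, contract_expand, contract_expand, γ.map_act]

theorem GenMap.contract_family (γ : 𝒢.GenMap V) {m n G : ℕ} (i : ℤ)
    (ξ : 𝒢.DualPart (Fin m) (Fin n) G i) :
    𝒢.contract V _ _ G i ξ (γ.family m n G) = γ.toFun _ _ G i ξ :=
  contract_expand _ _ _

/-- By equivariance the values for the standard finite sets determine a map on the generators. -/
theorem GenMap.ext {γ γ' : 𝒢.GenMap V} (h : ∀ (m n G : ℕ) (i : ℤ)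
    (ξ : 𝒢.DualPart (Fin m) (Fin n) G i), γ.toFun _ _ G i ξ = γ'.toFun _ _ G i ξ) : γ = γ' := by
  have key : γ.toFun = γ'.toFun := by
    funext C D _ _ G i
    refine LinearMap.ext fun ξ => ?_
    have h' := congrArg (V.homAct (Finite.equivFin C).symm (Finite.equivFin D).symm)
      (h _ _ G i (𝒢.dualAct (Finite.equivFin C) (Finite.equivFin D) G i ξ))
    rwa [← γ.map_act, ← γ'.map_act, V.homAct_homAct, V.homAct_homAct, Equiv.self_trans_symm,
      Equiv.self_trans_symm, V.homAct_refl, V.homAct_refl] at h'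
  cases γ
  cases γ'
  cases key
  rfl

theorem genMap_family (γ : 𝒢.GenMap V) :
    genMap γ.family γ.family_mem_inv γ.family_isHomogeneous = γ :=
  GenMap.ext fun m n G i ξ => by
    change 𝒢.contract V _ _ G i ξ (𝒢.transport V γ.family _ _ G) = _
    rw [transport_fin γ.family_mem_inv, γ.contract_family]

theorem family_genMap (L : 𝒢.Family V) (hL : L ∈ 𝒢.inv V) (hL1 : 𝒢.IsHomogeneous V L 1) :
    (genMap L hL hL1).family = L := by
  funext m n G
  refine total_ext (expand_mem _) (hL m n G).1 fun i ξ => ?_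
  refine (contract_expand _ _ _).trans ?_
  change 𝒢.contract V _ _ G i ξ (𝒢.transport V L _ _ G) = _
  rw [transport_fin hL]

/-! ### The master equation and the differential of the cobar complex -/

theorem masterD_mem_total {L : 𝒢.Family V} (hL : L ∈ 𝒢.inv V) (m n G : ℕ) :
    𝒢.masterD V L m n G ∈ 𝒢.total V _ _ G := by
  refine total_ind (q := fun X => TensorProduct.map (P.d (Fin m) (Fin n)) LinearMap.id X -
    TensorProduct.map (parity (P.internal (Fin m) (Fin n))) (V.homD (Fin m) (Fin n)) X ∈
      𝒢.total V _ _ G) ?_ ?_ ?_ (hL m n G).1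
  · simp only [map_zero, sub_zero, zero_mem]
  · intro X Y hX hY
    rw [map_add, map_add, add_sub_add_comm]
    exact add_mem hX hY
  · intro i p hp f
    rw [TensorProduct.map_tmul, TensorProduct.map_tmul,
      parity_apply_of_mem _ (𝒢.bi_le _ _ _ _ hp)]
    exact sub_mem (tmul_mem_total (𝒢.d_mem hp) _)
      (tmul_mem_total (Submodule.smul_mem _ _ hp) _)

theorem masterComp_mem_total (L : 𝒢.Family V) (m n G : ℕ) :
    𝒢.masterComp V L L m n G ∈ 𝒢.total V _ _ G := by
  classical
  refine finsum_induction (· ∈ 𝒢.total V _ _ G) (zero_mem _) (fun _ _ => add_mem) fun s => ?_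
  exact Submodule.smul_mem _ _ (peAct_mem_total _ _ (glue_mem_total _ G _))

theorem smul_sub_add_smul_sub {W : Type*} [AddCommGroup W] [Module k W] (c : k) (a a' b b' : W) :
    c • (a - b) + c • (a' - b') = c • (a + a' - (b + b')) := by
  rw [← smul_add, add_sub_add_comm]

theorem smul_sub_of_mul_self {W : Type*} [AddCommGroup W] [Module k W] {c : k} (hc : c * c = 1)
    (x y : k) (a b : W) : x • a - (c * y) • b = c • ((c * x) • a - y • b) := by
  rw [smul_sub, smul_smul, smul_smul, ← mul_assoc, hc, one_mul]

/-- The contraction of `d L` with `ξ` is the failure of the map on the generators to commute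
with the differentials of the dual of `P` and of the linear maps, up to the sign `(-1)^|ξ|`. -/
theorem contract_masterD {L : 𝒢.Family V} (hL : L ∈ 𝒢.inv V) {m n G : ℕ} (i : ℤ)
    (ξ : 𝒢.DualPart (Fin m) (Fin n) G i) : 𝒢.contract V _ _ G i ξ (𝒢.masterD V L m n G) =
      sgn k i • (𝒢.contract V _ _ G (i - 1) (𝒢.dualD _ _ G i ξ) (L m n G) -
        V.homD _ _ (𝒢.contract V _ _ G i ξ (L m n G))) := by
  refine total_ind (q := fun X => 𝒢.contract V _ _ G i ξ
    (TensorProduct.map (P.d (Fin m) (Fin n)) LinearMap.id X -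
      TensorProduct.map (parity (P.internal (Fin m) (Fin n))) (V.homD (Fin m) (Fin n)) X) =
      sgn k i • (𝒢.contract V _ _ G (i - 1) (𝒢.dualD _ _ G i ξ) X -
        V.homD _ _ (𝒢.contract V _ _ G i ξ X))) ?_ ?_ ?_ (hL m n G).1
  · simp only [map_zero, sub_zero]
    exact ((congrArg _ (sub_self (G := V.E (Fin m) (Fin n)) _)).trans (smul_zero _)).symm
  · intro X Y hX hY
    rw [map_add, map_add, add_sub_add_comm, map_add, hX, hY]
    simp only [map_add]
    exact smul_sub_add_smul_sub (W := V.E (Fin m) (Fin n)) _ _ _ _ _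
  · intro j p hp f
    have hd : 𝒢.dualD _ _ G i ξ (𝒢.pr _ _ G (i - 1) p) =
        sgn k i * ξ (𝒢.pr _ _ G i (P.d _ _ p)) := by
      change sgn k i • ξ (𝒢.pr _ _ G i (P.d _ _ (𝒢.pr _ _ G (i - 1) p : P.obj _ _))) = _
      rw [smul_eq_mul]
      by_cases hj : j = i - 1
      · subst hj
        rw [pr_of_mem hp]
      · rw [pr_of_mem_ne hp (fun h => hj (Prod.mk.inj h).2),
          pr_of_mem_ne (𝒢.d_mem hp) (fun h => hj (eq_sub_of_add_eq (Prod.mk.inj h).2)),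
          Submodule.coe_zero, map_zero, map_zero]
    have hp' : sgn k j • ξ (𝒢.pr _ _ G i p) = sgn k i • ξ (𝒢.pr _ _ G i p) := by
      by_cases hj : j = i
      · rw [hj]
      · rw [pr_of_mem_ne hp (fun h => hj (Prod.mk.inj h).2), map_zero, smul_zero, smul_zero]
    rw [TensorProduct.map_tmul, TensorProduct.map_tmul,
      parity_apply_of_mem _ (𝒢.bi_le _ _ _ _ hp), map_sub, contract_tmul, contract_tmul,
      contract_tmul, contract_tmul, hd, map_smul, map_smul, hp', map_smul]
    exact smul_sub_of_mul_self (W := V.E (Fin m) (Fin n)) (sgn_mul_self i) _ _ _ _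

theorem glue_eq_zero {C₁ D₁ C₂ D₂ A B : Type} [Finite C₁] [Finite D₁] [Finite C₂] [Finite D₂]
    [Finite A] [Finite B] [Nonempty B] (η : B ≃ A) {G₁ G₂ : ℕ} (G : ℕ)
    (h : ∀ x ∈ (⨆ i, 𝒢.bi C₁ (D₁ ⊕ B) G₁ i : Submodule k _),
      ∀ y ∈ (⨆ i, 𝒢.bi (C₂ ⊕ A) D₂ G₂ i : Submodule k _), 𝒢.prG _ _ G (P.comp η x y) = 0)
    {X : 𝒢.PE V C₁ (D₁ ⊕ B)} {Y : 𝒢.PE V (C₂ ⊕ A) D₂} (hX : X ∈ 𝒢.totalOne V _ _ G₁)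
    (hY : Y ∈ 𝒢.totalOne V _ _ G₂) : 𝒢.glue V η G (X ⊗ₜ Y) = 0 := by
  refine totalOne_ind (q := fun X => 𝒢.glue V η G (X ⊗ₜ Y) = 0) ?_ ?_ ?_ hX
  · rw [TensorProduct.zero_tmul, map_zero]
  · intro X X' hX hX'
    rw [TensorProduct.add_tmul, map_add, hX, hX', add_zero]
  intro i p hp f hf
  refine totalOne_ind (q := fun Y => 𝒢.glue V η G ((p ⊗ₜ f) ⊗ₜ Y) = 0) ?_ ?_ ?_ hY
  · rw [TensorProduct.tmul_zero, map_zero]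
  · intro Y Y' hY hY'
    rw [TensorProduct.tmul_add, map_add, hY, hY', add_zero]
  intro j q hq g _
  rw [glue_tmul (i := i) (j := j) η G p g hf hq,
    h p (le_iSup (fun i => 𝒢.bi C₁ (D₁ ⊕ B) G₁ i) i hp) q
      (le_iSup (fun i => 𝒢.bi (C₂ ⊕ A) D₂ G₂ i) j hq), smul_zero, TensorProduct.zero_tmul]

/-- The contraction of `L ∘ L` with `ξ` is the value on the quadratic part of `∂ ↑ξ`, up to the sign
`(-1)^|ξ|`. -/
theorem contract_masterComp {L : 𝒢.Family V} (hL : L ∈ 𝒢.inv V) (hL1 : 𝒢.IsHomogeneous V L 1)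
    {m n G : ℕ} (l : ℤ) (ξ : 𝒢.DualPart (Fin m) (Fin n) G l) :
    𝒢.contract V _ _ G l ξ (𝒢.masterComp V L L m n G) =
      sgn k l • evalFree (genMap L hL hL1) _ _ (𝒢.quad _ _ G l ξ) := by
  classical
  have hmem : ∀ (C D : Type) [Finite C] [Finite D] (G : ℕ),
      𝒢.transport V L C D G ∈ 𝒢.totalOne V C D G := fun C D _ _ G =>
    transport_mem_totalOne hL1 C D G
  refine Eq.trans ?_ (map_quad (W := V.E (Fin m) (Fin n)) 𝒢 G
    (sgn k l • evalFree (genMap L hL hL1) _ _) l ξ).symm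
  refine (AddMonoidHom.map_finsum (𝒢.contract V _ _ G l ξ).toAddMonoidHom
    ((𝒢.finite_glueIndex (Fin m) (Fin n) G).subset fun s hs => ?_)).trans
    (finsum_congr fun s => ?_)
  · by_contra hs'
    refine hs ?_
    simp only [glueIndex, Set.mem_ofPred_eq, not_exists, not_and, not_not] at hs'
    change _ • 𝒢.peAct V _ _ _ = 0
    rw [glue_eq_zero _ G hs' (hmem _ _ _) (hmem _ _ _), map_zero, smul_zero]
  · change 𝒢.contract V _ _ G l ξ (_ • 𝒢.peAct V _ _ _) = _
    rw [map_smul, contract_glue _ _ _ _ _ _ _ _ (hmem _ _ _) (hmem _ _ _), contractSum,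
      glueDegrees, Finset.sum_product, smul_comm, Finset.smul_sum, Finset.smul_sum]
    refine Finset.sum_congr rfl fun i _ => ?_
    rw [Finset.smul_sum, Finset.smul_sum]
    refine Finset.sum_congr rfl fun j _ => ?_
    exact congrArg _ (evalFree_quadPart _ _ _ _ _ _ _ _ (fun _ => rfl) (fun _ => rfl) i j ξ).symm

/-- The master equation for `L` says that the associated map on the free properad commutes with the
differentials on all generators. -/
theorem master_iff {L : 𝒢.Family V} (hL : L ∈ 𝒢.inv V) (hL1 : 𝒢.IsHomogeneous V L 1) :
    𝒢.masterD V L + 𝒢.masterComp V L L = 0 ↔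
      ∀ {C D : Type} [Finite C] [Finite D] (G : ℕ) (i : ℤ) (ξ : 𝒢.DualPart C D G i),
        evalFree (genMap L hL hL1) C D
          (𝒢.incl C D G (i - 1) (𝒢.dualD C D G i ξ) + 𝒢.quad C D G i ξ) =
          V.homD C D ((genMap L hL hL1).toFun C D G i ξ) := by
  have key : ∀ (m n G : ℕ) (i : ℤ) (ξ : 𝒢.DualPart (Fin m) (Fin n) G i),
      𝒢.contract V _ _ G i ξ ((𝒢.masterD V L + 𝒢.masterComp V L L) m n G) =
        sgn k i • (evalFree (genMap L hL hL1) _ _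
          (𝒢.incl _ _ G (i - 1) (𝒢.dualD _ _ G i ξ) + 𝒢.quad _ _ G i ξ) -
          V.homD _ _ ((genMap L hL hL1).toFun _ _ G i ξ)) := by
    intro m n G i ξ
    have hgen : ∀ (i : ℤ) (ζ : 𝒢.DualPart (Fin m) (Fin n) G i),
        (genMap L hL hL1).toFun _ _ G i ζ = 𝒢.contract V _ _ G i ζ (L m n G) := fun i ζ => by
      change 𝒢.contract V _ _ G i ζ (𝒢.transport V L _ _ G) = _
      rw [transport_fin hL]
    rw [Pi.add_apply, Pi.add_apply, Pi.add_apply, map_add, contract_masterD hL,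
      contract_masterComp hL hL1, map_add, evalFree_incl, hgen, hgen, ← smul_add]
    congr 1
    abel
  constructor
  · intro h C D _ _ G i ξ
    have h0 : ∀ (m n : ℕ) (ζ : 𝒢.DualPart (Fin m) (Fin n) G i), evalFree (genMap L hL hL1) _ _
        (𝒢.incl _ _ G (i - 1) (𝒢.dualD _ _ G i ζ) + 𝒢.quad _ _ G i ζ) =
        V.homD _ _ ((genMap L hL hL1).toFun _ _ G i ζ) := by
      intro m n ζ
      have h1 := key m n G i ζ
      rw [h] at h1
      have h2 := congrArg (fun z => sgn k i • z) h1
      simp only [Pi.zero_apply, map_zero, smul_zero, smul_smul, sgn_mul_self, one_smul] at h2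
      exact (sub_eq_zero.1 h2.symm)
    have h1 := congrArg (V.homAct (Finite.equivFin C).symm (Finite.equivFin D).symm)
      (h0 _ _ (𝒢.dualAct (Finite.equivFin C) (Finite.equivFin D) G i ξ))
    rw [dualD_dualAct, ← freeAct_incl, ← quad_act, ← map_add, evalFree_freeAct,
      ← (genMap L hL hL1).map_act, V.homD_homAct, V.homAct_homAct, V.homAct_homAct,
      Equiv.self_trans_symm, Equiv.self_trans_symm, V.homAct_refl, V.homAct_refl] at h1
    exact h1
  · intro h
    funext m n G
    refine total_ext (add_mem (masterD_mem_total hL m n G) (masterComp_mem_total L m n G))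
      (zero_mem _) fun i ξ => ?_
    refine (key m n G i ξ).trans ?_
    rw [h]
    exact ((congrArg _ (sub_self (G := V.E (Fin m) (Fin n)) _)).trans (smul_zero _)).trans
      (map_zero _).symm

end Properad.StableGrading

end Equation

/-! ### Morphisms from the cobar complex -/

section Morphisms

variable {k : Type w} [Field k] {P : Properad.{w, u} k}

namespace Properad.StableGrading

variable {𝒢 : P.StableGrading} {V : DGVect.{w, v} k}

/-- The restriction of a morphism to the generators. -/
def homGen (α : ProperadData.Hom 𝒢.cobar (endo V)) : 𝒢.GenMap V where
  toFun C D _ _ G i := α.toFun C D ∘ₗ 𝒢.incl C D G i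
  map_act {C D C' D' _ _ _ _} ρ σ G i ξ :=
    (α.map_act ρ σ (𝒢.incl C D G i ξ)).symm.trans
      (congrArg (α.toFun C' D') (freeAct_incl ρ σ G i ξ))
  map_deg G i ξ := α.map_deg (incl_mem G i ξ)

theorem evalFree_homGen (α : ProperadData.Hom 𝒢.cobar (endo V)) {C D : Type} [Finite C] [Finite D]
    (x : 𝒢.Free C D) : evalFree (homGen α) C D x = α.toFun C D x := by
  have key : ∀ {C D : Type} (a : 𝒢.Mon C D) [Finite C] [Finite D],
      evalMon (homGen α) a = α.toFun C D (𝒢.cls C D a.lin) := by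
    intro C D a
    induction a with
    | gen G i ξ => intro _ _; rfl
    | act ρ σ a ih =>
      intro _ _
      rw [← freeAct_cls, evalMon, ih]
      exact (α.map_act ρ σ _).symm
    | comp η a b iha ihb =>
      intro _ _
      rw [← freeComp_cls, evalMon, iha, ihb]
      exact (α.map_comp η _ _).symm
  induction x using free_ind with
  | h a => rw [evalFree_cls, evalLin_lin]; exact key a
  | h0 => exact (map_zero _).trans (map_zero _).symm
  | hadd x y hx hy => exact (map_add _ _ _).trans ((congrArg₂ _ hx hy).trans (map_add _ _ _).symm)
  | hsmul c x hx => exact (map_smul _ _ _).trans ((congrArg _ hx).trans (map_smul _ _ _).symm)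

/-- A morphism from the cobar complex is determined by its values on the generators. -/
theorem homGen_injective :
    Function.Injective (homGen : ProperadData.Hom 𝒢.cobar (endo V) → 𝒢.GenMap V) := by
  intro α β h
  have h' : α.toFun = β.toFun := by
    funext C D _ _
    refine LinearMap.ext fun x => ?_
    exact (evalFree_homGen α x).symm.trans
      ((congrArg (fun γ => evalFree γ C D x) h).trans (evalFree_homGen β x))
  cases α
  cases β
  cases h'
  rfl

theorem freeD_incl {C D : Type} [Finite C] [Finite D] (G : ℕ) (i : ℤ) (ξ : 𝒢.DualPart C D G i) :
    𝒢.freeD C D (𝒢.incl C D G i ξ) =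
      𝒢.incl C D G (i - 1) (𝒢.dualD C D G i ξ) + 𝒢.quad C D G i ξ := by
  change 𝒢.dLin C D (Mon.gen G i ξ).lin = _
  rw [dLin_lin, dMon]

theorem evalFree_homGen_differential (α : ProperadData.Hom 𝒢.cobar (endo V)) {C D : Type}
    [Finite C] [Finite D] (G : ℕ) (i : ℤ) (ξ : 𝒢.DualPart C D G i) :
    evalFree (homGen α) C D (𝒢.incl C D G (i - 1) (𝒢.dualD C D G i ξ) + 𝒢.quad C D G i ξ) =
      V.homD C D ((homGen α).toFun C D G i ξ) := by
  rw [← freeD_incl, evalFree_homGen]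
  exact α.map_d _

/-- The morphism extending a map on the generators that commutes with the differentials there. -/
def genHom (γ : 𝒢.GenMap V)
    (h : ∀ {C D : Type} [Finite C] [Finite D] (G : ℕ) (i : ℤ) (ξ : 𝒢.DualPart C D G i),
      evalFree γ C D (𝒢.incl C D G (i - 1) (𝒢.dualD C D G i ξ) + 𝒢.quad C D G i ξ) =
        V.homD C D (γ.toFun C D G i ξ)) : ProperadData.Hom 𝒢.cobar (endo V) where
  toFun C D _ _ := evalFree γ C D
  map_deg hx := evalFree_mem γ hx
  map_d x := evalFree_freeD γ h x
  map_act ρ σ x := evalFree_freeAct γ ρ σ x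
  map_comp η x y := evalFree_freeComp γ η x y

theorem homGen_genHom (γ : 𝒢.GenMap V)
    (h : ∀ {C D : Type} [Finite C] [Finite D] (G : ℕ) (i : ℤ) (ξ : 𝒢.DualPart C D G i),
      evalFree γ C D (𝒢.incl C D G (i - 1) (𝒢.dualD C D G i ξ) + 𝒢.quad C D G i ξ) =
        V.homD C D (γ.toFun C D G i ξ)) : homGen (genHom γ h) = γ :=
  GenMap.ext fun _ _ G i ξ => evalFree_incl γ G i ξ

variable (𝒢 V) in
/-- The bijection between algebras over the cobar complex and solutions of the master equation. -/
def homEquivSolution : ProperadData.Hom 𝒢.cobar (endo V) ≃ 𝒢.Solution V where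
  toFun α := ⟨(homGen α).family, (homGen α).family_mem_inv, (homGen α).family_isHomogeneous,
    (master_iff (homGen α).family_mem_inv (homGen α).family_isHomogeneous).2 <| by
      rw [genMap_family]
      exact evalFree_homGen_differential α⟩
  invFun L := genHom (genMap L.1 L.2.1 L.2.2.1) ((master_iff L.2.1 L.2.2.1).1 L.2.2.2)
  left_inv α := homGen_injective ((homGen_genHom _ _).trans (genMap_family (homGen α)))
  right_inv L := Subtype.ext ((congrArg GenMap.family (homGen_genHom _ _)).trans
    (family_genMap L.1 L.2.1 L.2.2.1))

end Properad.StableGrading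

end Morphisms

end CobarMaster

end

theorem theorem32 {k : Type w} [Field k] [CharZero k] (P : CobarMaster.Properad.{w, u} k)
    (𝒢 : P.StableGrading) (V : CobarMaster.DGVect.{w, v} k) :
    ∃ Φ : CobarMaster.ProperadData.Hom 𝒢.cobar (CobarMaster.endo V) ≃ 𝒢.Solution V,
      ∀ (α : CobarMaster.ProperadData.Hom 𝒢.cobar (CobarMaster.endo V)) (m n G : ℕ) (i : ℤ)
        (ξ : 𝒢.DualPart (Fin m) (Fin n) G i),
        𝒢.contract V (Fin m) (Fin n) G i ξ ((Φ α).1 m n G) =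
          α.toFun (Fin m) (Fin n) (𝒢.incl (Fin m) (Fin n) G i ξ) :=
  ⟨CobarMaster.Properad.StableGrading.homEquivSolution 𝒢 V, fun α _ _ _ i ξ =>
    (CobarMaster.Properad.StableGrading.homGen α).contract_family i ξ⟩
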